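/- Let $n\in\mathbb N$ and let $\mathcal P_2=\mathcal P_2(\mathbb R^n)$ be the set of Borel probability measures on $\mathbb R^n$ with finite second moment, with the Wasserstein metric $W_2$. A functional $G:\mathcal P_2\to\mathbb R$ has a functional derivative $\frac{dG}{dm}:\mathcal P_2\times\mathbb R^n\to\mathbb R$ if the latter is continuous, $|\frac{dG}{dm}(m)(x)|\le c(m)(1+|x|^2)$ with $c\ge 0$ bounded on bounded subsets of $\mathcal P_2$, $G(m')-G(m)=\int_0^1\!\int\frac{dG}{dm}(m+\theta(m'-m))(x)\,d(m'-m)(x)\,d\theta$ and $\int\frac{dG}{dm}(m)\,dm=0$. It has a second order functional derivative $\frac{d^2G}{dm^2}:\mathcal P_2\times\mathbb R^n\times\mathbb R^n\to\mathbb R$ if the latter is continuous, symmetric in its last two arguments, bounded by $c(m)(1+|x|^2+|\tilde x|^2)$ with $c$ as before, has integral $0$ against $m$ in either variable, and $G(m')-G(m)=\int\frac{dG}{dm}(m)\,d(m'-m)+\int_0^1\!\int_0^1\!\iint\theta\,\frac{d^2G}{dm^2}(m+\lambda\theta(m'-m))(x,\tilde x)\,d(m'-m)(x)\,d(m'-m)(\tilde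 x)\,d\lambda\,d\theta$. $D$ denotes the gradient in the space variable. Let $T>0$, let $A,B,N$ be real $n\times n$ matrices with $N$ symmetric and invertible, let $f,h:\mathbb R^n\times\mathcal P_2\to\mathbb R$, and put $F(m)=\int f(x,m)\,dm(x)$, $F_T(m)=\int h(x,m)\,dm(x)$. Assume that there are constants $c,\nu,\nu_T>0$ and $M,M_T$ such that: (A1) $BN^{-1}B^*x\cdot x\ge c|x|^2$ for all $x$; (A2) $f(\cdot,m)$ is $C^2$; for every $x$ the functional $f(x,\cdot)$ has first and second order functional derivatives $\frac{\partial f}{\partial m}(x,m)(\xi)$, the first being $C^2$ in $\xi$, and $\frac{\partial^2 f}{\partial m^2}(x,m)(\xi_1,\xi_2)$; the mixed derivatives below exist; and, for all arguments, $\nu|y|^2\le\frac{\partial^2 f}{\partial x^2}(x,m)y\cdot y\le M|y|^2$, $\nu|y|^2\le D_\xi^2\frac{\partial f}{\partial m}(x,m)(\xi)y\cdot y\le M|y|^2$, $D_\xi\frac{\partial^2 f}{\partial x\partial m}(x,m)(\xi)=0$, $D_{\xi_1}D_{\xi_2}\frac{\partial^2 f}{\partial m^2}(x,m)(\xi_1,\xi_2)=0$;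 (A3) $h$ satisfies the same with $\nu_T,M_T$ in place of $\nu,M$; (A4) $|A|<M\,|BN^{-1}B^*|$ in the matrix $2$-norm. For $m\in\mathcal P_2$ let $\mathcal H_m=L^2_m(\mathbb R^n;\mathbb R^n)$, on which matrices act pointwise, and for $X\in\mathcal H_m$ let $X\otimes m=X_\#m$; a functional $G$ on $\mathcal P_2$ is extended to $\mathcal H_m$ by $X\mapsto G(X\otimes m)$, with gradient $D_XG(X\otimes m)$. For $t\in[0,T]$ and $v\in L^2(t,T;\mathcal H_m)$ let $x_{x,m,t}(s;v)=x+\int_t^s[Ax_{x,m,t}(\tau;v)+Bv_{x}(\tau)]d\tau$, $$J_{m,t}(v)=\int_t^TF(x_{\cdot,m,t}(s;v)_\#m)\,ds+F_T(x_{\cdot,m,t}(T;v)_\#m)+\tfrac12\int_t^T\!\!\int v_x(s)\cdot Nv_x(s)\,dm(x)\,ds,$$ and $V(m,t)=\inf_vJ_{m,t}(v)$. For $X\in\mathcal H_m$ the lifted problem is to minimise, over the controls $v\in L^2(t,T;\mathcal H_m)$ with $v(s)$ $\sigma(X)$-measurable, $\int_t^TF(X(s)\otimes m)ds+F_T(X(T)\otimes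 m)+\frac12\int_t^T\langle v,Nv\rangle_{\mathcal H_m}ds$, where $X(s)=X+\int_t^s[AX(\tau)+Bv(\tau)]d\tau$; its value is $V(X,t)$. Then $F$ and $F_T$ have functional derivatives that are differentiable in $x$, their extensions to $\mathcal H_m$ are differentiable, and the following hold for all $m\in\mathcal P_2$ and $t\in[0,T]$. 1. There is exactly one pair $(Y_{x,m,t},Z_{x,m,t})_{x\in\mathbb R^n}$, continuous on $[t,T]$ for every $x$ and with $Y_{\cdot,m,t}(s)\in\mathcal H_m$, such that, for all $x\in\mathbb R^n$ and $s\in[t,T]$, $$Y_{x,m,t}(s)=x+\int_t^s[AY_{x,m,t}-BN^{-1}B^*Z_{x,m,t}]\,d\tau,$$ $$Z_{x,m,t}(s)=\int_s^T\Big[A^*Z_{x,m,t}+D\tfrac{dF}{dm}(Y_{\cdot,m,t}(\tau)\otimes m)(Y_{x,m,t}(\tau))\Big]d\tau+D\tfrac{dF_T}{dm}(Y_{\cdot,m,t}(T)\otimes m)(Y_{x,m,t}(T)).$$ The control $-N^{-1}B^*Z_{x,m,t}(s)$, with state $Y_{\cdot,m,t}$, is the unique optimal control for $J_{m,t}$,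 and $V(m,t)$ is its cost. 2. $V(\cdot,t)$ has a functional derivative, differentiable in $x$; up to the additive constant (in $x$) fixed by the normalisation, $\frac{dV}{dm}(m,t)(x)$ equals $\int_t^T\frac{dF}{dm}(Y_{\cdot,m,t}(s)\otimes m)(Y_{x,m,t}(s))ds+\frac{dF_T}{dm}(Y_{\cdot,m,t}(T)\otimes m)(Y_{x,m,t}(T))+\frac12\int_t^TN^{-1}B^*Z_{x,m,t}\cdot B^*Z_{x,m,t}\,ds$. Moreover $D\frac{dV}{dm}(m,t)(x)=Z_{x,m,t}(t)$ and $Z_{x,m,t}(s)=D\frac{dV}{dm}(Y_{\cdot,m,t}(s)\otimes m,s)(Y_{x,m,t}(s))$ for all $x\in\mathbb R^n$, $s\in[t,T]$. 3. For every $X\in\mathcal H_m$ the system $Y_{Xt}(s)=X+\int_t^s[AY_{Xt}-BN^{-1}B^*Z_{Xt}]d\tau$, $Z_{Xt}(s)=\int_s^T[A^*Z_{Xt}+D_XF(Y_{Xt}(\tau)\otimes m)]d\tau+D_XF_T(Y_{Xt}(T)\otimes m)$ has exactly one solution in $C([t,T];\mathcal H_m)^2$; $-N^{-1}B^*Z_{Xt}$,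 with state $Y_{Xt}$, is the unique optimal control of the lifted problem, and $V(X,t)$ is its cost and equals $V(X\otimes m,t)$; $D_XV(X\otimes m,t)=Z_{Xt}(t)=D\frac{dV}{dm}(X\otimes m,t)(X(\cdot))$, and $Z_{Xt}(s)=D_XV(Y_{Xt}(s)\otimes m,s)$ for $s\in[t,T]$. 4. On $\mathcal H_m\times[0,T]$, the function $(X,t)\mapsto V(X\otimes m,t)$ is the unique solution of $$-\partial_tW-\langle D_XW,AX\rangle_{\mathcal H_m}+\tfrac12\langle D_XW,BN^{-1}B^*D_XW\rangle_{\mathcal H_m}=F(X\otimes m),\qquad W(X,T)=F_T(X\otimes m),$$ among the functions $W$ differentiable in $t$ and in $X$ whose gradient $D_XW$ is Lipschitz in $X$ uniformly in $t$ and continuous in $t$. 5. $V$ solves the Bellman equation on $\mathcal P_2(\mathbb R^n)$: for all $m\in\mathcal P_2$ and $t\in[0,T]$ (with one-sided time derivatives at the end points) $$-\partial_tV(m,t)-\int D\tfrac{dV}{dm}(m,t)(x)\cdot Ax\,dm(x)+\tfrac12\int D\tfrac{dV}{dm}(m,t)(x)\cdot BN^{-1}B^*D\tfrac{dV}{dm}(m,t)(x)\,dm(x)=F(m),$$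 both integrands being $m$-integrable, and $V(m,T)=F_T(m)$. -/

import Mathlib

open MeasureTheory Set
open scoped InnerProductSpace NNReal

noncomputable section

namespace MFTC

/-! ### The Wasserstein space -/

/-- The Euclidean space `ℝⁿ`. -/
abbrev E (n : ℕ) := EuclideanSpace ℝ (Fin n)

/-- Borel probability measures on `ℝⁿ` with finite second moment. -/
structure P2 (n : ℕ) where
  toMeasure : Measure (E n)
  isProb : IsProbabilityMeasure toMeasure
  sq_integrable : Integrable (fun x => ‖x‖ ^ 2) toMeasure

instance {n : ℕ} (m : P2 n) : IsProbabilityMeasure m.toMeasure := m.isProb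

/-- The quadratic Wasserstein distance. -/
def W2 {n : ℕ} (μ ν : P2 n) : ℝ :=
  Real.sqrt (sInf {c : ℝ | ∃ π : Measure (E n × E n),
    π.map Prod.fst = μ.toMeasure ∧ π.map Prod.snd = ν.toMeasure ∧
    c = ∫ p, ‖p.1 - p.2‖ ^ 2 ∂π})

/-- The unit mass at the origin. -/
def diracZero (n : ℕ) : P2 n where
  toMeasure := Measure.dirac 0
  isProb := inferInstance
  sq_integrable := integrable_dirac (by simp)

open Classical in
/-- The push-forward `X ⊗ m = X_# m` of `m` by a square integrable field `X`
(by convention `m` itself if `X` is not square integrable). -/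
def push {n : ℕ} (m : P2 n) (X : E n → E n) : P2 n :=
  if h : MemLp X 2 m.toMeasure then
    { toMeasure := m.toMeasure.map X
      isProb := Measure.isProbabilityMeasure_map h.aestronglyMeasurable.aemeasurable
      sq_integrable := by
        have hc : Continuous (fun x : E n => ‖x‖ ^ 2) := by fun_prop
        rw [integrable_map_measure hc.aestronglyMeasurable h.aestronglyMeasurable.aemeasurable]
        exact (memLp_two_iff_integrable_sq_norm h.aestronglyMeasurable).1 h }
  else m

/-- The mixture `m + θ (m' - m)` for `θ ∈ [0, 1]` (`θ` is clamped to `[0, 1]`). -/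
def mix {n : ℕ} (m m' : P2 n) (θ : ℝ) : P2 n where
  toMeasure := ENNReal.ofReal (1 - projIcc (0 : ℝ) 1 zero_le_one θ) • m.toMeasure +
    ENNReal.ofReal (projIcc (0 : ℝ) 1 zero_le_one θ) • m'.toMeasure
  isProb := by
    constructor
    have h0 := (projIcc (0 : ℝ) 1 zero_le_one θ).2.1
    have h1 := (projIcc (0 : ℝ) 1 zero_le_one θ).2.2
    simp only [Measure.add_apply, Measure.smul_apply, measure_univ, smul_eq_mul, mul_one]
    rw [← ENNReal.ofReal_add (by linarith) h0]
    simp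
  sq_integrable := (m.sq_integrable.smul_measure ENNReal.ofReal_ne_top).add_measure
    (m'.sq_integrable.smul_measure ENNReal.ofReal_ne_top)

/-- `∫ φ d(m' - m)`. -/
def intDiff {n : ℕ} (m m' : P2 n) (φ : E n → ℝ) : ℝ :=
  (∫ x, φ x ∂m'.toMeasure) - ∫ x, φ x ∂m.toMeasure

/-- `c : P₂ → [0, ∞)` is bounded on bounded subsets of `P₂`. -/
def BoundedOnBounded {n : ℕ} (c : P2 n → ℝ) : Prop :=
  (∀ m, 0 ≤ c m) ∧ ∀ R : ℝ, ∃ K : ℝ, ∀ m, W2 m (diracZero n) ≤ R → c m ≤ K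

/-! ### Functional derivatives -/

/-- `φ` is the (normalised) functional derivative `dF/dm` of `F : P₂(ℝⁿ) → ℝ`. -/
structure HasFunctionalDeriv {n : ℕ} (F : P2 n → ℝ) (φ : P2 n → E n → ℝ) : Prop where
  /-- joint continuity on `P₂ × ℝⁿ` -/
  cont : ∀ m x, ∀ ε > 0, ∃ δ > 0, ∀ m' x', W2 m' m < δ → ‖x' - x‖ < δ →
    |φ m' x' - φ m x| < ε
  growth : ∃ c : P2 n → ℝ, BoundedOnBounded c ∧ ∀ m x, |φ m x| ≤ c m * (1 + ‖x‖ ^ 2)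
  eq : ∀ m m', F m' - F m = ∫ θ in (0 : ℝ)..1, intDiff m m' (φ (mix m m' θ))
  normalized : ∀ m, ∫ x, φ m x ∂m.toMeasure = 0

/-- `φ` is the functional derivative and `ψ` the second order functional derivative of `F`. -/
structure HasSecondFunctionalDeriv {n : ℕ} (F : P2 n → ℝ) (φ : P2 n → E n → ℝ)
    (ψ : P2 n → E n → E n → ℝ) : Prop where
  first : HasFunctionalDeriv F φ
  /-- joint continuity on `P₂ × ℝⁿ × ℝⁿ` -/
  cont : ∀ m x y, ∀ ε > 0, ∃ δ > 0, ∀ m' x' y', W2 m' m < δ → ‖x' - x‖ < δ →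
    ‖y' - y‖ < δ → |ψ m' x' y' - ψ m x y| < ε
  growth : ∃ c : P2 n → ℝ, BoundedOnBounded c ∧
    ∀ m x y, |ψ m x y| ≤ c m * (1 + ‖x‖ ^ 2 + ‖y‖ ^ 2)
  eq : ∀ m m', F m' - F m = intDiff m m' (φ m) +
    ∫ θ in (0 : ℝ)..1, ∫ l in (0 : ℝ)..1,
      θ * intDiff m m' (fun y => intDiff m m' (fun x => ψ (mix m m' (l * θ)) x y))
  normalized_right : ∀ m x, ∫ y, ψ m x y ∂m.toMeasure = 0
  normalized_left : ∀ m y, ∫ x, ψ m x y ∂m.toMeasure = 0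
  symm : ∀ m x y, ψ m x y = ψ m y x

open Classical in
/-- The functional derivative `dF/dm (m)(x)` (zero if it does not exist). -/
def functionalDeriv {n : ℕ} (F : P2 n → ℝ) : P2 n → E n → ℝ :=
  if h : ∃ φ, HasFunctionalDeriv F φ then h.choose else 0

/-- `D (dF/dm) (m)(x)`, the gradient in `x` of the functional derivative. -/
def Ddm {n : ℕ} (F : P2 n → ℝ) (m : P2 n) (x : E n) : E n :=
  gradient (functionalDeriv F m) x

/-- The standing assumption on a running or terminal coefficient `f(x, m)`: all derivatives
written below exist, and
`lo |y|² ≤ ∂²f/∂x² (x,m) y·y ≤ hi |y|²`, `lo |y|² ≤ D_ξ² ∂f/∂m (x,m)(ξ) y·y ≤ hi |y|²`,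
`D_ξ ∂²f/∂x∂m (x,m)(ξ) = 0`, `D_ξ₁ D_ξ₂ ∂²f/∂m² (x,m)(ξ₁,ξ₂) = 0`. -/
def CoefficientAssumption {n : ℕ} (f : E n → P2 n → ℝ) (lo hi : ℝ) : Prop :=
  ∃ (p : E n → P2 n → E n → ℝ) (q : E n → P2 n → E n → E n → ℝ),
    (∀ x, HasSecondFunctionalDeriv (f x) (p x) (q x)) ∧
    (∀ m, ContDiff ℝ 2 (fun x => f x m)) ∧
    (∀ x m, ContDiff ℝ 2 (p x m)) ∧
    (∀ x m y, lo * ‖y‖ ^ 2 ≤ fderiv ℝ (fderiv ℝ (fun x' => f x' m)) x y y ∧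
      fderiv ℝ (fderiv ℝ (fun x' => f x' m)) x y y ≤ hi * ‖y‖ ^ 2) ∧
    (∀ x m ξ y, lo * ‖y‖ ^ 2 ≤ fderiv ℝ (fderiv ℝ (p x m)) ξ y y ∧
      fderiv ℝ (fderiv ℝ (p x m)) ξ y y ≤ hi * ‖y‖ ^ 2) ∧
    (∀ m ξ, Differentiable ℝ (fun x => p x m ξ)) ∧
    (∀ x m ξ, HasFDerivAt (fun ξ' => fderiv ℝ (fun x' => p x' m ξ') x)
      (0 : E n →L[ℝ] E n →L[ℝ] ℝ) ξ) ∧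
    (∀ x m ξ₁, Differentiable ℝ (q x m ξ₁)) ∧
    (∀ x m ξ₁ ξ₂, HasFDerivAt (fun ξ => fderiv ℝ (q x m ξ) ξ₂)
      (0 : E n →L[ℝ] E n →L[ℝ] ℝ) ξ₁)

/-! ### The mean field type control problem -/

/-- The data of the problem: matrices `A`, `B`, an invertible matrix `N`, coefficients `f`, `h`
and a horizon `T`. -/
structure ControlData (n : ℕ) where
  A : E n →L[ℝ] E n
  B : E n →L[ℝ] E n
  N : E n ≃L[ℝ] E n
  f : E n → P2 n → ℝ
  h : E n → P2 n → ℝ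
  T : ℝ

variable {n : ℕ}

namespace ControlData

/-- `F(m) = ∫ f(x, m) dm(x)`. -/
def F (P : ControlData n) (m : P2 n) : ℝ := ∫ x, P.f x m ∂m.toMeasure

/-- `F_T(m) = ∫ h(x, m) dm(x)`. -/
def FT (P : ControlData n) (m : P2 n) : ℝ := ∫ x, P.h x m ∂m.toMeasure

/-- `B*`. -/
def Bstar (P : ControlData n) : E n →L[ℝ] E n := ContinuousLinearMap.adjoint P.B

/-- `A*`. -/
def Astar (P : ControlData n) : E n →L[ℝ] E n := ContinuousLinearMap.adjoint P.A

/-- `N`, as a matrix. -/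
def Nmat (P : ControlData n) : E n →L[ℝ] E n := P.N

/-- `N⁻¹`. -/
def Ninv (P : ControlData n) : E n →L[ℝ] E n := P.N.symm

/-- `B N⁻¹ B*`. -/
def S (P : ControlData n) : E n →L[ℝ] E n := P.B ∘L P.Ninv ∘L P.Bstar

/-- Feasible controls `v ∈ L²(t, T; L²_m(ℝⁿ; ℝⁿ))`, as jointly measurable fields `v s x`. -/
def IsControl (P : ControlData n) (m : P2 n) (t : ℝ) (v : ℝ → E n → E n) : Prop :=
  MemLp (Function.uncurry v) 2 ((volume.restrict (Ioc t P.T)).prod m.toMeasure)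

/-- `y s x` is the state `x_{x,m,t}(s; v)`. The equation is required for `m`-almost every `x`,
since `v` is only defined up to null sets; `y s` lies in `L²_m`. -/
structure IsState (P : ControlData n) (m : P2 n) (t : ℝ) (v y : ℝ → E n → E n) : Prop where
  memLp : ∀ s ∈ Icc t P.T, MemLp (y s) 2 m.toMeasure
  eq : ∀ᵐ x ∂m.toMeasure, ContinuousOn (fun s => y s x) (Icc t P.T) ∧
    ∀ s ∈ Icc t P.T, y s x = x + ∫ τ in t..s, (P.A (y τ x) + P.B (v τ x))

/-- The objective functional `J_{m,t}(v)`, evaluated along the state `y`. -/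
def cost (P : ControlData n) (m : P2 n) (t : ℝ) (v y : ℝ → E n → E n) : ℝ :=
  (∫ s in t..P.T, P.F (push m (y s))) + P.FT (push m (y P.T)) +
    1 / 2 * ∫ s in t..P.T, ∫ x, ⟪v s x, P.Nmat (v s x)⟫_ℝ ∂m.toMeasure

/-- The value function `V(m, t)`. -/
def V (P : ControlData n) (m : P2 n) (t : ℝ) : ℝ :=
  sInf {c : ℝ | ∃ v y, P.IsControl m t v ∧ P.IsState m t v y ∧ c = P.cost m t v y}

/-- `v` is an optimal control. -/
def IsOptimal (P : ControlData n) (m : P2 n) (t : ℝ) (v : ℝ → E n → E n) : Prop :=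
  P.IsControl m t v ∧ ∃ y, P.IsState m t v y ∧
    ∀ v' y', P.IsControl m t v' → P.IsState m t v' y' → P.cost m t v y ≤ P.cost m t v' y'

/-- `(Y, Z)`, with `Y s x = Y_{x,m,t}(s)` and `Z s x = Z_{x,m,t}(s)`, solves the forward-backward
system for every starting point `x ∈ ℝⁿ`. -/
structure IsFBODE (P : ControlData n) (m : P2 n) (t : ℝ) (Y Z : ℝ → E n → E n) : Prop where
  memLp : ∀ s ∈ Icc t P.T, MemLp (Y s) 2 m.toMeasure
  contY : ∀ x, ContinuousOn (fun s => Y s x) (Icc t P.T)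
  contZ : ∀ x, ContinuousOn (fun s => Z s x) (Icc t P.T)
  eqY : ∀ x, ∀ s ∈ Icc t P.T, Y s x = x + ∫ τ in t..s, (P.A (Y τ x) - P.S (Z τ x))
  eqZ : ∀ x, ∀ s ∈ Icc t P.T, Z s x =
    (∫ τ in s..P.T, (P.Astar (Z τ x) + Ddm P.F (push m (Y τ)) (Y τ x))) +
      Ddm P.FT (push m (Y P.T)) (Y P.T x)

/-! ### The lifted problem -/

/-- The Hilbert space `H_m = L²_m(ℝⁿ; ℝⁿ)`. -/
abbrev H (m : P2 n) := Lp (E n) 2 m.toMeasure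

/-- A matrix acting pointwise on `H_m`. -/
def lift (m : P2 n) (L : E n →L[ℝ] E n) : H m →L[ℝ] H m := L.compLpL 2 m.toMeasure

/-- The extension `X ↦ G(X ⊗ m)` to `H_m` of a function `G` on `P₂`. -/
def ext (m : P2 n) (G : P2 n → ℝ) (X : H m) : ℝ := G (push m X)

/-- The controls `L²_X(t, T; H_m)`: square integrable, with `v s` measurable for `σ(X)`. -/
def IsLiftedControl (P : ControlData n) (m : P2 n) (X : H m) (t : ℝ) (v : ℝ → H m) : Prop :=
  MemLp v 2 (volume.restrict (Ioc t P.T)) ∧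
    ∀ᵐ s ∂(volume.restrict (Ioc t P.T)),
      v s ∈ lpMeas (E n) ℝ (MeasurableSpace.comap (X : E n → E n) inferInstance) 2 m.toMeasure

/-- `Y` is the state of the lifted dynamics with initial datum `X` and control `v`. -/
def IsLiftedState (P : ControlData n) (m : P2 n) (X : H m) (t : ℝ) (v Y : ℝ → H m) : Prop :=
  ContinuousOn Y (Icc t P.T) ∧
    ∀ s ∈ Icc t P.T, Y s = X + ∫ τ in t..s, (lift m P.A (Y τ) + lift m P.B (v τ))

/-- The lifted objective functional `J_{Xt}(v)`, evaluated along the state `Y`. -/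
def liftedCost (P : ControlData n) (m : P2 n) (t : ℝ) (v Y : ℝ → H m) : ℝ :=
  (∫ s in t..P.T, ext m P.F (Y s)) + ext m P.FT (Y P.T) +
    1 / 2 * ∫ s in t..P.T, ⟪v s, lift m P.Nmat (v s)⟫_ℝ

/-- The lifted value function `V(X, t)`. -/
def liftedV (P : ControlData n) (m : P2 n) (X : H m) (t : ℝ) : ℝ :=
  sInf {c : ℝ | ∃ v Y, P.IsLiftedControl m X t v ∧ P.IsLiftedState m X t v Y ∧
    c = P.liftedCost m t v Y}

/-- `v` is an optimal control of the lifted problem. -/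
def IsLiftedOptimal (P : ControlData n) (m : P2 n) (X : H m) (t : ℝ) (v : ℝ → H m) : Prop :=
  P.IsLiftedControl m X t v ∧ ∃ Y, P.IsLiftedState m X t v Y ∧
    ∀ v' Y', P.IsLiftedControl m X t v' → P.IsLiftedState m X t v' Y' →
      P.liftedCost m t v Y ≤ P.liftedCost m t v' Y'

/-- `(Y, Z)` solves the forward-backward system in `H_m` with initial datum `X` at time `t`. -/
structure IsLiftedFBODE (P : ControlData n) (m : P2 n) (X : H m) (t : ℝ) (Y Z : ℝ → H m) :
    Prop where
  contY : ContinuousOn Y (Icc t P.T)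
  contZ : ContinuousOn Z (Icc t P.T)
  eqY : ∀ s ∈ Icc t P.T, Y s = X + ∫ τ in t..s, (lift m P.A (Y τ) - lift m P.S (Z τ))
  eqZ : ∀ s ∈ Icc t P.T, Z s =
    (∫ τ in s..P.T, (lift m P.Astar (Z τ) + gradient (ext m P.F) (Y τ))) +
      gradient (ext m P.FT) (Y P.T)

/-- `W` is a classical solution on `H_m × [0, T]` of the lifted Bellman equation
`-∂_t W - ⟨D_X W, A X⟩ + ½ ⟨D_X W, B N⁻¹ B* D_X W⟩ = F(X ⊗ m)`, `W(X, T) = F_T(X ⊗ m)`,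
whose gradient `G = D_X W` is Lipschitz in `X` uniformly in `t`, and continuous in `t`. -/
def IsLiftedBellmanSolution (P : ControlData n) (m : P2 n) (W : H m → ℝ → ℝ) : Prop :=
  ∃ G : H m → ℝ → H m,
    (∀ t ∈ Icc 0 P.T, ∀ X, HasGradientAt (fun X' => W X' t) (G X t) X) ∧
    (∃ K : ℝ≥0, ∀ t ∈ Icc 0 P.T, LipschitzWith K (fun X => G X t)) ∧
    (∀ X, ContinuousOn (G X) (Icc 0 P.T)) ∧
    (∀ X, ∀ t ∈ Icc 0 P.T, ∃ w : ℝ, HasDerivWithinAt (W X) w (Icc 0 P.T) t ∧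
      -w - ⟪G X t, lift m P.A X⟫_ℝ + 1 / 2 * ⟪G X t, lift m P.S (G X t)⟫_ℝ = ext m P.F X) ∧
    ∀ X, W X P.T = ext m P.FT X

end ControlData

end MFTC

end

/-!
The hypotheses on the mixed derivatives, together with the normalisation of functional derivatives,
make the problem linear in the measure. Since `D_ξ₁ D_ξ₂ ∂²f/∂m² = 0`, the second functional
derivative of `f(x, ·)` is a sum of functions of one variable, and its integrals against `m`
vanish, so it is zero; since `D_ξ ∂²f/∂x∂m = 0`, the first one does not depend on `x`. Hence
`f(x, m) = f(x, δ₀) + ∫ ψ dm` and `F(m) = ∫ l dm` with `l = f(·, δ₀) + ψ` strongly convex with a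
Lipschitz gradient, and likewise `F_T(m) = ∫ lT dm` (`CoefficientAssumption.exists_linear`).
The problem thus splits into deterministic control problems on `ℝⁿ`, one for each starting point,
and `V(m, t) = ∫ u(x, t) dm(x)`, where `u` is the value function on `ℝⁿ` (`Represents.V_eq`).

The same reduction turns the lifted problem into a control problem on the Hilbert space `L²_m`, so
both are treated at once, for an arbitrary Hilbert space, in `ConvexControl`:
* strong convexity makes the forward-backward system monotone, which gives Lipschitz dependence on
  the initial datum uniformly in the initial time (`ConvexControl.exists_stability`) and, by
  continuation of solutions on short intervals backwards from `T`, solvability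
  (`ConvexControl.exists_isSol`);
* the cost along the solution has the initial adjoint state as its gradient, with a quadratic
  remainder uniform in time (`ConvexControl.exists_abs_val_sub_le`), and satisfies the Bellman
  equation by dynamic programming (`ConvexControl.hasDerivWithinAt_val`);
* convexity shows that the feedback control is optimal, with a quadratic gap that makes it unique
  (`ConvexControl.val_add_le_trackCost`);
* a solution of the Bellman equation is compared with the value function along the optimal flow and
  along the closed loop of its own feedback (`ConvexControl.bellman_unique`).

The flow on `L²_m` is the superposition `X ↦ Y_{X(·)}` of the flow on `ℝⁿ`, and the lifted value
function is `∫ u(X, t) dm` (`lifted_state`, `lifted_val`). This identifies the lifted value with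
`V(X ⊗ m, t)` and the lifted gradient with `D dV/dm`; the Bellman equation on the space of measures
is the lifted one at `X = id`. On `ℝⁿ` the cost of an arbitrary control is the integral over the
starting points of the costs of its trajectories (`Represents.cost_eq`). Finally, a functional
`m ↦ ∫ u dm` has the functional derivative `u - ∫ u dm` (`QuadLip.hasFunctionalDeriv`), and
functional derivatives are unique (`HasFunctionalDeriv.unique`), so the derivatives `functionalDeriv`
and `Ddm` in the statement are the expected ones.
-/

noncomputable section

namespace MFTC

/-! ### Integral calculus in Hilbert spaces -/

section Calculus

variable {K : Type*} [NormedAddCommGroup K] [InnerProductSpace ℝ K] [CompleteSpace K]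

/-- Integration by parts for two Bochner primitives; Fubini's theorem on the square, split along
its diagonal. -/
lemma integral_inner_primitive_add {a b : ℝ} (hab : a ≤ b) {f g : ℝ → K}
    (hf : IntervalIntegrable f volume a b) (hg : IntervalIntegrable g volume a b) :
    ∫ s in a..b, (⟪f s, ∫ τ in a..s, g τ⟫_ℝ + ⟪∫ τ in a..s, f τ, g s⟫_ℝ) =
      ⟪∫ s in a..b, f s, ∫ s in a..b, g s⟫_ℝ := by
  set μ := (volume : Measure ℝ).restrict (Ioc a b) with hμ
  have hf' : Integrable f μ := (intervalIntegrable_iff_integrableOn_Ioc_of_le hab).1 hf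
  have hg' : Integrable g μ := (intervalIntegrable_iff_integrableOn_Ioc_of_le hab).1 hg
  have hH : Integrable (fun p : ℝ × ℝ => ⟪f p.1, g p.2⟫_ℝ) (μ.prod μ) :=
    hf'.op_fst_snd (by fun_prop) ⟨1, fun x y => by simpa using norm_inner_le_norm (𝕜 := ℝ) x y⟩ hg'
  have hm : MeasurableSet {p : ℝ × ℝ | p.2 ≤ p.1} := measurableSet_le measurable_snd measurable_fst
  have hm' : MeasurableSet {p : ℝ × ℝ | p.1 ≤ p.2} := measurableSet_le measurable_fst measurable_snd
  have h1 : ∀ s ∈ Ioc a b, ⟪f s, ∫ τ in a..s, g τ⟫_ℝ =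
      ∫ τ, {p : ℝ × ℝ | p.2 ≤ p.1}.indicator (fun p : ℝ × ℝ => ⟪f p.1, g p.2⟫_ℝ) (s, τ) ∂μ := by
    intro s hs
    have e : ∀ τ, {p : ℝ × ℝ | p.2 ≤ p.1}.indicator (fun p : ℝ × ℝ => ⟪f p.1, g p.2⟫_ℝ) (s, τ) =
        (Iic s).indicator (fun τ => ⟪f s, g τ⟫_ℝ) τ := fun τ => by
      simp only [indicator, mem_ofPred_eq, mem_Iic]
    simp_rw [e]
    rw [integral_indicator measurableSet_Iic, hμ, Measure.restrict_restrict measurableSet_Iic,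
      Set.inter_comm, Ioc_inter_Iic, min_eq_right hs.2, intervalIntegral.integral_of_le hs.1.le,
      integral_inner (hg'.mono_measure (Measure.restrict_mono (Ioc_subset_Ioc_right hs.2) le_rfl))]
  have h2 : ∀ s ∈ Ioc a b, ⟪∫ τ in a..s, f τ, g s⟫_ℝ =
      ∫ τ, {p : ℝ × ℝ | p.1 ≤ p.2}.indicator (fun p : ℝ × ℝ => ⟪f p.1, g p.2⟫_ℝ) (τ, s) ∂μ := by
    intro s hs
    have e : ∀ τ, {p : ℝ × ℝ | p.1 ≤ p.2}.indicator (fun p : ℝ × ℝ => ⟪f p.1, g p.2⟫_ℝ) (τ, s) =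
        (Iic s).indicator (fun τ => ⟪f τ, g s⟫_ℝ) τ := fun τ => by
      simp only [indicator, mem_ofPred_eq, mem_Iic]
    simp_rw [e]
    rw [integral_indicator measurableSet_Iic, hμ, Measure.restrict_restrict measurableSet_Iic,
      Set.inter_comm, Ioc_inter_Iic, min_eq_right hs.2, intervalIntegral.integral_of_le hs.1.le]
    simp_rw [real_inner_comm (g s)]
    rw [integral_inner (hf'.mono_measure
      (Measure.restrict_mono (Ioc_subset_Ioc_right hs.2) le_rfl))]
  have i1 := hH.indicator hm
  have i2 := hH.indicator hm'
  rw [intervalIntegral.integral_of_le hab, integral_add]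
  · rw [setIntegral_congr_fun measurableSet_Ioc h1, setIntegral_congr_fun measurableSet_Ioc h2,
      ← hμ, ← integral_integral_swap (f := fun τ s => {p : ℝ × ℝ | p.1 ≤ p.2}.indicator
        (fun p : ℝ × ℝ => ⟪f p.1, g p.2⟫_ℝ) (τ, s)) i2,
      integral_integral (f := fun s τ => {p : ℝ × ℝ | p.2 ≤ p.1}.indicator
        (fun p : ℝ × ℝ => ⟪f p.1, g p.2⟫_ℝ) (s, τ)) i1,
      integral_integral (f := fun s τ => {p : ℝ × ℝ | p.1 ≤ p.2}.indicator
        (fun p : ℝ × ℝ => ⟪f p.1, g p.2⟫_ℝ) (s, τ)) i2, ← integral_add i1 i2]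
    -- The indicators overlap only on the diagonal, which is a null set.
    have hd : ∀ᵐ p ∂(μ.prod μ), p.1 ≠ p.2 := by
      have : MeasurableSet {p : ℝ × ℝ | p.1 ≠ p.2} :=
        (measurableSet_eq_fun measurable_fst measurable_snd).compl
      rw [Measure.ae_prod_iff_ae_ae this]
      refine Filter.Eventually.of_forall fun s => ?_
      have : ∀ᵐ τ ∂μ, τ ≠ s := ae_restrict_of_ae (by simp [ae_iff])
      filter_upwards [this] with τ h using h.symm
    have : ∫ p, ({p : ℝ × ℝ | p.2 ≤ p.1}.indicator (fun p : ℝ × ℝ => ⟪f p.1, g p.2⟫_ℝ) p +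
        {p : ℝ × ℝ | p.1 ≤ p.2}.indicator (fun p : ℝ × ℝ => ⟪f p.1, g p.2⟫_ℝ) p) ∂(μ.prod μ) =
        ∫ p, ⟪f p.1, g p.2⟫_ℝ ∂(μ.prod μ) := by
      refine integral_congr_ae ?_
      filter_upwards [hd] with p hp
      rcases lt_or_gt_of_ne hp with h | h
      · simp [indicator, h.le, h]
      · simp [indicator, h.le, h]
    refine this.trans ?_
    rw [integral_prod _ hH, intervalIntegral.integral_of_le hab,
      intervalIntegral.integral_of_le hab]
    simp_rw [integral_inner hg']
    simp_rw [real_inner_comm (∫ x, g x ∂μ)]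
    rw [integral_inner hf', real_inner_comm]
  · exact (i1.integral_prod_left).congr ((ae_restrict_mem measurableSet_Ioc).mono
      fun s hs => (h1 s hs).symm)
  · exact (i2.integral_prod_right).congr ((ae_restrict_mem measurableSet_Ioc).mono
      fun s hs => (h2 s hs).symm)

/-- The product rule for `⟪p, q⟫`, where `p` and `q` are primitives of integrable functions. -/
lemma inner_sub_inner_eq_integral {a b : ℝ} (hab : a ≤ b) {f g p q : ℝ → K} {p₀ q₀ : K}
    (hf : IntervalIntegrable f volume a b) (hg : IntervalIntegrable g volume a b)
    (hp : ∀ s ∈ Icc a b, p s = p₀ + ∫ τ in a..s, f τ)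
    (hq : ∀ s ∈ Icc a b, q s = q₀ + ∫ τ in a..s, g τ) :
    ⟪p b, q b⟫_ℝ - ⟪p₀, q₀⟫_ℝ = ∫ s in a..b, (⟪f s, q s⟫_ℝ + ⟪p s, g s⟫_ℝ) := by
  have hcf : ContinuousOn (fun s => ∫ τ in a..s, f τ) (uIcc a b) :=
    intervalIntegral.continuousOn_primitive_interval (by
      rw [uIcc_of_le hab]; exact (intervalIntegrable_iff_integrableOn_Icc_of_le hab).1 hf)
  have hcg : ContinuousOn (fun s => ∫ τ in a..s, g τ) (uIcc a b) :=
    intervalIntegral.continuousOn_primitive_interval (by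
      rw [uIcc_of_le hab]; exact (intervalIntegrable_iff_integrableOn_Icc_of_le hab).1 hg)
  have key := integral_inner_primitive_add hab hf hg
  have hf1 : IntervalIntegrable (fun s => ⟪q₀, f s⟫_ℝ) volume a b :=
    ⟨hf.1.const_inner q₀, hf.2.const_inner q₀⟩
  have hg1 : IntervalIntegrable (fun s => ⟪p₀, g s⟫_ℝ) volume a b :=
    ⟨hg.1.const_inner p₀, hg.2.const_inner p₀⟩
  have inner_int : ∀ {u v : ℝ → K}, IntervalIntegrable u volume a b → ContinuousOn v (uIcc a b) →
      IntervalIntegrable (fun s => ⟪u s, v s⟫_ℝ) volume a b := by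
    intro u v hu hv
    obtain ⟨C, hC⟩ := isCompact_uIcc.exists_bound_of_continuousOn hv
    rw [intervalIntegrable_iff] at hu ⊢
    refine Integrable.mono' (hu.norm.mul_const C) (hu.aestronglyMeasurable.inner
      ((hv.mono uIoc_subset_uIcc).aestronglyMeasurable measurableSet_uIoc)) ?_
    filter_upwards [ae_restrict_mem measurableSet_uIoc] with s hs
    exact (norm_inner_le_norm _ _).trans
      (mul_le_mul_of_nonneg_left (hC s (uIoc_subset_uIcc hs)) (norm_nonneg _))
  have hi2 : IntervalIntegrable (fun s => ⟪f s, ∫ τ in a..s, g τ⟫_ℝ + ⟪∫ τ in a..s, f τ, g s⟫_ℝ)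
      volume a b := by
    refine (inner_int hf hcg).add ?_
    simpa only [real_inner_comm] using inner_int hg hcf
  have : ∫ s in a..b, (⟪f s, q s⟫_ℝ + ⟪p s, g s⟫_ℝ) =
      ∫ s in a..b, ((⟪q₀, f s⟫_ℝ + ⟪p₀, g s⟫_ℝ) +
        (⟪f s, ∫ τ in a..s, g τ⟫_ℝ + ⟪∫ τ in a..s, f τ, g s⟫_ℝ)) := by
    refine intervalIntegral.integral_congr fun s hs => ?_
    rw [uIcc_of_le hab] at hs
    simp only [hp s hs, hq s hs, inner_add_left, inner_add_right, real_inner_comm q₀]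
    ring
  rw [this, intervalIntegral.integral_add (hf1.add hg1) hi2, key,
    intervalIntegral.integral_add hf1 hg1]
  have e1 : ∫ s in a..b, ⟪q₀, f s⟫_ℝ = ⟪q₀, ∫ s in a..b, f s⟫_ℝ := by
    simp only [intervalIntegral.integral_of_le hab]
    exact integral_inner ((intervalIntegrable_iff_integrableOn_Ioc_of_le hab).1 hf) _
  have e2 : ∫ s in a..b, ⟪p₀, g s⟫_ℝ = ⟪p₀, ∫ s in a..b, g s⟫_ℝ := by
    simp only [intervalIntegral.integral_of_le hab]
    exact integral_inner ((intervalIntegrable_iff_integrableOn_Ioc_of_le hab).1 hg) _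
  rw [e1, e2, hp b (right_mem_Icc.2 hab), hq b (right_mem_Icc.2 hab)]
  simp only [inner_add_left, inner_add_right, real_inner_comm q₀]
  ring

/-- The Cauchy-Schwarz inequality against the constant function `1`. -/
lemma sq_integral_le {a b : ℝ} (hab : a ≤ b) {φ : ℝ → ℝ}
    (h1 : IntervalIntegrable φ volume a b) (h2 : IntervalIntegrable (fun s => φ s ^ 2) volume a b) :
    (∫ s in a..b, φ s) ^ 2 ≤ (b - a) * ∫ s in a..b, φ s ^ 2 := by
  rcases hab.eq_or_lt with rfl | hlt
  · simp
  set I := ∫ s in a..b, φ s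
  set l := I / (b - a)
  have h0 : 0 ≤ ∫ s in a..b, (φ s - l) ^ 2 :=
    intervalIntegral.integral_nonneg hab fun s _ => sq_nonneg _
  have e : ∫ s in a..b, (φ s - l) ^ 2 = (∫ s in a..b, φ s ^ 2) - 2 * l * I + l ^ 2 * (b - a) := by
    have : ∀ s, (φ s - l) ^ 2 = φ s ^ 2 - 2 * l * φ s + l ^ 2 := fun s => by ring
    simp_rw [this]
    have c2 : IntervalIntegrable (fun s => 2 * l * φ s) volume a b := h1.const_mul _
    rw [intervalIntegral.integral_add (h2.sub c2) intervalIntegrable_const,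
      intervalIntegral.integral_sub h2 c2, intervalIntegral.integral_const_mul]
    simp only [intervalIntegral.integral_const, smul_eq_mul]
    ring
  have hl : l * (b - a) = I := div_mul_cancel₀ _ (by linarith)
  have h3 : (b - a) * (∫ s in a..b, (φ s - l) ^ 2) = (b - a) * (∫ s in a..b, φ s ^ 2) - I ^ 2 := by
    rw [e, ← hl]; ring
  nlinarith [mul_nonneg (sub_nonneg.2 hab) h0]

end Calculus

/-! ### Integral equations with Lipschitz coefficients -/

section Existence

variable {K : Type*} [NormedAddCommGroup K] [NormedSpace ℝ K] [CompleteSpace K]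

/-- A forward-backward system with Lipschitz coefficients is solvable on a short interval, the
length depending only on the Lipschitz constants: the solution is the fixed point of a contraction
of `C([a, b]; K × K)`. -/
lemma exists_forwardBackward_of_short {α β : ℝ → K × K → K} {M κ : ℝ≥0}
    (hα : Continuous (Function.uncurry α)) (hαL : ∀ τ, LipschitzWith M (α τ))
    (hβ : Continuous (Function.uncurry β)) (hβL : ∀ τ, LipschitzWith M (β τ))
    {Γ : K → K} (hΓ : LipschitzWith κ Γ) {a b : ℝ} (hab : a ≤ b)
    (hsmall : (b - a) * (M * (1 + κ)) ≤ 1 / 2) (x : K) :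
    ∃ Y Z : ℝ → K, Continuous Y ∧ Continuous Z ∧
      (∀ s ∈ Icc a b, Y s = x + ∫ τ in a..s, α τ (Y τ, Z τ)) ∧
      ∀ s ∈ Icc a b, Z s = (∫ τ in s..b, β τ (Y τ, Z τ)) + Γ (Y b) := by
  let W : C(Icc a b, K × K) → ℝ → K × K := fun w => IccExtend hab w
  have hW : ∀ w, Continuous (W w) := fun w => w.continuous.Icc_extend'
  have cα : ∀ w, Continuous fun τ => α τ (W w τ) := fun w => hα.comp (continuous_id.prodMk (hW w))
  have cβ : ∀ w, Continuous fun τ => β τ (W w τ) := fun w => hβ.comp (continuous_id.prodMk (hW w))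
  -- The terminal value uses the updated `Y` component `I w b`; since it is already contracted, the
  -- constant `κ` of `Γ` need not be small.
  let I : C(Icc a b, K × K) → ℝ → K := fun w s => x + ∫ τ in a..s, α τ (W w τ)
  let J : C(Icc a b, K × K) → ℝ → K := fun w s => (∫ τ in s..b, β τ (W w τ)) + Γ (I w b)
  have hI : ∀ w, Continuous (I w) := fun w => continuous_const.add
    (intervalIntegral.continuous_primitive (fun u v => (cα w).intervalIntegrable u v) a)
  have hJ : ∀ w, Continuous (J w) := fun w => by
    refine Continuous.add ?_ continuous_const
    simp_rw [intervalIntegral.integral_symm b]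
    exact (intervalIntegral.continuous_primitive (fun u v => (cβ w).intervalIntegrable u v) b).neg
  let Φ : C(Icc a b, K × K) → C(Icc a b, K × K) := fun w =>
    ⟨fun s => (I w s, J w s), by
      exact ((hI w).comp continuous_subtype_val).prodMk ((hJ w).comp continuous_subtype_val)⟩
  have hWd : ∀ w w' τ, dist (W w τ) (W w' τ) ≤ dist w w' := fun w w' τ =>
    ContinuousMap.dist_apply_le_dist _
  have hM0 : (0 : ℝ) ≤ M := M.2
  have hκ0 : (0 : ℝ) ≤ κ := κ.2
  have hId : ∀ w w', ∀ s ∈ Icc a b, dist (I w s) (I w' s) ≤ (b - a) * M * dist w w' := by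
    intro w w' s hs
    have e : I w s - I w' s = ∫ τ in a..s, (α τ (W w τ) - α τ (W w' τ)) := by
      rw [intervalIntegral.integral_sub ((cα w).intervalIntegrable _ _)
        ((cα w').intervalIntegrable _ _)]
      simp [I]
    rw [dist_eq_norm, e]
    refine (intervalIntegral.norm_integral_le_of_norm_le_const (C := M * dist w w')
      fun τ _ => ?_).trans ?_
    · rw [← dist_eq_norm]
      exact ((hαL τ).dist_le_mul _ _).trans (mul_le_mul_of_nonneg_left (hWd w w' τ) hM0)
    · rw [abs_of_nonneg (by linarith [hs.1])]
      nlinarith [hs.1, hs.2, mul_nonneg hM0 (dist_nonneg : 0 ≤ dist w w')]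
  have hJd : ∀ w w', ∀ s ∈ Icc a b,
      dist (J w s) (J w' s) ≤ (b - a) * (M * (1 + κ)) * dist w w' := by
    intro w w' s hs
    have e : J w s - J w' s = (∫ τ in s..b, (β τ (W w τ) - β τ (W w' τ))) +
        (Γ (I w b) - Γ (I w' b)) := by
      rw [intervalIntegral.integral_sub ((cβ w).intervalIntegrable _ _)
        ((cβ w').intervalIntegrable _ _)]
      simp only [J]; abel
    rw [dist_eq_norm, e]
    have h1 : ‖∫ τ in s..b, (β τ (W w τ) - β τ (W w' τ))‖ ≤ (b - a) * M * dist w w' := by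
      refine (intervalIntegral.norm_integral_le_of_norm_le_const (C := M * dist w w')
        fun τ _ => ?_).trans ?_
      · rw [← dist_eq_norm]
        exact ((hβL τ).dist_le_mul _ _).trans (mul_le_mul_of_nonneg_left (hWd w w' τ) hM0)
      · rw [abs_of_nonneg (by linarith [hs.2])]
        nlinarith [hs.1, hs.2, mul_nonneg hM0 (dist_nonneg : 0 ≤ dist w w')]
    have h2 : ‖Γ (I w b) - Γ (I w' b)‖ ≤ κ * ((b - a) * M * dist w w') := by
      rw [← dist_eq_norm]
      exact (hΓ.dist_le_mul _ _).trans
        (mul_le_mul_of_nonneg_left (hId w w' b (right_mem_Icc.2 hab)) hκ0)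
    refine (norm_add_le _ _).trans ((add_le_add h1 h2).trans (le_of_eq ?_))
    ring
  have hΦ : ContractingWith (1 / 2 : ℝ≥0) Φ := by
    refine ⟨by norm_num, LipschitzWith.of_dist_le_mul fun w w' => ?_⟩
    have hd : (0 : ℝ) ≤ dist w w' := dist_nonneg
    refine (ContinuousMap.dist_le (by positivity)).2 fun s => ?_
    rw [Prod.dist_eq]
    have hb : (b - a) * (M * (1 + κ)) * dist w w' ≤ ((1 / 2 : ℝ≥0) : ℝ) * dist w w' := by
      push_cast; exact mul_le_mul_of_nonneg_right hsmall hd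
    refine max_le ((hId w w' s s.2).trans (le_trans ?_ hb)) ((hJd w w' s s.2).trans hb)
    nlinarith [mul_nonneg (mul_nonneg (mul_nonneg (sub_nonneg.2 hab) hM0) hκ0) hd]
  let w := ContractingWith.fixedPoint Φ hΦ
  have hw : Φ w = w := hΦ.fixedPoint_isFixedPt
  have hw1 : ∀ s ∈ Icc a b, W w s = (I w s, J w s) := by
    intro s hs
    have : W w s = w ⟨s, hs⟩ := IccExtend_of_mem _ _ hs
    rw [this]
    conv_lhs => rw [← hw]
    rfl
  refine ⟨fun s => (W w s).1, fun s => (W w s).2, (hW w).fst, (hW w).snd, fun s hs => ?_,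
    fun s hs => ?_⟩
  · simp only [hw1 s hs, I]
  · simp only [hw1 s hs, J, hw1 b (right_mem_Icc.2 hab)]

/-- Two curves that agree at `b` glue to a continuous curve. -/
lemma exists_glue {X : Type*} [TopologicalSpace X] {a b c : ℝ} (hab : a ≤ b) (hbc : b ≤ c)
    {f₁ f₂ : ℝ → X} (h₁ : ContinuousOn f₁ (Icc a b)) (h₂ : ContinuousOn f₂ (Icc b c))
    (h : f₁ b = f₂ b) :
    ∃ f : ℝ → X, ContinuousOn f (Icc a c) ∧ EqOn f f₁ (Icc a b) ∧ EqOn f f₂ (Icc b c) := by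
  have e1 : EqOn (fun s => if s ≤ b then f₁ s else f₂ s) f₁ (Icc a b) := fun s hs => by
    simp [hs.2]
  have e2 : EqOn (fun s => if s ≤ b then f₁ s else f₂ s) f₂ (Icc b c) := fun s hs => by
    by_cases hsb : s ≤ b
    · obtain rfl : s = b := le_antisymm hsb hs.1
      simp [h]
    · simp [hsb]
  refine ⟨_, ?_, e1, e2⟩
  rw [← Icc_union_Icc_eq_Icc hab hbc]
  exact (h₁.congr e1).union_of_isClosed (h₂.congr e2) isClosed_Icc isClosed_Icc

/-- Global solvability of an ordinary differential equation with a Lipschitz right hand side. -/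
lemma exists_solution_of_lipschitz {α : ℝ → K → K} {M : ℝ≥0}
    (hα : Continuous (Function.uncurry α)) (hαL : ∀ τ, LipschitzWith M (α τ))
    {a b : ℝ} (hab : a ≤ b) (x : K) :
    ∃ Y : ℝ → K, ContinuousOn Y (Icc a b) ∧ ∀ s ∈ Icc a b, Y s = x + ∫ τ in a..s, α τ (Y τ) := by
  have hM0 : (0 : ℝ) ≤ M := M.2
  obtain ⟨h, hh0, hh⟩ : ∃ h : ℝ, 0 < h ∧ h * M ≤ 1 / 2 :=
    ⟨1 / (2 * (M + 1)), by positivity, by rw [div_mul_eq_mul_div, div_le_div_iff₀] <;> nlinarith⟩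
  have local_sol : ∀ a b : ℝ, a ≤ b → b - a ≤ h → ∀ x : K, ∃ Y : ℝ → K, ContinuousOn Y (Icc a b) ∧
      ∀ s ∈ Icc a b, Y s = x + ∫ τ in a..s, α τ (Y τ) := by
    intro a b hab hle x
    obtain ⟨Y, Z, hY, -, hYe, -⟩ := exists_forwardBackward_of_short (α := fun τ w => α τ w.1)
      (β := fun _ _ => 0) (M := M) (κ := 0) (Γ := fun _ => (0 : K))
      (by exact hα.comp (continuous_fst.prodMk (continuous_fst.comp continuous_snd)))
      (fun τ => LipschitzWith.of_dist_le_mul fun w w' => ((hαL τ).dist_le_mul _ _).trans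
        (mul_le_mul_of_nonneg_left (by rw [Prod.dist_eq]; exact le_max_left _ _) hM0))
      (by exact continuous_const) (fun τ => LipschitzWith.of_dist_le_mul fun w w' => by
        simp only [dist_self]; positivity) (LipschitzWith.const 0) hab
      (by push_cast; nlinarith) x
    exact ⟨Y, hY.continuousOn, hYe⟩
  have steps : ∀ k : ℕ, ∀ a : ℝ, a ≤ b → b - a ≤ k * h → ∀ x : K, ∃ Y : ℝ → K,
      ContinuousOn Y (Icc a b) ∧ ∀ s ∈ Icc a b, Y s = x + ∫ τ in a..s, α τ (Y τ) := by
    intro k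
    induction k with
    | zero => exact fun a hab hle x => local_sol a b hab (by simp at hle; linarith) x
    | succ k ih =>
      intro a hab hle x
      rcases le_total (b - a) h with hs | hs
      · exact local_sol a b hab hs x
      obtain ⟨Y₁, hY₁, e₁⟩ := local_sol a (a + h) (by linarith) (by linarith) x
      obtain ⟨Y₂, hY₂, e₂⟩ := ih (a + h) (by linarith) (by push_cast at hle; linarith) (Y₁ (a + h))
      obtain ⟨Y, hY, g₁, g₂⟩ := exists_glue (show a ≤ a + h by linarith)
        (show a + h ≤ b by linarith) hY₁ hY₂ (by rw [e₂ _ ⟨le_rfl, by linarith⟩]; simp)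
      have hc : ContinuousOn (fun τ => α τ (Y τ)) (Icc a b) :=
        hα.comp_continuousOn (continuousOn_id.prodMk hY)
      have e₁' : ∀ s ∈ Icc a (a + h), Y s = x + ∫ τ in a..s, α τ (Y τ) := fun s hs => by
        rw [g₁ hs, e₁ s hs]
        congr 1
        refine intervalIntegral.integral_congr fun τ hτ => ?_
        rw [uIcc_of_le hs.1] at hτ
        simp only [g₁ ⟨hτ.1, hτ.2.trans hs.2⟩]
      refine ⟨Y, hY, fun s hs => ?_⟩
      rcases le_total s (a + h) with hsh | hsh
      · exact e₁' s ⟨hs.1, hsh⟩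
      have i₁ : IntervalIntegrable (fun τ => α τ (Y τ)) volume a (a + h) :=
        (hc.mono (Icc_subset_Icc le_rfl (by linarith))).intervalIntegrable_of_Icc (by linarith)
      have i₂ : IntervalIntegrable (fun τ => α τ (Y τ)) volume (a + h) s :=
        (hc.mono (Icc_subset_Icc (by linarith) hs.2)).intervalIntegrable_of_Icc hsh
      rw [← intervalIntegral.integral_add_adjacent_intervals i₁ i₂, ← add_assoc,
        ← e₁' _ (right_mem_Icc.2 (by linarith)), g₂ ⟨hsh, hs.2⟩, e₂ s ⟨hsh, hs.2⟩,
        ← g₁ (right_mem_Icc.2 (by linarith))]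
      congr 1
      refine intervalIntegral.integral_congr fun τ hτ => ?_
      rw [uIcc_of_le hsh] at hτ
      simp only [g₂ ⟨hτ.1, hτ.2.trans hs.2⟩]
  obtain ⟨k, hk⟩ := exists_nat_gt ((b - a) / h)
  exact steps k a hab ((div_lt_iff₀ hh0).1 hk).le x

end Existence

/-! ### Convex control problems on a Hilbert space -/

/-- A linear-convex control problem on a Hilbert space `K`: the dynamics `y' = A y + B v`, the
running cost `l(y) + ½ ⟪v, N v⟫`, the terminal cost `lT(y)` and the horizon `T`. The functions `l`
and `lT` are strongly convex with Lipschitz gradients `g` and `gT`; a single constant `c` serves as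
a lower bound for all the coercivity conditions. -/
structure ConvexControl (K : Type*) [NormedAddCommGroup K] [InnerProductSpace ℝ K]
    [CompleteSpace K] where
  A : K →L[ℝ] K
  B : K →L[ℝ] K
  N : K →L[ℝ] K
  Ninv : K →L[ℝ] K
  T : ℝ
  l : K → ℝ
  lT : K → ℝ
  g : K → K
  gT : K → K
  Lip : ℝ≥0
  c : ℝ
  T_pos : 0 < T
  c_pos : 0 < c
  N_symm : ∀ x y, ⟪N x, y⟫_ℝ = ⟪x, N y⟫_ℝ
  N_Ninv : ∀ x, N (Ninv x) = x
  Ninv_N : ∀ x, Ninv (N x) = x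
  N_coercive : ∀ x, c * ‖x‖ ^ 2 ≤ ⟪N x, x⟫_ℝ
  S_coercive : ∀ x, c * ‖x‖ ^ 2 ≤ ⟪B (Ninv (ContinuousLinearMap.adjoint B x)), x⟫_ℝ
  hasGradientAt_l : ∀ x, HasGradientAt l (g x) x
  hasGradientAt_lT : ∀ x, HasGradientAt lT (gT x) x
  lipschitz_g : LipschitzWith Lip g
  lipschitz_gT : LipschitzWith Lip gT
  mono_g : ∀ x y, c * ‖x - y‖ ^ 2 ≤ ⟪g x - g y, x - y⟫_ℝ
  mono_gT : ∀ x y, c * ‖x - y‖ ^ 2 ≤ ⟪gT x - gT y, x - y⟫_ℝ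

namespace ConvexControl

variable {K : Type*} [NormedAddCommGroup K] [InnerProductSpace ℝ K] [CompleteSpace K]
  (Q : ConvexControl K)

/-- The adjoint of `A`. -/
def As : K →L[ℝ] K := ContinuousLinearMap.adjoint Q.A

/-- The adjoint of `B`. -/
def Bs : K →L[ℝ] K := ContinuousLinearMap.adjoint Q.B

/-- The operator `B N⁻¹ B*`. -/
def S : K →L[ℝ] K := Q.B ∘L Q.Ninv ∘L Q.Bs

lemma S_apply (x : K) : Q.S x = Q.B (Q.Ninv (Q.Bs x)) := rfl

lemma inner_As_left (x y : K) : ⟪Q.As x, y⟫_ℝ = ⟪x, Q.A y⟫_ℝ :=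
  ContinuousLinearMap.adjoint_inner_left _ _ _

lemma inner_Bs_left (x y : K) : ⟪Q.Bs x, y⟫_ℝ = ⟪x, Q.B y⟫_ℝ :=
  ContinuousLinearMap.adjoint_inner_left _ _ _

lemma inner_Ninv_left (x y : K) : ⟪Q.Ninv x, y⟫_ℝ = ⟪x, Q.Ninv y⟫_ℝ := by
  conv_lhs => rw [← Q.N_Ninv y]
  rw [← Q.N_symm, Q.N_Ninv]

lemma inner_S_left (x y : K) : ⟪Q.S x, y⟫_ℝ = ⟪x, Q.S y⟫_ℝ := by
  rw [S_apply, S_apply, ← inner_Bs_left Q x, ← inner_Ninv_left, real_inner_comm,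
    ← inner_Bs_left Q y, real_inner_comm]

/-- `(Y, Z)` solves on `[a, b]` the forward-backward system with initial datum `x` for `Y` and
terminal condition `Z b = Γ (Y b)`. -/
structure IsSolOn (a b : ℝ) (Γ : K → K) (x : K) (Y Z : ℝ → K) : Prop where
  contY : ContinuousOn Y (Icc a b)
  contZ : ContinuousOn Z (Icc a b)
  eqY : ∀ s ∈ Icc a b, Y s = x + ∫ τ in a..s, (Q.A (Y τ) - Q.S (Z τ))
  eqZ : ∀ s ∈ Icc a b, Z s = (∫ τ in s..b, (Q.As (Z τ) + Q.g (Y τ))) + Γ (Y b)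

/-- `(Y, Z)` solves the forward-backward system of the control problem started at time `t`
from `x`. -/
def IsSol (t : ℝ) (x : K) (Y Z : ℝ → K) : Prop := Q.IsSolOn t Q.T Q.gT x Y Z

variable {Q}

namespace IsSolOn

variable {a b : ℝ} {Γ : K → K} {x : K} {Y Z : ℝ → K}

lemma contA (h : Q.IsSolOn a b Γ x Y Z) :
    ContinuousOn (fun τ => Q.A (Y τ) - Q.S (Z τ)) (Icc a b) :=
  (Q.A.continuous.comp_continuousOn h.contY).sub (Q.S.continuous.comp_continuousOn h.contZ)

lemma contAs (h : Q.IsSolOn a b Γ x Y Z) :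
    ContinuousOn (fun τ => Q.As (Z τ) + Q.g (Y τ)) (Icc a b) :=
  (Q.As.continuous.comp_continuousOn h.contZ).add
    (Q.lipschitz_g.continuous.comp_continuousOn h.contY)

lemma init (h : Q.IsSolOn a b Γ x Y Z) (hab : a ≤ b) : Y a = x := by
  rw [h.eqY a (left_mem_Icc.2 hab)]; simp

lemma terminal (h : Q.IsSolOn a b Γ x Y Z) (hab : a ≤ b) : Z b = Γ (Y b) := by
  rw [h.eqZ b (right_mem_Icc.2 hab)]; simp

lemma Z_sub (h : Q.IsSolOn a b Γ x Y Z) {s s' : ℝ} (hs : a ≤ s) (hss : s ≤ s') (hs' : s' ≤ b) :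
    Z s = (∫ τ in s..s', (Q.As (Z τ) + Q.g (Y τ))) + Z s' := by
  rw [h.eqZ s ⟨hs, hss.trans hs'⟩, h.eqZ s' ⟨hs.trans hss, hs'⟩, ← add_assoc,
    intervalIntegral.integral_add_adjacent_intervals]
  · exact (h.contAs.mono (Icc_subset_Icc hs hs')).intervalIntegrable_of_Icc hss
  · exact (h.contAs.mono (Icc_subset_Icc (hs.trans hss) le_rfl)).intervalIntegrable_of_Icc hs'

lemma Y_sub (h : Q.IsSolOn a b Γ x Y Z) {s s' : ℝ} (hs : a ≤ s) (hss : s ≤ s') (hs' : s' ≤ b) :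
    Y s' = Y s + ∫ τ in s..s', (Q.A (Y τ) - Q.S (Z τ)) := by
  rw [h.eqY s ⟨hs, hss.trans hs'⟩, h.eqY s' ⟨hs.trans hss, hs'⟩, add_assoc,
    intervalIntegral.integral_add_adjacent_intervals]
  · exact (h.contA.mono (Icc_subset_Icc le_rfl (hss.trans hs'))).intervalIntegrable_of_Icc hs
  · exact (h.contA.mono (Icc_subset_Icc hs hs')).intervalIntegrable_of_Icc hss

lemma Z_forward (h : Q.IsSolOn a b Γ x Y Z) {s : ℝ} (hs : s ∈ Icc a b) :
    Z s = Z a + ∫ τ in a..s, -(Q.As (Z τ) + Q.g (Y τ)) := by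
  rw [intervalIntegral.integral_neg, h.Z_sub le_rfl hs.1 hs.2]
  abel

/-- The restriction of a solution to a final interval is a solution. -/
lemma restrict (h : Q.IsSolOn a b Γ x Y Z) {s : ℝ} (hs : s ∈ Icc a b) :
    Q.IsSolOn s b Γ (Y s) Y Z where
  contY := h.contY.mono (Icc_subset_Icc hs.1 le_rfl)
  contZ := h.contZ.mono (Icc_subset_Icc hs.1 le_rfl)
  eqY := fun _ hs' => h.Y_sub hs.1 hs'.1 hs'.2
  eqZ := fun s' hs' => h.eqZ s' ⟨hs.1.trans hs'.1, hs'.2⟩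

lemma congr (h : Q.IsSolOn a b Γ x Y Z) {Y' Z' : ℝ → K} (hab : a ≤ b) (hY : EqOn Y' Y (Icc a b))
    (hZ : EqOn Z' Z (Icc a b)) : Q.IsSolOn a b Γ x Y' Z' where
  contY := h.contY.congr hY
  contZ := h.contZ.congr hZ
  eqY := fun s hs => by
    rw [hY hs, h.eqY s hs]
    congr 1
    refine intervalIntegral.integral_congr fun τ hτ => ?_
    rw [uIcc_of_le hs.1] at hτ
    simp only [hY ⟨hτ.1, hτ.2.trans hs.2⟩, hZ ⟨hτ.1, hτ.2.trans hs.2⟩]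
  eqZ := fun s hs => by
    rw [hZ hs, h.eqZ s hs, hY (right_mem_Icc.2 hab)]
    congr 1
    refine intervalIntegral.integral_congr fun τ hτ => ?_
    rw [uIcc_of_le hs.2] at hτ
    simp only [hY ⟨hs.1.trans hτ.1, hτ.2⟩, hZ ⟨hs.1.trans hτ.1, hτ.2⟩]

end IsSolOn

/-- A solution on `[a, b]` followed by one on `[b, e]` that provides its terminal condition. -/
lemma IsSolOn.glue {a b e : ℝ} (hab : a ≤ b) (hbe : b ≤ e) {Γ Γ' : K → K} {x : K}
    {Y₁ Z₁ Y₂ Z₂ : ℝ → K} (h₁ : Q.IsSolOn a b Γ' x Y₁ Z₁) (h₂ : Q.IsSolOn b e Γ (Y₁ b) Y₂ Z₂)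
    (hΓ : Γ' (Y₁ b) = Z₂ b) : ∃ Y Z, Q.IsSolOn a e Γ x Y Z := by
  obtain ⟨Y, hY, y₁, y₂⟩ := exists_glue hab hbe h₁.contY h₂.contY (h₂.init hbe).symm
  obtain ⟨Z, hZ, z₁, z₂⟩ := exists_glue hab hbe h₁.contZ h₂.contZ
    ((h₁.terminal hab).trans hΓ)
  have h₁' := h₁.congr hab y₁ z₁
  have h₂' := h₂.congr hbe y₂ z₂
  have cA : ContinuousOn (fun τ => Q.A (Y τ) - Q.S (Z τ)) (Icc a e) :=
    (Q.A.continuous.comp_continuousOn hY).sub (Q.S.continuous.comp_continuousOn hZ)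
  have cAs : ContinuousOn (fun τ => Q.As (Z τ) + Q.g (Y τ)) (Icc a e) :=
    (Q.As.continuous.comp_continuousOn hZ).add (Q.lipschitz_g.continuous.comp_continuousOn hY)
  refine ⟨Y, Z, hY, hZ, fun s hs => ?_, fun s hs => ?_⟩
  · rcases le_total s b with hsb | hsb
    · exact h₁'.eqY s ⟨hs.1, hsb⟩
    · have i₁ := (cA.mono (Icc_subset_Icc le_rfl hbe)).intervalIntegrable_of_Icc
        (μ := volume) hab
      have i₂ := (cA.mono (Icc_subset_Icc hab hs.2)).intervalIntegrable_of_Icc (μ := volume) hsb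
      rw [← intervalIntegral.integral_add_adjacent_intervals i₁ i₂, ← add_assoc,
        ← h₁'.eqY b (right_mem_Icc.2 hab), h₂'.eqY s ⟨hsb, hs.2⟩, y₁ (right_mem_Icc.2 hab)]
  · rcases le_total s b with hsb | hsb
    · have i₁ := (cAs.mono (Icc_subset_Icc hs.1 hbe)).intervalIntegrable_of_Icc (μ := volume) hsb
      have i₂ := (cAs.mono (Icc_subset_Icc hab le_rfl)).intervalIntegrable_of_Icc (μ := volume) hbe
      rw [← intervalIntegral.integral_add_adjacent_intervals i₁ i₂, add_assoc,
        ← h₂'.eqZ b (left_mem_Icc.2 hbe), z₂ (left_mem_Icc.2 hbe), ← hΓ,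
        ← y₁ (right_mem_Icc.2 hab)]
      exact h₁'.eqZ s ⟨hs.1, hsb⟩
    · exact h₂'.eqZ s ⟨hsb, hs.2⟩

variable (Q)

/-- The duality between the adjoint equation `Z' = -A* Z - q` and a perturbation `y' = A y + r` of
the state equation. -/
lemma inner_adjoint_state {a b : ℝ} (hab : a ≤ b) {Z q y r : ℝ → K} {z₀ y₀ : K}
    (hZc : ContinuousOn Z (Icc a b)) (hq : ContinuousOn q (Icc a b))
    (hyc : ContinuousOn y (Icc a b)) (hr : IntervalIntegrable r volume a b)
    (hZ : ∀ s ∈ Icc a b, Z s = z₀ + ∫ τ in a..s, -(Q.As (Z τ) + q τ))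
    (hy : ∀ s ∈ Icc a b, y s = y₀ + ∫ τ in a..s, (Q.A (y τ) + r τ)) :
    ⟪Z b, y b⟫_ℝ - ⟪z₀, y₀⟫_ℝ = ∫ s in a..b, (⟪Z s, r s⟫_ℝ - ⟪q s, y s⟫_ℝ) := by
  have i1 : IntervalIntegrable (fun τ => -(Q.As (Z τ) + q τ)) volume a b :=
    ((Q.As.continuous.comp_continuousOn hZc).add hq).neg.intervalIntegrable_of_Icc hab
  have i2 : IntervalIntegrable (fun τ => Q.A (y τ) + r τ) volume a b :=
    ((Q.A.continuous.comp_continuousOn hyc).intervalIntegrable_of_Icc hab).add hr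
  rw [inner_sub_inner_eq_integral hab i1 i2 hZ hy]
  refine intervalIntegral.integral_congr fun s _ => ?_
  simp only [inner_neg_left, inner_add_left, inner_add_right, inner_As_left]
  ring

lemma S_coercive' (x : K) : Q.c * ‖x‖ ^ 2 ≤ ⟪x, Q.S x⟫_ℝ := by
  rw [real_inner_comm]; exact Q.S_coercive x

/-- The difference of two solutions solves a linear system. -/
lemma IsSolOn.sub_eq {a b : ℝ} {Γ : K → K} {x x' : K} {Y Z Y' Z' : ℝ → K}
    (h : Q.IsSolOn a b Γ x Y Z) (h' : Q.IsSolOn a b Γ x' Y' Z') {s : ℝ} (hs : s ∈ Icc a b) :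
    Y' s - Y s = (x' - x) + ∫ τ in a..s, (Q.A (Y' τ - Y τ) + -Q.S (Z' τ - Z τ)) := by
  have i := (h.contA.mono (Icc_subset_Icc le_rfl hs.2)).intervalIntegrable_of_Icc (μ := volume) hs.1
  have i' := (h'.contA.mono (Icc_subset_Icc le_rfl hs.2)).intervalIntegrable_of_Icc
    (μ := volume) hs.1
  have : ∀ τ, Q.A (Y' τ - Y τ) + -Q.S (Z' τ - Z τ) =
      (Q.A (Y' τ) - Q.S (Z' τ)) - (Q.A (Y τ) - Q.S (Z τ)) := fun τ => by
    simp only [map_sub]; abel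
  simp_rw [this]
  rw [intervalIntegral.integral_sub i' i, h.eqY s hs, h'.eqY s hs]
  abel

lemma IsSolOn.Z_sub_eq {a b : ℝ} {Γ : K → K} {x x' : K} {Y Z Y' Z' : ℝ → K}
    (h : Q.IsSolOn a b Γ x Y Z) (h' : Q.IsSolOn a b Γ x' Y' Z') {s : ℝ} (hs : s ∈ Icc a b) :
    Z' s - Z s = (∫ τ in s..b, (Q.As (Z' τ - Z τ) + (Q.g (Y' τ) - Q.g (Y τ)))) +
      (Γ (Y' b) - Γ (Y b)) := by
  have i := (h.contAs.mono (Icc_subset_Icc hs.1 le_rfl)).intervalIntegrable_of_Icc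
    (μ := volume) hs.2
  have i' := (h'.contAs.mono (Icc_subset_Icc hs.1 le_rfl)).intervalIntegrable_of_Icc
    (μ := volume) hs.2
  have : ∀ τ, Q.As (Z' τ - Z τ) + (Q.g (Y' τ) - Q.g (Y τ)) =
      (Q.As (Z' τ) + Q.g (Y' τ)) - (Q.As (Z τ) + Q.g (Y τ)) := fun τ => by
    simp only [map_sub]; abel
  simp_rw [this]
  rw [intervalIntegral.integral_sub i' i, h.eqZ s hs, h'.eqZ s hs]
  abel

lemma IsSolOn.Z_sub_forward {a b : ℝ} {Γ : K → K} {x x' : K} {Y Z Y' Z' : ℝ → K}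
    (h : Q.IsSolOn a b Γ x Y Z) (h' : Q.IsSolOn a b Γ x' Y' Z') {s : ℝ} (hs : s ∈ Icc a b) :
    Z' s - Z s = (Z' a - Z a) +
      ∫ τ in a..s, -(Q.As (Z' τ - Z τ) + (Q.g (Y' τ) - Q.g (Y τ))) := by
  have i := (h.contAs.mono (Icc_subset_Icc le_rfl hs.2)).intervalIntegrable_of_Icc
    (μ := volume) hs.1
  have i' := (h'.contAs.mono (Icc_subset_Icc le_rfl hs.2)).intervalIntegrable_of_Icc
    (μ := volume) hs.1
  have : ∀ τ, -(Q.As (Z' τ - Z τ) + (Q.g (Y' τ) - Q.g (Y τ))) =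
      -(Q.As (Z' τ) + Q.g (Y' τ)) - -(Q.As (Z τ) + Q.g (Y τ)) := fun τ => by
    simp only [map_sub]; abel
  simp_rw [this]
  have n : IntervalIntegrable (fun τ => -(Q.As (Z τ) + Q.g (Y τ))) volume a s := i.neg
  have n' : IntervalIntegrable (fun τ => -(Q.As (Z' τ) + Q.g (Y' τ))) volume a s := i'.neg
  rw [intervalIntegral.integral_sub n' n, h.Z_forward hs, h'.Z_forward hs]
  abel

/-- The monotonicity estimate: strong convexity controls the difference of two solutions by the
product of the differences of `Y` and `Z` at the initial time. -/
lemma IsSol.monotone_estimate {t : ℝ} (ht : t ≤ Q.T) {x x' : K} {Y Z Y' Z' : ℝ → K}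
    (h : Q.IsSol t x Y Z) (h' : Q.IsSol t x' Y' Z') :
    Q.c * (‖Y' Q.T - Y Q.T‖ ^ 2 + ∫ s in t..Q.T, (‖Y' s - Y s‖ ^ 2 + ‖Z' s - Z s‖ ^ 2)) ≤
      ‖x' - x‖ * ‖Z' t - Z t‖ := by
  have cY : ContinuousOn (fun s => Y' s - Y s) (Icc t Q.T) := h'.contY.sub h.contY
  have cZ : ContinuousOn (fun s => Z' s - Z s) (Icc t Q.T) := h'.contZ.sub h.contZ
  have cg : ContinuousOn (fun s => Q.g (Y' s) - Q.g (Y s)) (Icc t Q.T) :=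
    (Q.lipschitz_g.continuous.comp_continuousOn h'.contY).sub
      (Q.lipschitz_g.continuous.comp_continuousOn h.contY)
  have cS : ContinuousOn (fun s => -Q.S (Z' s - Z s)) (Icc t Q.T) :=
    (Q.S.continuous.comp_continuousOn cZ).neg
  have key := Q.inner_adjoint_state ht cZ cg cY (cS.intervalIntegrable_of_Icc ht)
    (fun s hs => IsSolOn.Z_sub_forward Q h h' hs) (fun s hs => IsSolOn.sub_eq Q h h' hs)
  have hle : ∫ s in t..Q.T, (⟪Z' s - Z s, -Q.S (Z' s - Z s)⟫_ℝ -
      ⟪Q.g (Y' s) - Q.g (Y s), Y' s - Y s⟫_ℝ) ≤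
      ∫ s in t..Q.T, -(Q.c * (‖Y' s - Y s‖ ^ 2 + ‖Z' s - Z s‖ ^ 2)) := by
    refine intervalIntegral.integral_mono_on ht
      (((cZ.inner cS).sub (cg.inner cY)).intervalIntegrable_of_Icc ht)
      ((continuousOn_const.mul ((cY.norm.pow 2).add
        (cZ.norm.pow 2))).neg.intervalIntegrable_of_Icc ht) fun s _ => ?_
    have h1 := Q.S_coercive' (Z' s - Z s)
    have h2 := Q.mono_g (Y' s) (Y s)
    rw [inner_neg_right]
    linarith
  rw [intervalIntegral.integral_neg, intervalIntegral.integral_const_mul] at hle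
  have hT := Q.mono_gT (Y' Q.T) (Y Q.T)
  rw [← h.terminal ht, ← h'.terminal ht] at hT
  have hcs := real_inner_le_norm (Z' t - Z t) (x' - x)
  rw [mul_comm] at hcs
  linarith

lemma sq_integral_combination_le {a b s s' : ℝ} (has : a ≤ s) (hss : s ≤ s') (hsb : s' ≤ b)
    {u v : ℝ → ℝ} (hu : ContinuousOn u (Icc a b)) (hv : ContinuousOn v (Icc a b)) (p q : ℝ) :
    (∫ τ in s..s', (p * u τ + q * v τ)) ^ 2 ≤
      (b - a) * (2 * (p ^ 2 + q ^ 2)) * ∫ τ in a..b, (u τ ^ 2 + v τ ^ 2) := by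
  have hab : a ≤ b := has.trans (hss.trans hsb)
  have hsub : Icc s s' ⊆ Icc a b := Icc_subset_Icc has hsb
  have c1 : ContinuousOn (fun τ => p * u τ + q * v τ) (Icc a b) :=
    (continuousOn_const.mul hu).add (continuousOn_const.mul hv)
  have c2 : ContinuousOn (fun τ => 2 * (p ^ 2 + q ^ 2) * (u τ ^ 2 + v τ ^ 2)) (Icc a b) :=
    continuousOn_const.mul ((hu.pow 2).add (hv.pow 2))
  have hnn : ∀ τ, 0 ≤ 2 * (p ^ 2 + q ^ 2) * (u τ ^ 2 + v τ ^ 2) := fun τ => by positivity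
  have h1 := sq_integral_le hss ((c1.mono hsub).intervalIntegrable_of_Icc hss)
    (((c1.mono hsub).pow 2).intervalIntegrable_of_Icc hss)
  have h2 : ∫ τ in s..s', (p * u τ + q * v τ) ^ 2 ≤
      ∫ τ in s..s', 2 * (p ^ 2 + q ^ 2) * (u τ ^ 2 + v τ ^ 2) :=
    intervalIntegral.integral_mono_on hss (((c1.mono hsub).pow 2).intervalIntegrable_of_Icc hss)
      ((c2.mono hsub).intervalIntegrable_of_Icc hss) fun τ _ => by
        nlinarith [sq_nonneg (p * u τ - q * v τ), sq_nonneg (p * v τ), sq_nonneg (q * u τ)]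
  have h3 : ∫ τ in s..s', 2 * (p ^ 2 + q ^ 2) * (u τ ^ 2 + v τ ^ 2) ≤
      ∫ τ in a..b, 2 * (p ^ 2 + q ^ 2) * (u τ ^ 2 + v τ ^ 2) :=
    intervalIntegral.integral_mono_interval has hss hsb
      (Filter.Eventually.of_forall hnn) (c2.intervalIntegrable_of_Icc hab)
  have h4 : 0 ≤ ∫ τ in s..s', 2 * (p ^ 2 + q ^ 2) * (u τ ^ 2 + v τ ^ 2) :=
    intervalIntegral.integral_nonneg hss fun τ _ => hnn τ
  rw [mul_assoc, ← intervalIntegral.integral_const_mul]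
  refine h1.trans ((mul_le_mul_of_nonneg_left (h2.trans h3) (by linarith)).trans ?_)
  exact mul_le_mul_of_nonneg_right (by linarith) (h4.trans h3)

/-- Lipschitz dependence of the solution on its initial datum, uniformly in the initial time. -/
lemma exists_stability : ∃ κ : ℝ≥0, ∀ t ∈ Icc 0 Q.T, ∀ (x x' : K) (Y Z Y' Z' : ℝ → K),
    Q.IsSol t x Y Z → Q.IsSol t x' Y' Z' →
    ∀ s ∈ Icc t Q.T, ‖Y' s - Y s‖ ≤ κ * ‖x' - x‖ ∧ ‖Z' s - Z s‖ ≤ κ * ‖x' - x‖ := by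
  have hT := Q.T_pos
  have hc := Q.c_pos
  obtain ⟨L, hLdef⟩ : ∃ L : ℝ, (Q.Lip : ℝ) = L := ⟨_, rfl⟩
  have hL : 0 ≤ L := hLdef ▸ Q.Lip.2
  set C₁ : ℝ := 2 * L ^ 2 + 4 * Q.T * (‖Q.As‖ ^ 2 + L ^ 2) with hC₁
  set C₂ : ℝ := 4 * Q.T * (‖Q.A‖ ^ 2 + ‖Q.S‖ ^ 2) with hC₂
  have hC₁0 : 0 ≤ C₁ := by positivity
  have hC₂0 : 0 ≤ C₂ := by positivity
  set k : ℝ := C₁ / Q.c with hk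
  have hk0 : 0 ≤ k := by positivity
  set κ₂ : ℝ := 2 + C₂ * (k / Q.c)
  have hκ₂ : 2 ≤ κ₂ := by simp only [κ₂]; linarith [show 0 ≤ C₂ * (k / Q.c) by positivity]
  refine ⟨⟨k + κ₂, by positivity⟩, fun t ht x x' Y Z Y' Z' h h' => ?_⟩
  have htT := ht.2
  have cY : ContinuousOn (fun s => ‖Y' s - Y s‖) (Icc t Q.T) := (h'.contY.sub h.contY).norm
  have cZ : ContinuousOn (fun s => ‖Z' s - Z s‖) (Icc t Q.T) := (h'.contZ.sub h.contZ).norm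
  have mono := IsSol.monotone_estimate Q htT h h'
  set D := ∫ s in t..Q.T, (‖Y' s - Y s‖ ^ 2 + ‖Z' s - Z s‖ ^ 2)
  have hD : 0 ≤ D := intervalIntegral.integral_nonneg htT fun s _ => by positivity
  set a := ‖x' - x‖
  set b := ‖Z' t - Z t‖
  set r := ‖Y' Q.T - Y Q.T‖
  have ha : 0 ≤ a := norm_nonneg _
  have hb : 0 ≤ b := norm_nonneg _
  have hD' : ∫ s in t..Q.T, (‖Z' s - Z s‖ ^ 2 + ‖Y' s - Y s‖ ^ 2) = D := by
    simp only [D, add_comm]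
  -- The integral equation for `Z` turns the `L²` bound of `mono` into a pointwise one.
  have hZ2 : ∀ s ∈ Icc t Q.T, ‖Z' s - Z s‖ ^ 2 ≤ k * (a * b) := by
    intro s hs
    have e := IsSolOn.Z_sub_eq Q h h' hs
    set I := ∫ τ in s..Q.T, (‖Q.As‖ * ‖Z' τ - Z τ‖ + L * ‖Y' τ - Y τ‖) with hI
    have n1 : ‖∫ τ in s..Q.T, (Q.As (Z' τ - Z τ) + (Q.g (Y' τ) - Q.g (Y τ)))‖ ≤ I := by
      refine intervalIntegral.norm_integral_le_of_norm_le hs.2 (Filter.Eventually.of_forall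
        fun τ _ => ?_) ?_
      · refine (norm_add_le _ _).trans (add_le_add (Q.As.le_opNorm _) ?_)
        simpa [dist_eq_norm, hLdef] using Q.lipschitz_g.dist_le_mul (Y' τ) (Y τ)
      · exact (((continuousOn_const.mul cZ).add (continuousOn_const.mul cY)).mono
          (Icc_subset_Icc hs.1 le_rfl)).intervalIntegrable_of_Icc hs.2
    have n2 : ‖Q.gT (Y' Q.T) - Q.gT (Y Q.T)‖ ≤ L * r := by
      simpa [dist_eq_norm, hLdef] using Q.lipschitz_gT.dist_le_mul (Y' Q.T) (Y Q.T)
    have n3 : ‖Z' s - Z s‖ ≤ I + L * r := by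
      rw [e]; exact (norm_add_le _ _).trans (add_le_add n1 n2)
    have n4 := sq_integral_combination_le hs.1 hs.2 le_rfl cZ cY ‖Q.As‖ L
    rw [← hI, hD'] at n4
    have n5 : (Q.T - t) * (2 * (‖Q.As‖ ^ 2 + L ^ 2)) * D ≤
        Q.T * (2 * (‖Q.As‖ ^ 2 + L ^ 2)) * D := by
      gcongr; linarith [ht.1]
    have n6 : ‖Z' s - Z s‖ ^ 2 ≤ 2 * I ^ 2 + 2 * (L * r) ^ 2 := by
      have := pow_le_pow_left₀ (norm_nonneg _) n3 2
      nlinarith [sq_nonneg (I - L * r)]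
    have n7 : ‖Z' s - Z s‖ ^ 2 ≤ C₁ * (r ^ 2 + D) := by
      have e1 : 0 ≤ 2 * L ^ 2 * D := by positivity
      have e2 : 0 ≤ 4 * Q.T * (‖Q.As‖ ^ 2 + L ^ 2) * r ^ 2 := by positivity
      have e3 : C₁ * (r ^ 2 + D) = 2 * (Q.T * (2 * (‖Q.As‖ ^ 2 + L ^ 2)) * D) + 2 * (L * r) ^ 2 +
          2 * L ^ 2 * D + 4 * Q.T * (‖Q.As‖ ^ 2 + L ^ 2) * r ^ 2 := by rw [hC₁]; ring
      linarith
    calc ‖Z' s - Z s‖ ^ 2 ≤ C₁ * (r ^ 2 + D) := n7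
      _ = k * (Q.c * (r ^ 2 + D)) := by rw [hk]; field_simp
      _ ≤ k * (a * b) := mul_le_mul_of_nonneg_left mono hk0
  -- At the initial time this reads `b ^ 2 ≤ k * (a * b)`, which closes the estimate.
  have hbka : b ≤ k * a := by
    have := hZ2 t (left_mem_Icc.2 htT)
    by_contra hcon
    push Not at hcon
    have hbp : 0 < b := lt_of_le_of_lt (by positivity) hcon
    have : b * b ≤ (k * a) * b := by
      linarith [show b ^ 2 = b * b by ring, show k * (a * b) = k * a * b by ring]
    exact absurd (le_of_mul_le_mul_right this hbp) (not_le.2 hcon)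
  have hDa : D ≤ k / Q.c * a ^ 2 := by
    have h1 : Q.c * D ≤ a * (k * a) :=
      le_trans (mul_le_mul_of_nonneg_left (by linarith [sq_nonneg r]) hc.le)
        (mono.trans (mul_le_mul_of_nonneg_left hbka ha))
    rw [div_mul_eq_mul_div, le_div_iff₀ hc]
    linarith [show a * (k * a) = k * a ^ 2 by ring]
  intro s hs
  constructor
  · have e := IsSolOn.sub_eq Q h h' hs
    set I := ∫ τ in t..s, (‖Q.A‖ * ‖Y' τ - Y τ‖ + ‖Q.S‖ * ‖Z' τ - Z τ‖) with hI
    have n1 : ‖∫ τ in t..s, (Q.A (Y' τ - Y τ) + -Q.S (Z' τ - Z τ))‖ ≤ I := by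
      refine intervalIntegral.norm_integral_le_of_norm_le hs.1 (Filter.Eventually.of_forall
        fun τ _ => ?_) ?_
      · refine (norm_add_le _ _).trans (add_le_add (Q.A.le_opNorm _) ?_)
        rw [norm_neg]; exact Q.S.le_opNorm _
      · exact (((continuousOn_const.mul cY).add (continuousOn_const.mul cZ)).mono
          (Icc_subset_Icc le_rfl hs.2)).intervalIntegrable_of_Icc hs.1
    have n3 : ‖Y' s - Y s‖ ≤ a + I := by
      rw [e]; exact (norm_add_le _ _).trans (add_le_add le_rfl n1)
    have n4 := sq_integral_combination_le le_rfl hs.1 hs.2 cY cZ ‖Q.A‖ ‖Q.S‖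
    rw [← hI] at n4
    have n5 : (Q.T - t) * (2 * (‖Q.A‖ ^ 2 + ‖Q.S‖ ^ 2)) * D ≤
        Q.T * (2 * (‖Q.A‖ ^ 2 + ‖Q.S‖ ^ 2)) * D := by
      gcongr; linarith [ht.1]
    have n6 : ‖Y' s - Y s‖ ^ 2 ≤ 2 * a ^ 2 + 2 * I ^ 2 := by
      have := pow_le_pow_left₀ (norm_nonneg _) n3 2
      nlinarith [sq_nonneg (I - a)]
    have n7 : ‖Y' s - Y s‖ ^ 2 ≤ κ₂ * a ^ 2 := by
      have : C₂ * D ≤ C₂ * (k / Q.c * a ^ 2) := mul_le_mul_of_nonneg_left hDa hC₂0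
      have e1 : κ₂ * a ^ 2 = 2 * a ^ 2 + C₂ * (k / Q.c * a ^ 2) := by simp only [κ₂]; ring
      have e2 : C₂ * D = 2 * (Q.T * (2 * (‖Q.A‖ ^ 2 + ‖Q.S‖ ^ 2)) * D) := by rw [hC₂]; ring
      linarith
    have n8 : ‖Y' s - Y s‖ ^ 2 ≤ (κ₂ * a) ^ 2 := by
      refine n7.trans ?_
      rw [mul_pow]
      exact mul_le_mul_of_nonneg_right (le_self_pow₀ (by linarith) two_ne_zero) (sq_nonneg a)
    have n9 := (pow_le_pow_iff_left₀ (norm_nonneg _) (by positivity) two_ne_zero).1 n8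
    refine n9.trans (mul_le_mul_of_nonneg_right ?_ ha)
    change κ₂ ≤ k + κ₂
    linarith
  · have n8 : ‖Z' s - Z s‖ ^ 2 ≤ (k * a) ^ 2 := by
      refine (hZ2 s hs).trans ?_
      have := mul_le_mul_of_nonneg_left hbka (mul_nonneg hk0 ha)
      linarith [show (k * a) ^ 2 = k * a * (k * a) by ring, show k * (a * b) = k * a * b by ring]
    have n9 := (pow_le_pow_iff_left₀ (norm_nonneg _) (by positivity) two_ne_zero).1 n8
    refine n9.trans (mul_le_mul_of_nonneg_right ?_ ha)
    change k ≤ k + κ₂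
    linarith

/-- The Lipschitz constant of the solution map of the forward-backward system. -/
def κ : ℝ≥0 := Q.exists_stability.choose

variable {Q}

lemma IsSol.norm_sub_le {t : ℝ} (ht : t ∈ Icc 0 Q.T) {x x' : K} {Y Z Y' Z' : ℝ → K}
    (h : Q.IsSol t x Y Z) (h' : Q.IsSol t x' Y' Z') {s : ℝ} (hs : s ∈ Icc t Q.T) :
    ‖Y' s - Y s‖ ≤ Q.κ * ‖x' - x‖ ∧ ‖Z' s - Z s‖ ≤ Q.κ * ‖x' - x‖ :=
  Q.exists_stability.choose_spec t ht x x' Y Z Y' Z' h h' s hs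

lemma IsSol.unique {t : ℝ} (ht : t ∈ Icc 0 Q.T) {x : K} {Y Z Y' Z' : ℝ → K}
    (h : Q.IsSol t x Y Z) (h' : Q.IsSol t x Y' Z') {s : ℝ} (hs : s ∈ Icc t Q.T) :
    Y' s = Y s ∧ Z' s = Z s := by
  have := h.norm_sub_le ht h' hs
  simp only [sub_self, norm_zero, mul_zero, norm_le_zero_iff, sub_eq_zero] at this
  exact this

variable (Q)

/-- Solvability of the forward-backward system: solutions on short intervals are concatenated
backwards from `T`. The step does not shrink, since `exists_stability` bounds the Lipschitz constant
of the terminal condition in each step. -/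
lemma exists_isSol {t : ℝ} (ht : t ∈ Icc 0 Q.T) (x : K) : ∃ Y Z, Q.IsSol t x Y Z := by
  set M : ℝ≥0 := ‖Q.A‖₊ + ‖Q.S‖₊ + ‖Q.As‖₊ + Q.Lip with hM
  set κ' : ℝ≥0 := Q.κ + Q.Lip with hκ'
  have hM0 : (0 : ℝ) ≤ M := M.2
  have hκ0 : (0 : ℝ) ≤ κ' := κ'.2
  have lip : ∀ (U V : K × K → K) (C D : ℝ≥0), LipschitzWith C U → LipschitzWith D V →
      C + D ≤ M → LipschitzWith M (fun w => U w + V w) := fun U V C D hU hV h =>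
    (hU.add hV).weaken h
  have local_sol : ∀ a b : ℝ, a ≤ b → (b - a) * (M * (1 + κ')) ≤ 1 / 2 → ∀ Γ : K → K,
      LipschitzWith κ' Γ → ∀ x, ∃ Y Z, Q.IsSolOn a b Γ x Y Z := by
    intro a b hab hs Γ hΓ x
    obtain ⟨Y, Z, hY, hZ, eY, eZ⟩ := exists_forwardBackward_of_short (M := M)
      (α := fun _ w => Q.A w.1 + -Q.S w.2) (β := fun _ w => Q.As w.2 + Q.g w.1)
      (by
        change Continuous fun p : ℝ × K × K => Q.A p.2.1 + -Q.S p.2.2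
        fun_prop)
      (fun _ => lip (fun w => Q.A w.1) (fun w => -Q.S w.2) _ _
        (Q.A.lipschitz.comp LipschitzWith.prod_fst) (Q.S.lipschitz.comp LipschitzWith.prod_snd).neg
        (by rw [hM, mul_one, mul_one, add_assoc (‖Q.A‖₊ + ‖Q.S‖₊)]; exact le_self_add))
      (by
        change Continuous fun p : ℝ × K × K => Q.As p.2.2 + Q.g p.2.1
        have := Q.lipschitz_g.continuous
        fun_prop)
      (fun _ => lip (fun w => Q.As w.2) (fun w => Q.g w.1) _ _
        (Q.As.lipschitz.comp LipschitzWith.prod_snd) (Q.lipschitz_g.comp LipschitzWith.prod_fst)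
        (by rw [hM, mul_one, mul_one, add_assoc (‖Q.A‖₊ + ‖Q.S‖₊)]; exact le_add_self))
      hΓ hab hs x
    exact ⟨Y, Z, hY.continuousOn, hZ.continuousOn, by simpa only [sub_eq_add_neg] using eY, eZ⟩
  obtain ⟨h, hh0, hh⟩ : ∃ h : ℝ, 0 < h ∧ h * (M * (1 + κ')) ≤ 1 / 2 := by
    refine ⟨1 / (2 * (M * (1 + κ') + 1)), by positivity, ?_⟩
    rw [div_mul_eq_mul_div, div_le_div_iff₀ (by positivity) (by norm_num)]
    linarith
  have hmul : ∀ d, d ≤ h → d * (M * (1 + κ')) ≤ 1 / 2 := fun d hd =>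
    (mul_le_mul_of_nonneg_right hd (by positivity)).trans hh
  have steps : ∀ k : ℕ, ∀ t ∈ Icc 0 Q.T, Q.T - t ≤ k * h → ∀ x, ∃ Y Z, Q.IsSol t x Y Z := by
    intro k
    induction k with
    | zero =>
      intro t ht hle x
      exact local_sol t Q.T ht.2 (hmul _ (by simp at hle; linarith)) Q.gT
        (Q.lipschitz_gT.weaken le_add_self) x
    | succ k ih =>
      intro t ht hle x
      rcases le_total (Q.T - t) h with hs | hs
      · exact local_sol t Q.T ht.2 (hmul _ hs) Q.gT (Q.lipschitz_gT.weaken le_add_self) x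
      have hb : t + h ∈ Icc 0 Q.T := ⟨by linarith [ht.1], by linarith⟩
      choose Y Z hYZ using ih (t + h) hb (by push_cast at hle; linarith)
      -- The new terminal condition is the initial adjoint state of the solutions already found.
      have hΓ : LipschitzWith κ' fun x => Z x (t + h) := by
        refine LipschitzWith.weaken (K := Q.κ) (LipschitzWith.of_dist_le_mul fun x x' => ?_)
          le_self_add
        rw [dist_eq_norm, dist_eq_norm]
        exact ((hYZ x').norm_sub_le hb (hYZ x) (left_mem_Icc.2 hb.2)).2
      obtain ⟨Y₁, Z₁, h₁⟩ := local_sol t (t + h) (by linarith) (hmul _ (by linarith)) _ hΓ x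
      exact h₁.glue (by linarith) hb.2 (hYZ (Y₁ (t + h))) rfl
  obtain ⟨k, hk⟩ := exists_nat_gt ((Q.T - t) / h)
  exact steps k t ht ((div_lt_iff₀ hh0).1 hk).le x

end ConvexControl

/-! ### Functions with a Lipschitz gradient -/

section Gradient

variable {K : Type*} [NormedAddCommGroup K] [InnerProductSpace ℝ K] [CompleteSpace K]

lemma exists_sub_eq_inner_gradient {l : K → ℝ} {g : K → K} (hl : ∀ x, HasGradientAt l (g x) x)
    (x y : K) : ∃ θ ∈ Ioo (0 : ℝ) 1, l y - l x = ⟪g (x + θ • (y - x)), y - x⟫_ℝ := by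
  have hd : ∀ θ : ℝ, HasDerivAt (fun θ : ℝ => l (x + θ • (y - x)))
      ⟪g (x + θ • (y - x)), y - x⟫_ℝ θ := by
    intro θ
    have h1 : HasDerivAt (fun θ : ℝ => x + θ • (y - x)) (y - x) θ := by
      simpa using ((hasDerivAt_id θ).smul_const (y - x)).const_add x
    have := (hl (x + θ • (y - x))).hasFDerivAt.comp_hasDerivAt θ h1
    rwa [InnerProductSpace.toDual_apply_apply] at this
  obtain ⟨θ, hθ, e⟩ := exists_hasDerivAt_eq_slope (fun θ : ℝ => l (x + θ • (y - x))) _ zero_lt_one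
    (fun θ _ => (hd θ).continuousAt.continuousWithinAt) (fun θ _ => hd θ)
  refine ⟨θ, hθ, ?_⟩
  rw [e]
  simp

lemma abs_sub_sub_inner_gradient_le {l : K → ℝ} {g : K → K} {L : ℝ≥0}
    (hl : ∀ x, HasGradientAt l (g x) x) (hg : LipschitzWith L g) (x y : K) :
    |l y - l x - ⟪g x, y - x⟫_ℝ| ≤ L * ‖y - x‖ ^ 2 := by
  obtain ⟨θ, hθ, e⟩ := exists_sub_eq_inner_gradient hl x y
  rw [e, ← inner_sub_left]
  refine (abs_real_inner_le_norm _ _).trans ?_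
  have h1 := hg.dist_le_mul (x + θ • (y - x)) x
  rw [dist_eq_norm, dist_eq_norm, add_sub_cancel_left, norm_smul, Real.norm_of_nonneg hθ.1.le] at h1
  have h2 : θ * ‖y - x‖ ≤ ‖y - x‖ := mul_le_of_le_one_left (norm_nonneg _) hθ.2.le
  calc _ ≤ (L * ‖y - x‖) * ‖y - x‖ := mul_le_mul_of_nonneg_right
        (h1.trans (mul_le_mul_of_nonneg_left h2 L.2)) (norm_nonneg _)
    _ = _ := by ring

/-- The first order convexity inequality for a function with monotone gradient. -/
lemma inner_gradient_le_sub {l : K → ℝ} {g : K → K} (hl : ∀ x, HasGradientAt l (g x) x)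
    (hg : ∀ x y, 0 ≤ ⟪g x - g y, x - y⟫_ℝ) (x y : K) : ⟪g x, y - x⟫_ℝ ≤ l y - l x := by
  obtain ⟨θ, hθ, e⟩ := exists_sub_eq_inner_gradient hl x y
  have := hg (x + θ • (y - x)) x
  rw [add_sub_cancel_left, inner_smul_right, inner_sub_left] at this
  have := nonneg_of_mul_nonneg_right this hθ.1
  linarith

lemma hasGradientAt_of_abs_le {l : K → ℝ} {p x : K} {C : ℝ}
    (h : ∀ y, |l y - l x - ⟪p, y - x⟫_ℝ| ≤ C * ‖y - x‖ ^ 2) : HasGradientAt l p x := by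
  rw [hasGradientAt_iff_isLittleO]
  have h1 : (fun y => l y - l x - ⟪p, y - x⟫_ℝ) =O[nhds x] fun y => ‖y - x‖ ^ 2 :=
    Asymptotics.IsBigO.of_bound C (Filter.Eventually.of_forall fun y => by
      simpa using h y)
  refine h1.trans_isLittleO ?_
  have : (fun h : K => ‖h‖ ^ 2) =o[nhds 0] fun h : K => h :=
    Asymptotics.isLittleO_norm_pow_id one_lt_two
  have ht : Filter.Tendsto (fun y => y - x) (nhds x) (nhds 0) := by
    simpa using (continuous_id.sub continuous_const).tendsto (f := fun y : K => y - x) x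
  exact this.comp_tendsto ht

end Gradient

section Chain

variable {K : Type*} [NormedAddCommGroup K] [InnerProductSpace ℝ K]

/-- The variation of a time-dependent function along a curve, for fixed time variable: the part of
the chain rule that needs no differentiability in time. -/
lemma hasDerivWithinAt_sub_along {W : K → ℝ → ℝ} {G : K → ℝ → K} {I : Set ℝ} {t₀ : ℝ} {C : ℝ}
    {y : ℝ → K} {y' : K}
    (hW : ∀ s ∈ I, ∀ z, |W z s - W (y t₀) s - ⟪G (y t₀) s, z - y t₀⟫_ℝ| ≤ C * ‖z - y t₀‖ ^ 2)
    (hG : ContinuousWithinAt (G (y t₀)) I t₀) (hy : HasDerivWithinAt y y' I t₀) :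
    HasDerivWithinAt (fun s => W (y s) s - W (y t₀) s) ⟪G (y t₀) t₀, y'⟫_ℝ I t₀ := by
  have hO : (fun s => y s - y t₀) =O[nhdsWithin t₀ I] fun s => s - t₀ :=
    hy.hasFDerivWithinAt.isBigO_sub
  have hT : Filter.Tendsto (fun s => y s - y t₀) (nhdsWithin t₀ I) (nhds 0) := by
    have := hy.continuousWithinAt.tendsto.sub_const (y t₀)
    rwa [sub_self] at this
  have h1 : (fun s => W (y s) s - W (y t₀) s - ⟪G (y t₀) s, y s - y t₀⟫_ℝ)
      =o[nhdsWithin t₀ I] fun s => s - t₀ := by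
    have b : (fun s => W (y s) s - W (y t₀) s - ⟪G (y t₀) s, y s - y t₀⟫_ℝ)
        =O[nhdsWithin t₀ I] fun s => ‖y s - y t₀‖ ^ 2 :=
      Asymptotics.IsBigO.of_bound C (by
        filter_upwards [self_mem_nhdsWithin] with s hs
        simpa using hW s hs (y s))
    have o : (fun h : K => ‖h‖ ^ 2) =o[nhds 0] fun h : K => h :=
      Asymptotics.isLittleO_norm_pow_id one_lt_two
    exact b.trans_isLittleO ((o.comp_tendsto hT).trans_isBigO hO)
  have h2 : (fun s => ⟪G (y t₀) s - G (y t₀) t₀, y s - y t₀⟫_ℝ)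
      =o[nhdsWithin t₀ I] fun s => s - t₀ := by
    have o : (fun s => G (y t₀) s - G (y t₀) t₀) =o[nhdsWithin t₀ I] fun _ => (1 : ℝ) := by
      rw [Asymptotics.isLittleO_one_iff]
      have := hG.tendsto.sub_const (G (y t₀) t₀)
      rwa [sub_self] at this
    have b : (fun s => ⟪G (y t₀) s - G (y t₀) t₀, y s - y t₀⟫_ℝ)
        =O[nhdsWithin t₀ I] fun s => ‖G (y t₀) s - G (y t₀) t₀‖ * ‖y s - y t₀‖ :=
      Asymptotics.IsBigO.of_bound 1 (Filter.Eventually.of_forall fun s => by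
        simpa using abs_real_inner_le_norm (G (y t₀) s - G (y t₀) t₀) (y s - y t₀))
    refine b.trans_isLittleO ?_
    simpa using o.norm_left.mul_isBigO hO.norm_left
  have h3 : HasDerivWithinAt (fun s => ⟪G (y t₀) t₀, y s - y t₀⟫_ℝ) ⟪G (y t₀) t₀, y'⟫_ℝ I t₀ := by
    simpa using (hasDerivWithinAt_const t₀ I (G (y t₀) t₀)).inner ℝ (hy.sub_const (y t₀))
  rw [hasDerivWithinAt_iff_isLittleO] at h3 ⊢
  refine ((h1.add h2).add h3).congr_left fun s => ?_
  simp only [inner_sub_left, sub_self, inner_zero_right]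
  ring

end Chain

namespace ConvexControl

variable {K : Type*} [NormedAddCommGroup K] [InnerProductSpace ℝ K] [CompleteSpace K]
  (Q : ConvexControl K)

/-! ### The optimal flow and the decoupling field -/

lemma exists_isSol_continuous {t : ℝ} (ht : t ∈ Icc 0 Q.T) (x : K) :
    ∃ p : (ℝ → K) × (ℝ → K), Q.IsSol t x p.1 p.2 ∧ Continuous p.1 ∧ Continuous p.2 := by
  obtain ⟨Y, Z, h⟩ := Q.exists_isSol ht x
  refine ⟨(IccExtend ht.2 ((Icc t Q.T).domRestrict Y), IccExtend ht.2 ((Icc t Q.T).domRestrict Z)),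
    h.congr ht.2 (fun s hs => ?_) (fun s hs => ?_), ?_, ?_⟩
  · simp [IccExtend_of_mem ht.2 _ hs]
  · simp [IccExtend_of_mem ht.2 _ hs]
  · exact (continuousOn_iff_continuous_domRestrict.1 h.contY).Icc_extend'
  · exact (continuousOn_iff_continuous_domRestrict.1 h.contZ).Icc_extend'

open Classical in
/-- The optimal trajectory started at time `t` from `x` (extended continuously to all times; zero
for `t ∉ [0, T]`). -/
def state (t : ℝ) (x : K) : ℝ → K :=
  if h : t ∈ Icc 0 Q.T then (Q.exists_isSol_continuous h x).choose.1 else 0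

open Classical in
/-- The adjoint state along the optimal trajectory started at time `t` from `x`. -/
def costate (t : ℝ) (x : K) : ℝ → K :=
  if h : t ∈ Icc 0 Q.T then (Q.exists_isSol_continuous h x).choose.2 else 0

/-- The decoupling field: the initial value of the adjoint state. -/
def field (t : ℝ) (x : K) : K := Q.costate t x t

/-- The value function, as the cost along the optimal trajectory. -/
def val (t : ℝ) (x : K) : ℝ :=
  (∫ s in t..Q.T, (Q.l (Q.state t x s) + 1 / 2 * ⟪Q.costate t x s, Q.S (Q.costate t x s)⟫_ℝ)) +
    Q.lT (Q.state t x Q.T)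

variable {Q}

lemma isSol {t : ℝ} (ht : t ∈ Icc 0 Q.T) (x : K) : Q.IsSol t x (Q.state t x) (Q.costate t x) := by
  simp only [state, costate, ht, dif_pos]
  exact (Q.exists_isSol_continuous ht x).choose_spec.1

lemma continuous_state {t : ℝ} (ht : t ∈ Icc 0 Q.T) (x : K) : Continuous (Q.state t x) := by
  simp only [state, ht, dif_pos]
  exact (Q.exists_isSol_continuous ht x).choose_spec.2.1

lemma continuous_costate {t : ℝ} (ht : t ∈ Icc 0 Q.T) (x : K) : Continuous (Q.costate t x) := by
  simp only [costate, ht, dif_pos]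
  exact (Q.exists_isSol_continuous ht x).choose_spec.2.2

lemma state_self {t : ℝ} (ht : t ∈ Icc 0 Q.T) (x : K) : Q.state t x t = x :=
  (isSol ht x).init ht.2

lemma mem_Icc_of {t s : ℝ} (ht : t ∈ Icc 0 Q.T) (hs : s ∈ Icc t Q.T) : s ∈ Icc 0 Q.T :=
  ⟨ht.1.trans hs.1, hs.2⟩

/-- The flow property. -/
lemma state_state {t s r : ℝ} (ht : t ∈ Icc 0 Q.T) (hs : s ∈ Icc t Q.T) (hr : r ∈ Icc s Q.T)
    (x : K) : Q.state s (Q.state t x s) r = Q.state t x r ∧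
      Q.costate s (Q.state t x s) r = Q.costate t x r :=
  IsSol.unique (mem_Icc_of ht hs) ((isSol ht x).restrict hs) (isSol (mem_Icc_of ht hs) _) hr

lemma costate_eq_field {t s : ℝ} (ht : t ∈ Icc 0 Q.T) (hs : s ∈ Icc t Q.T) (x : K) :
    Q.costate t x s = Q.field s (Q.state t x s) :=
  (state_state ht hs (left_mem_Icc.2 hs.2) x).2.symm

lemma lipschitz_state {t s : ℝ} (ht : t ∈ Icc 0 Q.T) (hs : s ∈ Icc t Q.T) :
    LipschitzWith Q.κ fun x => Q.state t x s :=
  LipschitzWith.of_dist_le_mul fun x x' => by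
    rw [dist_eq_norm, dist_eq_norm]
    exact ((isSol ht x').norm_sub_le ht (isSol ht x) hs).1

lemma lipschitz_costate {t s : ℝ} (ht : t ∈ Icc 0 Q.T) (hs : s ∈ Icc t Q.T) :
    LipschitzWith Q.κ fun x => Q.costate t x s :=
  LipschitzWith.of_dist_le_mul fun x x' => by
    rw [dist_eq_norm, dist_eq_norm]
    exact ((isSol ht x').norm_sub_le ht (isSol ht x) hs).2

lemma lipschitz_field {t : ℝ} (ht : t ∈ Icc 0 Q.T) : LipschitzWith Q.κ (Q.field t) :=
  lipschitz_costate ht (left_mem_Icc.2 ht.2)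

variable (Q)

/-- Linear growth of the optimal flow, uniformly in time; the comparison trajectory is the one
started from `0` at time `0`. -/
lemma exists_growth : ∃ R : ℝ, 0 ≤ R ∧ ∀ t ∈ Icc 0 Q.T, ∀ s ∈ Icc t Q.T, ∀ x,
    ‖Q.state t x s‖ ≤ R * (1 + ‖x‖) ∧ ‖Q.costate t x s‖ ≤ R * (1 + ‖x‖) := by
  have h0 : (0 : ℝ) ∈ Icc 0 Q.T := left_mem_Icc.2 Q.T_pos.le
  obtain ⟨a, ha⟩ := isCompact_Icc.exists_bound_of_continuousOn
    (continuous_state (Q := Q) h0 0).continuousOn (s := Icc 0 Q.T)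
  obtain ⟨b, hb⟩ := isCompact_Icc.exists_bound_of_continuousOn
    (continuous_costate (Q := Q) h0 0).continuousOn (s := Icc 0 Q.T)
  have ha0 : 0 ≤ a := (norm_nonneg _).trans (ha 0 h0)
  have hb0 : 0 ≤ b := (norm_nonneg _).trans (hb 0 h0)
  have hκ : (0 : ℝ) ≤ Q.κ := Q.κ.2
  have hP : 0 ≤ (Q.κ : ℝ) * a := mul_nonneg hκ ha0
  refine ⟨a + b + Q.κ * a + Q.κ, by positivity, fun t ht s hs x => ?_⟩
  have hs' := mem_Icc_of ht hs
  have key := IsSol.norm_sub_le ht ((isSol h0 (0 : K)).restrict ht) (isSol ht x) hs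
  have e : (Q.κ : ℝ) * ‖x - Q.state 0 0 t‖ ≤ Q.κ * (‖x‖ + a) :=
    mul_le_mul_of_nonneg_left ((norm_sub_le _ _).trans (add_le_add le_rfl (ha t ht))) hκ
  have n1 := norm_le_norm_add_norm_sub' (Q.state t x s) (Q.state 0 0 s)
  have n2 := norm_le_norm_add_norm_sub' (Q.costate t x s) (Q.costate 0 0 s)
  have p : 0 ≤ (a + b + Q.κ * a) * ‖x‖ := by positivity
  constructor
  · linarith [ha s hs', key.1]
  · linarith [hb s hs', key.2]

lemma norm_g_le (x : K) : ‖Q.g x‖ ≤ ‖Q.g 0‖ + Q.Lip * ‖x‖ := by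
  have h1 := Q.lipschitz_g.dist_le_mul x 0
  rw [dist_eq_norm, dist_eq_norm, sub_zero] at h1
  linarith [norm_le_norm_add_norm_sub' (Q.g x) (Q.g 0)]

/-- The flow moves at a speed that is bounded locally uniformly in `x`, and the decoupling field is
Lipschitz in time. -/
lemma exists_speed : ∃ C : ℝ, 0 ≤ C ∧ ∀ t ∈ Icc 0 Q.T, ∀ s ∈ Icc t Q.T, ∀ x,
    ‖Q.state t x s - x‖ ≤ C * (1 + ‖x‖) * (s - t) ∧
      ‖Q.field s x - Q.field t x‖ ≤ C * (1 + ‖x‖) * (s - t) := by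
  obtain ⟨R, hR, hgr⟩ := Q.exists_growth
  have hκ : (0 : ℝ) ≤ Q.κ := Q.κ.2
  have hL : (0 : ℝ) ≤ Q.Lip := Q.Lip.2
  set a := (‖Q.A‖ + ‖Q.S‖) * R with ha
  set b := (‖Q.As‖ + Q.Lip) * R + ‖Q.g 0‖ with hb
  have ha0 : 0 ≤ a := by positivity
  have hb0 : 0 ≤ b := by positivity
  refine ⟨a + (Q.κ * a + b), by positivity, fun t ht s hs x => ?_⟩
  have hx : 0 ≤ ‖x‖ := norm_nonneg x
  have hst : 0 ≤ s - t := sub_nonneg.2 hs.1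
  have h := isSol ht x
  have m1 : ‖Q.state t x s - x‖ ≤ a * (1 + ‖x‖) * (s - t) := by
    rw [h.eqY s hs, add_sub_cancel_left]
    refine (intervalIntegral.norm_integral_le_of_norm_le_const (C := a * (1 + ‖x‖))
      fun τ hτ => ?_).trans_eq (by rw [abs_of_nonneg hst])
    rw [uIoc_of_le hs.1] at hτ
    have hτ' : τ ∈ Icc t Q.T := ⟨hτ.1.le, hτ.2.trans hs.2⟩
    have e1 := (Q.A.le_opNorm (Q.state t x τ)).trans
      (mul_le_mul_of_nonneg_left (hgr t ht τ hτ' x).1 (norm_nonneg _))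
    have e2 := (Q.S.le_opNorm (Q.costate t x τ)).trans
      (mul_le_mul_of_nonneg_left (hgr t ht τ hτ' x).2 (norm_nonneg _))
    refine (norm_sub_le _ _).trans ((add_le_add e1 e2).trans_eq ?_)
    rw [ha]; ring
  have m2 : ‖Q.costate t x s - Q.costate t x t‖ ≤ b * (1 + ‖x‖) * (s - t) := by
    rw [h.Z_sub le_rfl hs.1 hs.2, norm_sub_rev, add_sub_cancel_right]
    refine (intervalIntegral.norm_integral_le_of_norm_le_const (C := b * (1 + ‖x‖))
      fun τ hτ => ?_).trans_eq (by rw [abs_of_nonneg hst])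
    rw [uIoc_of_le hs.1] at hτ
    have hτ' : τ ∈ Icc t Q.T := ⟨hτ.1.le, hτ.2.trans hs.2⟩
    have e1 := (Q.As.le_opNorm (Q.costate t x τ)).trans
      (mul_le_mul_of_nonneg_left (hgr t ht τ hτ' x).2 (norm_nonneg _))
    have e2 := (Q.norm_g_le (Q.state t x τ)).trans
      (add_le_add le_rfl (mul_le_mul_of_nonneg_left (hgr t ht τ hτ' x).1 hL))
    have e3 : 0 ≤ ‖Q.g 0‖ * ‖x‖ := by positivity
    refine (norm_add_le _ _).trans ((add_le_add e1 e2).trans ?_)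
    rw [hb]; linarith
  have p1 : 0 ≤ a * (1 + ‖x‖) * (s - t) := by positivity
  have p2 : 0 ≤ b * (1 + ‖x‖) * (s - t) := by positivity
  have p3 : 0 ≤ Q.κ * (a * (1 + ‖x‖) * (s - t)) := by positivity
  constructor
  · linarith
  · have e1 : ‖Q.field s x - Q.field s (Q.state t x s)‖ ≤ Q.κ * (a * (1 + ‖x‖) * (s - t)) := by
      have := (lipschitz_field (mem_Icc_of ht hs)).dist_le_mul x (Q.state t x s)
      rw [dist_eq_norm, dist_comm, dist_eq_norm] at this
      exact this.trans (mul_le_mul_of_nonneg_left m1 hκ)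
    rw [← costate_eq_field ht hs] at e1
    have e2 := norm_add_le (Q.field s x - Q.costate t x s) (Q.costate t x s - Q.costate t x t)
    rw [sub_add_sub_cancel] at e2
    change ‖Q.field s x - Q.costate t x t‖ ≤ _
    linarith

lemma continuousOn_field (x : K) : ContinuousOn (fun t => Q.field t x) (Icc 0 Q.T) := by
  obtain ⟨C, hC, h⟩ := Q.exists_speed
  have : LipschitzOnWith ⟨C * (1 + ‖x‖), by positivity⟩ (fun t => Q.field t x) (Icc 0 Q.T) := by
    refine LipschitzOnWith.of_dist_le_mul fun t ht s hs => ?_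
    change _ ≤ C * (1 + ‖x‖) * _
    rcases le_total t s with hts | hts
    · rw [dist_comm, dist_eq_norm, Real.dist_eq, abs_sub_comm, abs_of_nonneg (sub_nonneg.2 hts)]
      exact (h t ht s ⟨hts, hs.2⟩ x).2
    · rw [dist_eq_norm, Real.dist_eq, abs_of_nonneg (sub_nonneg.2 hts)]
      exact (h s hs t ⟨hts, ht.2⟩ x).2
  exact this.continuousOn

/-! ### The value function: gradient and time derivative -/

lemma continuous_l : Continuous Q.l :=
  continuous_iff_continuousAt.2 fun x => (Q.hasGradientAt_l x).continuousAt

lemma continuous_lT : Continuous Q.lT :=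
  continuous_iff_continuousAt.2 fun x => (Q.hasGradientAt_lT x).continuousAt

/-- The running cost of a trajectory with feedback control `-N⁻¹ B* z`. -/
def lag (y z : K) : ℝ := Q.l y + 1 / 2 * ⟪z, Q.S z⟫_ℝ

lemma continuousOn_lag {I : Set ℝ} {y z : ℝ → K} (hy : ContinuousOn y I) (hz : ContinuousOn z I) :
    ContinuousOn (fun s => Q.lag (y s) (z s)) I :=
  (Q.continuous_l.comp_continuousOn hy).add
    (continuousOn_const.mul (hz.inner (Q.S.continuous.comp_continuousOn hz)))

lemma continuous_lag {t : ℝ} (ht : t ∈ Icc 0 Q.T) (x : K) :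
    Continuous fun s => Q.lag (Q.state t x s) (Q.costate t x s) := by
  rw [← continuousOn_univ]
  exact Q.continuousOn_lag (continuous_state ht x).continuousOn
    (continuous_costate ht x).continuousOn

lemma val_eq (t : ℝ) (x : K) : Q.val t x =
    (∫ s in t..Q.T, Q.lag (Q.state t x s) (Q.costate t x s)) + Q.lT (Q.state t x Q.T) := rfl

lemma val_terminal (x : K) : Q.val Q.T x = Q.lT x := by
  have hT : Q.T ∈ Icc 0 Q.T := right_mem_Icc.2 Q.T_pos.le
  rw [val_eq, intervalIntegral.integral_same, zero_add, state_self hT]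

/-- The dynamic programming principle along the optimal trajectory. -/
lemma val_eq_integral_add {t s : ℝ} (ht : t ∈ Icc 0 Q.T) (hs : s ∈ Icc t Q.T) (x : K) :
    Q.val t x = (∫ τ in t..s, Q.lag (Q.state t x τ) (Q.costate t x τ)) +
      Q.val s (Q.state t x s) := by
  have hc := Q.continuous_lag ht x
  rw [val_eq, val_eq, ← intervalIntegral.integral_add_adjacent_intervals
    (hc.intervalIntegrable t s) (hc.intervalIntegrable s Q.T), add_assoc]
  congr 2
  · refine intervalIntegral.integral_congr fun τ hτ => ?_
    rw [uIcc_of_le hs.2] at hτ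
    simp only [state_state ht hs hτ x]
  · rw [(state_state ht hs (right_mem_Icc.2 hs.2) x).1]

/-- First order expansion of the value function with a quadratic remainder, uniformly in time. -/
lemma exists_abs_val_sub_le : ∃ C : ℝ, 0 ≤ C ∧ ∀ t ∈ Icc 0 Q.T, ∀ x x',
    |Q.val t x' - Q.val t x - ⟪Q.field t x, x' - x⟫_ℝ| ≤ C * ‖x' - x‖ ^ 2 := by
  have hκ : (0 : ℝ) ≤ Q.κ := Q.κ.2
  have hL : (0 : ℝ) ≤ Q.Lip := Q.Lip.2
  have hT := Q.T_pos
  set C₀ : ℝ := (Q.Lip + ‖Q.S‖) * Q.κ ^ 2 with hC₀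
  refine ⟨C₀ * Q.T + Q.Lip * Q.κ ^ 2, by positivity, fun t ht x x' => ?_⟩
  have h := isSol ht x
  have h' := isSol ht x'
  set Y := Q.state t x
  set Z := Q.costate t x
  set Y' := Q.state t x'
  set Z' := Q.costate t x'
  have cY : Continuous Y := continuous_state ht x
  have cZ : Continuous Z := continuous_costate ht x
  have cY' : Continuous Y' := continuous_state ht x'
  have cZ' : Continuous Z' := continuous_costate ht x'
  have cg : Continuous fun s => Q.g (Y s) := Q.lipschitz_g.continuous.comp cY
  have cS : Continuous fun s => -Q.S (Z' s - Z s) := by fun_prop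
  -- Through this duality the first order terms of the cost add up to `⟪Z t, x' - x⟫`.
  have pair := Q.inner_adjoint_state ht.2 (q := fun s => Q.g (Y s))
    (r := fun s => -Q.S (Z' s - Z s)) (y := fun s => Y' s - Y s) (z₀ := Z t) (y₀ := x' - x)
    cZ.continuousOn cg.continuousOn
    (cY'.sub cY).continuousOn (cS.intervalIntegrable _ _) (fun s hs => h.Z_forward hs)
    (fun s hs => IsSolOn.sub_eq Q h h' hs)
  have e : Q.val t x' - Q.val t x - ⟪Q.field t x, x' - x⟫_ℝ =
      (∫ s in t..Q.T, (Q.lag (Y' s) (Z' s) - Q.lag (Y s) (Z s) +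
        (⟪Z s, -Q.S (Z' s - Z s)⟫_ℝ - ⟪Q.g (Y s), Y' s - Y s⟫_ℝ))) +
      (Q.lT (Y' Q.T) - Q.lT (Y Q.T) - ⟪Q.gT (Y Q.T), Y' Q.T - Y Q.T⟫_ℝ) := by
    have i1 := (Q.continuous_lag ht x').intervalIntegrable (μ := volume) t Q.T
    have i2 := (Q.continuous_lag ht x).intervalIntegrable (μ := volume) t Q.T
    have i3 : IntervalIntegrable
        (fun s => ⟪Z s, -Q.S (Z' s - Z s)⟫_ℝ - ⟪Q.g (Y s), Y' s - Y s⟫_ℝ) volume t Q.T :=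
      ((cZ.inner cS).sub (cg.inner (cY'.sub cY))).intervalIntegrable _ _
    rw [intervalIntegral.integral_add (i1.sub i2) i3, intervalIntegral.integral_sub i1 i2, ← pair,
      val_eq, val_eq, h.terminal ht.2]
    change _ - ⟪Z t, x' - x⟫_ℝ = _
    ring
  have bd : ∀ s ∈ Icc t Q.T, ‖Y' s - Y s‖ ^ 2 ≤ Q.κ ^ 2 * ‖x' - x‖ ^ 2 ∧
      ‖Z' s - Z s‖ ^ 2 ≤ Q.κ ^ 2 * ‖x' - x‖ ^ 2 := fun s hs => by
    have := h.norm_sub_le ht h' hs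
    rw [← mul_pow]
    exact ⟨pow_le_pow_left₀ (norm_nonneg _) this.1 2, pow_le_pow_left₀ (norm_nonneg _) this.2 2⟩
  have b1 : ‖∫ s in t..Q.T, (Q.lag (Y' s) (Z' s) - Q.lag (Y s) (Z s) +
        (⟪Z s, -Q.S (Z' s - Z s)⟫_ℝ - ⟪Q.g (Y s), Y' s - Y s⟫_ℝ))‖ ≤
      C₀ * ‖x' - x‖ ^ 2 * |Q.T - t| := by
    refine intervalIntegral.norm_integral_le_of_norm_le_const fun s hs => ?_
    rw [uIoc_of_le ht.2] at hs
    have hb := bd s ⟨hs.1.le, hs.2⟩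
    have q1 := abs_sub_sub_inner_gradient_le Q.hasGradientAt_l Q.lipschitz_g (Y s) (Y' s)
    have q2 : |⟪Z' s - Z s, Q.S (Z' s - Z s)⟫_ℝ| ≤ ‖Q.S‖ * ‖Z' s - Z s‖ ^ 2 := by
      refine (abs_real_inner_le_norm _ _).trans ?_
      have := mul_le_mul_of_nonneg_left (Q.S.le_opNorm (Z' s - Z s)) (norm_nonneg (Z' s - Z s))
      linarith
    have q3 : Q.lag (Y' s) (Z' s) - Q.lag (Y s) (Z s) +
        (⟪Z s, -Q.S (Z' s - Z s)⟫_ℝ - ⟪Q.g (Y s), Y' s - Y s⟫_ℝ) =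
        (Q.l (Y' s) - Q.l (Y s) - ⟪Q.g (Y s), Y' s - Y s⟫_ℝ) +
        1 / 2 * ⟪Z' s - Z s, Q.S (Z' s - Z s)⟫_ℝ := by
      have sy : ⟪Z' s, Q.S (Z s)⟫_ℝ = ⟪Z s, Q.S (Z' s)⟫_ℝ := by
        rw [← inner_S_left, real_inner_comm]
      simp only [lag, map_sub, inner_sub_left, inner_sub_right, inner_neg_right, sy]
      ring
    rw [q3, Real.norm_eq_abs]
    refine (abs_add_le _ _).trans ?_
    rw [abs_mul, abs_of_pos (show (0 : ℝ) < 1 / 2 by norm_num)]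
    have q4 := mul_le_mul_of_nonneg_left hb.1 hL
    have q5 := mul_le_mul_of_nonneg_left hb.2 (norm_nonneg Q.S)
    have q6 : 0 ≤ ‖Q.S‖ * (Q.κ ^ 2 * ‖x' - x‖ ^ 2) := by positivity
    rw [hC₀]
    linarith
  have b2 := abs_sub_sub_inner_gradient_le Q.hasGradientAt_lT Q.lipschitz_gT (Y Q.T) (Y' Q.T)
  have b3 := mul_le_mul_of_nonneg_left (bd Q.T (right_mem_Icc.2 ht.2)).1 hL
  have b4 : C₀ * ‖x' - x‖ ^ 2 * |Q.T - t| ≤ C₀ * ‖x' - x‖ ^ 2 * Q.T := by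
    rw [abs_of_nonneg (sub_nonneg.2 ht.2)]
    exact mul_le_mul_of_nonneg_left (by linarith [ht.1]) (by positivity)
  rw [e]
  refine (abs_add_le _ _).trans ?_
  rw [Real.norm_eq_abs] at b1
  linarith

lemma hasGradientAt_val {t : ℝ} (ht : t ∈ Icc 0 Q.T) (x : K) :
    HasGradientAt (Q.val t) (Q.field t x) x := by
  obtain ⟨C, -, h⟩ := Q.exists_abs_val_sub_le
  exact hasGradientAt_of_abs_le fun y => h t ht x y

/-- Minus the Hamiltonian, which is the time derivative of the value function. -/
def ham (x z : K) : ℝ := -(Q.l x + ⟪z, Q.A x⟫_ℝ - 1 / 2 * ⟪z, Q.S z⟫_ℝ)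

lemma hasDerivWithinAt_primitive {X : Type*} [NormedAddCommGroup X] [NormedSpace ℝ X]
    [CompleteSpace X] {a b : ℝ} {f : ℝ → X} (hf : ContinuousOn f (Icc a b)) {s : ℝ}
    (hs : s ∈ Icc a b) (x₀ : X) :
    HasDerivWithinAt (fun r => x₀ + ∫ τ in a..r, f τ) (f s) (Icc a b) s := by
  have hab : a ≤ b := hs.1.trans hs.2
  have hc : Continuous (IccExtend hab ((Icc a b).domRestrict f)) :=
    (continuousOn_iff_continuous_domRestrict.1 hf).Icc_extend'
  have e : ∀ r ∈ Icc a b, IccExtend hab ((Icc a b).domRestrict f) r = f r := fun r hr => by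
    simp [IccExtend_of_mem hab _ hr]
  have h1 := ((hc.integral_hasStrictDerivAt a s).hasDerivAt.const_add x₀).hasDerivWithinAt
    (s := Icc a b)
  rw [e s hs] at h1
  refine h1.congr_of_mem (fun r hr => ?_) hs
  congr 1
  refine intervalIntegral.integral_congr fun τ hτ => ?_
  rw [uIcc_of_le hr.1] at hτ
  exact (e τ ⟨hτ.1, hτ.2.trans hr.2⟩).symm

variable {Q} in
lemma IsSolOn.hasDerivWithinAt_Y {a b : ℝ} {Γ : K → K} {x : K} {Y Z : ℝ → K}
    (h : Q.IsSolOn a b Γ x Y Z) {s : ℝ} (hs : s ∈ Icc a b) :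
    HasDerivWithinAt Y (Q.A (Y s) - Q.S (Z s)) (Icc a b) s :=
  (hasDerivWithinAt_primitive h.contA hs x).congr_of_mem h.eqY hs

lemma exists_abs_lag_le (ρ : ℝ) : ∃ C, 0 ≤ C ∧ ∀ y z : K, ‖y‖ ≤ ρ → ‖z‖ ≤ ρ →
    |Q.lag y z| ≤ C := by
  have hL : (0 : ℝ) ≤ Q.Lip := Q.Lip.2
  refine ⟨|Q.l 0| + ‖Q.g 0‖ * |ρ| + Q.Lip * |ρ| ^ 2 + ‖Q.S‖ * |ρ| ^ 2, by positivity,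
    fun y z hy hz => ?_⟩
  have hy' := hy.trans (le_abs_self ρ)
  have hz' := hz.trans (le_abs_self ρ)
  have q1 := abs_sub_sub_inner_gradient_le Q.hasGradientAt_l Q.lipschitz_g 0 y
  rw [sub_zero] at q1
  have q2 := (abs_real_inner_le_norm (Q.g 0) y).trans
    (mul_le_mul_of_nonneg_left hy' (norm_nonneg _))
  have q3 : |⟪z, Q.S z⟫_ℝ| ≤ ‖Q.S‖ * |ρ| ^ 2 := by
    refine (abs_real_inner_le_norm _ _).trans ?_
    have h1 := mul_le_mul hz' ((Q.S.le_opNorm z).trans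
      (mul_le_mul_of_nonneg_left hz' (norm_nonneg _))) (norm_nonneg _) (abs_nonneg _)
    linarith
  have q4 : Q.Lip * ‖y‖ ^ 2 ≤ Q.Lip * |ρ| ^ 2 :=
    mul_le_mul_of_nonneg_left (pow_le_pow_left₀ (norm_nonneg _) hy' 2) hL
  have q5 : 0 ≤ ‖Q.S‖ * |ρ| ^ 2 := by positivity
  rw [lag, abs_le]
  rw [abs_le] at q1 q2 q3
  have := neg_abs_le (Q.l 0)
  have := le_abs_self (Q.l 0)
  constructor <;> linarith

lemma continuousOn_val (x : K) : ContinuousOn (fun t => Q.val t x) (Icc 0 Q.T) := by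
  obtain ⟨C, hC, hsp⟩ := Q.exists_speed
  obtain ⟨R, hR, hgr⟩ := Q.exists_growth
  obtain ⟨D, hD, hval⟩ := Q.exists_abs_val_sub_le
  obtain ⟨E, hE, hlag⟩ := Q.exists_abs_lag_le (R * (1 + ‖x‖))
  have hT := Q.T_pos.le
  set c₁ := C * (1 + ‖x‖)
  have hc₁ : 0 ≤ c₁ := by positivity
  have key : ∀ t ∈ Icc 0 Q.T, ∀ s ∈ Icc t Q.T, |Q.val s x - Q.val t x| ≤
      (R * (1 + ‖x‖) * c₁ + D * (c₁ ^ 2 * Q.T) + E) * (s - t) := by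
    intro t ht s hs
    have hs0 := mem_Icc_of ht hs
    have hst : 0 ≤ s - t := sub_nonneg.2 hs.1
    have h1 := hval s hs0 x (Q.state t x s)
    have h2 := (hsp t ht s hs x).1
    have h3 : |⟪Q.field s x, Q.state t x s - x⟫_ℝ| ≤ R * (1 + ‖x‖) * (c₁ * (s - t)) :=
      (abs_real_inner_le_norm _ _).trans (mul_le_mul
        (hgr s hs0 s (left_mem_Icc.2 hs.2) x).2 h2 (norm_nonneg _) (by positivity))
    have h4 : ‖Q.state t x s - x‖ ^ 2 ≤ c₁ ^ 2 * Q.T * (s - t) := by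
      have a1 := pow_le_pow_left₀ (norm_nonneg _) h2 2
      have a2 : (c₁ * (s - t)) ^ 2 = c₁ ^ 2 * (s - t) * (s - t) := by ring
      have a3 : c₁ ^ 2 * (s - t) * (s - t) ≤ c₁ ^ 2 * Q.T * (s - t) := by
        gcongr; linarith [ht.1, hs.2]
      linarith
    have h5 : ‖∫ τ in t..s, Q.lag (Q.state t x τ) (Q.costate t x τ)‖ ≤ E * |s - t| :=
      intervalIntegral.norm_integral_le_of_norm_le_const fun τ hτ => by
        rw [uIoc_of_le hs.1] at hτ
        have := hgr t ht τ ⟨hτ.1.le, hτ.2.trans hs.2⟩ x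
        exact hlag _ _ this.1 this.2
    have h6 := Q.val_eq_integral_add ht hs x
    have h7 := mul_le_mul_of_nonneg_left h4 hD
    rw [abs_of_nonneg hst, Real.norm_eq_abs] at h5
    rw [abs_le] at h1 h3 h5 ⊢
    constructor <;> nlinarith
  have : LipschitzOnWith ⟨R * (1 + ‖x‖) * c₁ + D * (c₁ ^ 2 * Q.T) + E, by positivity⟩
      (fun t => Q.val t x) (Icc 0 Q.T) := by
    refine LipschitzOnWith.of_dist_le_mul fun t ht s hs => ?_
    change _ ≤ (R * (1 + ‖x‖) * c₁ + D * (c₁ ^ 2 * Q.T) + E) * _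
    rcases le_total t s with hts | hts
    · rw [dist_comm, Real.dist_eq, Real.dist_eq, abs_sub_comm t, abs_of_nonneg (sub_nonneg.2 hts)]
      exact key t ht s ⟨hts, hs.2⟩
    · rw [Real.dist_eq, Real.dist_eq, abs_of_nonneg (sub_nonneg.2 hts)]
      exact key s hs t ⟨hts, ht.2⟩
  exact this.continuousOn

/-- Dynamic programming gives the derivative to the right only, as the flow runs forward in time. -/
lemma hasDerivWithinAt_val_right {t : ℝ} (ht : t ∈ Icc 0 Q.T) (x : K) :
    HasDerivWithinAt (fun s => Q.val s x) (Q.ham x (Q.field t x)) (Icc t Q.T) t := by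
  obtain ⟨D, hD, hval⟩ := Q.exists_abs_val_sub_le
  have htt : t ∈ Icc t Q.T := left_mem_Icc.2 ht.2
  have hsub : Icc t Q.T ⊆ Icc 0 Q.T := Icc_subset_Icc_left ht.1
  have h := isSol ht x
  have hY := h.hasDerivWithinAt_Y htt
  have h1 := hasDerivWithinAt_sub_along (W := fun x s => Q.val s x) (G := fun x s => Q.field s x)
    (C := D) (fun s hs z => hval s (hsub hs) _ z)
    (((Q.continuousOn_field _).mono hsub) t htt) hY
  have h2 := hasDerivWithinAt_primitive (Q.continuous_lag ht x).continuousOn htt 0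
  have h3 := (h1.add h2).const_sub (Q.val t x)
  rw [state_self ht] at h3
  refine (h3.congr_of_mem (fun s hs => ?_) htt).congr_deriv ?_
  · have := Q.val_eq_integral_add ht hs x
    simp only [Pi.add_apply, zero_add]
    linarith
  · change -(⟪Q.field t x, Q.A x - Q.S (Q.field t x)⟫_ℝ + Q.lag x (Q.field t x)) = _
    rw [ham, lag, inner_sub_right]
    ring

/-- The Hamilton-Jacobi-Bellman equation for the value function. The derivative is two-sided because
the value function and the primitive of its right derivative differ by a continuous function with
zero right derivative. -/
lemma hasDerivWithinAt_val {t : ℝ} (ht : t ∈ Icc 0 Q.T) (x : K) :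
    HasDerivWithinAt (fun s => Q.val s x) (Q.ham x (Q.field t x)) (Icc 0 Q.T) t := by
  have hcw : ContinuousOn (fun s => Q.ham x (Q.field s x)) (Icc 0 Q.T) := by
    have hf := Q.continuousOn_field x
    exact ((continuousOn_const.add (hf.inner continuousOn_const)).sub (continuousOn_const.mul
      (hf.inner (Q.S.continuous.comp_continuousOn hf)))).neg
  have hprim : ∀ s ∈ Icc 0 Q.T, HasDerivWithinAt
      (fun r => Q.val 0 x + ∫ τ in (0 : ℝ)..r, Q.ham x (Q.field τ x)) (Q.ham x (Q.field s x))
      (Icc 0 Q.T) s := fun s hs => hasDerivWithinAt_primitive hcw hs _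
  have hconst := constant_of_has_deriv_right_zero
    (f := fun s => Q.val s x - (Q.val 0 x + ∫ τ in (0 : ℝ)..s, Q.ham x (Q.field τ x)))
    (a := 0) (b := Q.T) ((Q.continuousOn_val x).sub fun s hs => (hprim s hs).continuousWithinAt)
    (fun s hs => by
      have hs' : s ∈ Icc 0 Q.T := ⟨hs.1, hs.2.le⟩
      have h1 := (Q.hasDerivWithinAt_val_right hs' x).sub
        ((hprim s hs').mono (Icc_subset_Icc_left hs.1))
      rw [sub_self] at h1
      exact h1.mono_of_mem_nhdsWithin (Icc_mem_nhdsGE hs.2))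
  refine (hprim t ht).congr_of_mem (fun s hs => ?_) ht
  have := hconst s hs
  simp only [intervalIntegral.integral_same, add_zero, sub_self] at this
  linarith

end ConvexControl

/-! ### Optimality of the flow -/

lemma integrable_inner_of_memLp_two {α F : Type*} [MeasurableSpace α] {μ : Measure α}
    [NormedAddCommGroup F] [InnerProductSpace ℝ F] {f k : α → F} (hf : MemLp f 2 μ)
    (hk : MemLp k 2 μ) : Integrable (fun x => ⟪f x, k x⟫_ℝ) μ := by
  have i1 := (memLp_two_iff_integrable_sq_norm hf.1).1 hf
  have i2 := (memLp_two_iff_integrable_sq_norm hk.1).1 hk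
  refine (i1.add i2).mono' (hf.1.inner hk.1) (Filter.Eventually.of_forall fun x => ?_)
  refine (norm_inner_le_norm _ _).trans ?_
  simp only [Pi.add_apply]
  nlinarith [sq_nonneg (‖f x‖ - ‖k x‖), sq_nonneg ‖f x‖, sq_nonneg ‖k x‖]

lemma memLp_Ioc_of_continuousOn {F : Type*} [NormedAddCommGroup F] {a b : ℝ} {f : ℝ → F}
    (hf : ContinuousOn f (Icc a b)) (p : ENNReal) : MemLp f p (volume.restrict (Ioc a b)) := by
  obtain ⟨C, hC⟩ := isCompact_Icc.exists_bound_of_continuousOn hf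
  refine MemLp.of_bound ((hf.mono Ioc_subset_Icc_self).aestronglyMeasurable measurableSet_Ioc) C ?_
  filter_upwards [ae_restrict_mem measurableSet_Ioc] with s hs using hC s (Ioc_subset_Icc_self hs)

namespace ConvexControl

variable {K : Type*} [NormedAddCommGroup K] [InnerProductSpace ℝ K] [CompleteSpace K]
  (Q : ConvexControl K)

/-- The cost of the control `v` with state `y`. -/
def trackCost (t : ℝ) (v y : ℝ → K) : ℝ :=
  (∫ s in t..Q.T, Q.l (y s)) + Q.lT (y Q.T) + 1 / 2 * ∫ s in t..Q.T, ⟪v s, Q.N (v s)⟫_ℝ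

/-- The feedback control `-N⁻¹ B* z`. -/
def feedback (z : K) : K := -Q.Ninv (Q.Bs z)

lemma B_feedback (z : K) : Q.B (Q.feedback z) = -Q.S z := by
  rw [feedback, map_neg, S_apply]

lemma inner_N_feedback (v z : K) : ⟪v, Q.N (Q.feedback z)⟫_ℝ = -⟪Q.B v, z⟫_ℝ := by
  rw [feedback, map_neg, Q.N_Ninv, inner_neg_right, real_inner_comm, inner_Bs_left,
    real_inner_comm]

lemma inner_feedback_N_feedback (z : K) :
    ⟪Q.feedback z, Q.N (Q.feedback z)⟫_ℝ = ⟪z, Q.S z⟫_ℝ := by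
  rw [inner_N_feedback, B_feedback, inner_neg_left, neg_neg, real_inner_comm]

lemma continuous_feedback : Continuous Q.feedback := by
  unfold feedback
  fun_prop

lemma trackCost_feedback {t : ℝ} {y z : ℝ → K} (ht : t ≤ Q.T) (hy : ContinuousOn y (Icc t Q.T))
    (hz : ContinuousOn z (Icc t Q.T)) :
    Q.trackCost t (fun s => Q.feedback (z s)) y =
      (∫ s in t..Q.T, Q.lag (y s) (z s)) + Q.lT (y Q.T) := by
  have i1 : IntervalIntegrable (fun s => Q.l (y s)) volume t Q.T :=
    (Q.continuous_l.comp_continuousOn hy).intervalIntegrable_of_Icc ht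
  have i2 : IntervalIntegrable (fun s => 1 / 2 * ⟪z s, Q.S (z s)⟫_ℝ) volume t Q.T :=
    (continuousOn_const.mul (hz.inner (Q.S.continuous.comp_continuousOn
      hz))).intervalIntegrable_of_Icc ht
  simp only [trackCost, lag, inner_feedback_N_feedback]
  rw [intervalIntegral.integral_add i1 i2, intervalIntegral.integral_const_mul]
  ring

lemma trackCost_opt {t : ℝ} (ht : t ∈ Icc 0 Q.T) (x : K) :
    Q.trackCost t (fun s => Q.feedback (Q.costate t x s)) (Q.state t x) = Q.val t x :=
  Q.trackCost_feedback ht.2 (continuous_state ht x).continuousOn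
    (continuous_costate ht x).continuousOn

/-- The verification theorem: convexity of the running and terminal costs, integrated along the
duality `inner_adjoint_state`, bounds the excess cost of a control from below. -/
lemma val_add_le_trackCost {t : ℝ} (ht : t ∈ Icc 0 Q.T) (x : K) {v y : ℝ → K}
    (hv : MemLp v 2 (volume.restrict (Ioc t Q.T))) (hyc : ContinuousOn y (Icc t Q.T))
    (hy : ∀ s ∈ Icc t Q.T, y s = x + ∫ τ in t..s, (Q.A (y τ) + Q.B (v τ))) :
    Q.val t x + Q.c / 2 * ∫ s in t..Q.T, ‖v s - Q.feedback (Q.costate t x s)‖ ^ 2 ≤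
      Q.trackCost t v y := by
  have h := isSol ht x
  set Y := Q.state t x with hY
  set Z := Q.costate t x with hZ
  have cY : Continuous Y := continuous_state ht x
  have cZ : Continuous Z := continuous_costate ht x
  set u : ℝ → K := fun s => Q.feedback (Z s) with hu
  have cu : Continuous u := Q.continuous_feedback.comp cZ
  have mu : MemLp u 2 (volume.restrict (Ioc t Q.T)) := memLp_Ioc_of_continuousOn cu.continuousOn 2
  set w : ℝ → K := fun s => v s - u s with hw
  have mw : MemLp w 2 (volume.restrict (Ioc t Q.T)) := hv.sub mu
  have iN : ∀ {f k : ℝ → K}, MemLp f 2 (volume.restrict (Ioc t Q.T)) →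
      MemLp k 2 (volume.restrict (Ioc t Q.T)) →
      IntervalIntegrable (fun s => ⟪f s, k s⟫_ℝ) volume t Q.T := fun hf hk =>
    (intervalIntegrable_iff_integrableOn_Ioc_of_le ht.2).2 (integrable_inner_of_memLp_two hf hk)
  have iB : ∀ {f : ℝ → K}, MemLp f 2 (volume.restrict (Ioc t Q.T)) → ∀ s ∈ Icc t Q.T,
      IntervalIntegrable (fun s => Q.B (f s)) volume t s := fun hf s hs => by
    refine (intervalIntegrable_iff_integrableOn_Ioc_of_le hs.1).2 ?_
    exact (Q.B.integrable_comp (hf.integrable one_le_two)).mono_measure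
      (Measure.restrict_mono (Ioc_subset_Ioc_right hs.2) le_rfl)
  have hTT := right_mem_Icc.2 ht.2
  have cg : Continuous fun s => Q.g (Y s) := Q.lipschitz_g.continuous.comp cY
  have cδ : ContinuousOn (fun s => y s - Y s) (Icc t Q.T) := hyc.sub cY.continuousOn
  have hδ : ∀ s ∈ Icc t Q.T, y s - Y s = 0 + ∫ τ in t..s, (Q.A (y τ - Y τ) + Q.B (w τ)) := by
    intro s hs
    have i1 : IntervalIntegrable (fun τ => Q.A (y τ) + Q.B (v τ)) volume t s :=
      (((Q.A.continuous.comp_continuousOn hyc).mono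
        (Icc_subset_Icc_right hs.2)).intervalIntegrable_of_Icc hs.1).add (iB hv s hs)
    have i2 : IntervalIntegrable (fun τ => Q.A (Y τ) - Q.S (Z τ)) volume t s :=
      ((Q.A.continuous.comp cY).sub (Q.S.continuous.comp cZ)).intervalIntegrable _ _
    have e : ∀ τ, Q.A (y τ - Y τ) + Q.B (w τ) =
        (Q.A (y τ) + Q.B (v τ)) - (Q.A (Y τ) - Q.S (Z τ)) := fun τ => by
      simp only [hw, hu, map_sub, B_feedback]; abel
    simp_rw [e]
    rw [intervalIntegral.integral_sub i1 i2, hy s hs, h.eqY s hs]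
    abel
  have pair := Q.inner_adjoint_state ht.2 (q := fun s => Q.g (Y s)) (r := fun s => Q.B (w s))
    (y := fun s => y s - Y s) cZ.continuousOn cg.continuousOn cδ (iB mw Q.T hTT)
    (fun s hs => h.Z_forward hs) hδ
  have mZ : MemLp Z 2 (volume.restrict (Ioc t Q.T)) := memLp_Ioc_of_continuousOn cZ.continuousOn 2
  have iZ : IntervalIntegrable (fun s => ⟪Z s, Q.B (w s)⟫_ℝ) volume t Q.T :=
    iN mZ (Q.B.comp_memLp' mw)
  have ig : IntervalIntegrable (fun s => ⟪Q.g (Y s), y s - Y s⟫_ℝ) volume t Q.T :=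
    (cg.continuousOn.inner cδ).intervalIntegrable_of_Icc ht.2
  rw [intervalIntegral.integral_sub iZ ig, inner_zero_right, sub_zero, h.terminal ht.2] at pair
  have il : IntervalIntegrable (fun s => Q.l (y s)) volume t Q.T :=
    (Q.continuous_l.comp_continuousOn hyc).intervalIntegrable_of_Icc ht.2
  have iL : IntervalIntegrable (fun s => Q.l (Y s)) volume t Q.T :=
    (Q.continuous_l.comp cY).intervalIntegrable _ _
  have c1 : ∫ s in t..Q.T, ⟪Q.g (Y s), y s - Y s⟫_ℝ ≤
      (∫ s in t..Q.T, Q.l (y s)) - ∫ s in t..Q.T, Q.l (Y s) := by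
    rw [← intervalIntegral.integral_sub il iL]
    refine intervalIntegral.integral_mono_on ht.2 ig (il.sub iL) fun s _ => ?_
    exact inner_gradient_le_sub Q.hasGradientAt_l
      (fun a b => (mul_nonneg Q.c_pos.le (sq_nonneg _)).trans (Q.mono_g a b)) _ _
  have c2 : ⟪Q.gT (Y Q.T), y Q.T - Y Q.T⟫_ℝ ≤ Q.lT (y Q.T) - Q.lT (Y Q.T) :=
    inner_gradient_le_sub Q.hasGradientAt_lT
      (fun a b => (mul_nonneg Q.c_pos.le (sq_nonneg _)).trans (Q.mono_gT a b)) _ _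
  have iu : IntervalIntegrable (fun s => ⟪u s, Q.N (u s)⟫_ℝ) volume t Q.T :=
    iN mu (Q.N.comp_memLp' mu)
  have iw : IntervalIntegrable (fun s => ⟪w s, Q.N (w s)⟫_ℝ) volume t Q.T :=
    iN mw (Q.N.comp_memLp' mw)
  -- The cross term in the expansion around the optimal control `u` is the one in `pair`.
  have c3 : ∫ s in t..Q.T, ⟪v s, Q.N (v s)⟫_ℝ = (∫ s in t..Q.T, ⟪u s, Q.N (u s)⟫_ℝ) -
      2 * (∫ s in t..Q.T, ⟪Z s, Q.B (w s)⟫_ℝ) + ∫ s in t..Q.T, ⟪w s, Q.N (w s)⟫_ℝ := by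
    rw [← intervalIntegral.integral_const_mul, ← intervalIntegral.integral_sub
      iu (iZ.const_mul 2), ← intervalIntegral.integral_add (iu.sub (iZ.const_mul 2)) iw]
    refine intervalIntegral.integral_congr fun s _ => ?_
    have e1 : v s = u s + w s := by simp [hw]
    have e2 : ⟪w s, Q.N (u s)⟫_ℝ = -⟪Z s, Q.B (w s)⟫_ℝ := by
      rw [hu, inner_N_feedback, real_inner_comm]
    have e3 : ⟪u s, Q.N (w s)⟫_ℝ = ⟪w s, Q.N (u s)⟫_ℝ := by
      rw [← Q.N_symm, real_inner_comm]
    simp only [e1, map_add, inner_add_left, inner_add_right, e3, e2]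
    ring
  have c4 : Q.c * ∫ s in t..Q.T, ‖w s‖ ^ 2 ≤ ∫ s in t..Q.T, ⟪w s, Q.N (w s)⟫_ℝ := by
    rw [← intervalIntegral.integral_const_mul]
    refine intervalIntegral.integral_mono_on ht.2 ?_ iw fun s _ => ?_
    · exact ((intervalIntegrable_iff_integrableOn_Ioc_of_le ht.2).2
        ((memLp_two_iff_integrable_sq_norm mw.1).1 mw)).const_mul _
    · rw [real_inner_comm]; exact Q.N_coercive _
  have c5 := Q.trackCost_opt ht x
  simp only [trackCost] at c5 ⊢
  change _ + _ + 1 / 2 * (∫ s in t..Q.T, ⟪u s, Q.N (u s)⟫_ℝ) = _ at c5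
  rw [c3, ← c5]
  linarith

lemma isState_opt {t : ℝ} (ht : t ∈ Icc 0 Q.T) (x : K) {s : ℝ} (hs : s ∈ Icc t Q.T) :
    Q.state t x s = x + ∫ τ in t..s, (Q.A (Q.state t x τ) +
      Q.B (Q.feedback (Q.costate t x τ))) := by
  simp only [B_feedback, ← sub_eq_add_neg]
  exact (isSol ht x).eqY s hs

lemma val_le_trackCost {t : ℝ} (ht : t ∈ Icc 0 Q.T) (x : K) {v y : ℝ → K}
    (hv : MemLp v 2 (volume.restrict (Ioc t Q.T))) (hyc : ContinuousOn y (Icc t Q.T))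
    (hy : ∀ s ∈ Icc t Q.T, y s = x + ∫ τ in t..s, (Q.A (y τ) + Q.B (v τ))) :
    Q.val t x ≤ Q.trackCost t v y := by
  refine le_trans ?_ (Q.val_add_le_trackCost ht x hv hyc hy)
  have : 0 ≤ ∫ s in t..Q.T, ‖v s - Q.feedback (Q.costate t x s)‖ ^ 2 :=
    intervalIntegral.integral_nonneg ht.2 fun s _ => sq_nonneg _
  have := mul_nonneg (div_nonneg Q.c_pos.le zero_le_two) this
  linarith

/-! ### Uniqueness for the Bellman equation -/

lemma le_of_hasDerivWithinAt_nonneg {a b : ℝ} (hab : a ≤ b) {f f' : ℝ → ℝ}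
    (hf : ∀ s ∈ Icc a b, HasDerivWithinAt f (f' s) (Icc a b) s)
    (hf' : ∀ s ∈ Icc a b, 0 ≤ f' s) : f a ≤ f b :=
  monotoneOn_of_hasDerivWithinAt_nonneg (convex_Icc a b)
    (fun s hs => (hf s hs).continuousWithinAt)
    (fun s hs => (hf s (interior_subset hs)).mono interior_subset)
    (fun s hs => hf' s (interior_subset hs)) (left_mem_Icc.2 hab) (right_mem_Icc.2 hab) hab

/-- Uniqueness of the classical solution of the Bellman equation. The inequality `W ≤ val` follows
`W` along the optimal flow, the converse follows it along the closed loop of its own feedback. -/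
lemma bellman_unique {W : K → ℝ → ℝ} {G : K → ℝ → K} {L : ℝ≥0}
    (hG : ∀ t ∈ Icc 0 Q.T, ∀ x, HasGradientAt (fun x' => W x' t) (G x t) x)
    (hL : ∀ t ∈ Icc 0 Q.T, LipschitzWith L fun x => G x t)
    (hGc : ∀ x, ContinuousOn (G x) (Icc 0 Q.T))
    (hW : ∀ x, ∀ t ∈ Icc 0 Q.T, ∃ w : ℝ, HasDerivWithinAt (W x) w (Icc 0 Q.T) t ∧
      -w - ⟪G x t, Q.A x⟫_ℝ + 1 / 2 * ⟪G x t, Q.S (G x t)⟫_ℝ = Q.l x)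
    (hWT : ∀ x, W x Q.T = Q.lT x) {t : ℝ} (ht : t ∈ Icc 0 Q.T) (x : K) : W x t = Q.val t x := by
  have hsub : Icc t Q.T ⊆ Icc 0 Q.T := Icc_subset_Icc_left ht.1
  -- By the equation for `W`, its derivative along a trajectory with velocity `A y - S z` is minus the
  -- running cost up to a quadratic term, which vanishes if `z` is the feedback of `W`.
  have along : ∀ (y z : ℝ → K) (s : ℝ), s ∈ Icc t Q.T →
      HasDerivWithinAt y (Q.A (y s) - Q.S (z s)) (Icc t Q.T) s →
      HasDerivWithinAt (fun r => W (y r) r)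
        (-Q.lag (y s) (z s) + 1 / 2 * ⟪G (y s) s - z s, Q.S (G (y s) s - z s)⟫_ℝ)
        (Icc t Q.T) s := by
    intro y z s hs hy
    obtain ⟨w, hw, hwe⟩ := hW (y s) s (hsub hs)
    have h1 := hasDerivWithinAt_sub_along (W := W) (G := G) (C := L) (I := Icc t Q.T) (t₀ := s)
      (y := y) (fun r hr z => abs_sub_sub_inner_gradient_le (l := fun x => W x r)
        (hG r (hsub hr)) (hL r (hsub hr)) _ z) ((hGc _ s (hsub hs)).mono hsub) hy
    have h2 := h1.add (hw.mono hsub)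
    refine (h2.congr_of_mem (fun r _ => by simp) hs).congr_deriv ?_
    have sy : ⟪z s, Q.S (G (y s) s)⟫_ℝ = ⟪G (y s) s, Q.S (z s)⟫_ℝ := by
      rw [← inner_S_left, real_inner_comm]
    simp only [lag, map_sub, inner_sub_left, inner_sub_right, sy]
    linarith
  have prim : ∀ (y z : ℝ → K), ContinuousOn y (Icc t Q.T) → ContinuousOn z (Icc t Q.T) →
      ∀ s ∈ Icc t Q.T, HasDerivWithinAt (fun r => 0 + ∫ τ in t..r, Q.lag (y τ) (z τ))
        (Q.lag (y s) (z s)) (Icc t Q.T) s := fun y z hy hz s hs =>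
    hasDerivWithinAt_primitive (Q.continuousOn_lag hy hz) hs 0
  apply le_antisymm
  · have h := isSol ht x
    have hd := fun s hs => (along _ _ s hs (h.hasDerivWithinAt_Y hs)).add
      (prim _ _ h.contY h.contZ s hs)
    have := le_of_hasDerivWithinAt_nonneg ht.2 hd fun s _ => by
      have := (mul_nonneg Q.c_pos.le (sq_nonneg _)).trans
        (Q.S_coercive' (G (Q.state t x s) s - Q.costate t x s))
      linarith
    simp only [Pi.add_apply, state_self ht, hWT, intervalIntegral.integral_same] at this
    rw [val_eq]
    linarith
  -- The closed loop `y' = A y - S (G y)`; times are projected to `[0, T]` to have a globally defined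
  -- right hand side.
  · set p : ℝ → Icc 0 Q.T := projIcc 0 Q.T Q.T_pos.le with hp
    have hpm : ∀ s, (p s : ℝ) ∈ Icc 0 Q.T := fun s => (p s).2
    have hLip : ∀ s, LipschitzWith (‖Q.A‖₊ + ‖Q.S‖₊ * L) fun y => Q.A y - Q.S (G y (p s)) := by
      intro s
      exact Q.A.lipschitz.sub (Q.S.lipschitz.comp (hL _ (hpm s)))
    have hcont : Continuous (Function.uncurry fun (s : ℝ) y => Q.A y - Q.S (G y (p s))) := by
      refine continuous_prod_of_continuous_lipschitzWith' _ _ hLip fun y => ?_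
      have : Continuous fun s => G y (p s) :=
        (hGc y).comp_continuous (continuous_subtype_val.comp continuous_projIcc) hpm
      change Continuous fun s => Q.A y - Q.S (G y (p s))
      exact continuous_const.sub (Q.S.continuous.comp this)
    obtain ⟨Y, cY, eY⟩ := exists_solution_of_lipschitz hcont hLip ht.2 x
    have hps : ∀ s ∈ Icc t Q.T, (p s : ℝ) = s := fun s hs => by
      rw [hp, projIcc_of_mem _ (hsub hs)]
    set Z : ℝ → K := fun s => G (Y s) (p s) with hZ
    have cZ : ContinuousOn Z (Icc t Q.T) := by
      have : Continuous (Function.uncurry fun (s : ℝ) y => G y (p s)) := by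
        refine continuous_prod_of_continuous_lipschitzWith' _ _ (fun s => hL _ (hpm s)) fun y => ?_
        exact (hGc y).comp_continuous (continuous_subtype_val.comp continuous_projIcc) hpm
      exact this.comp_continuousOn (continuousOn_id.prodMk cY)
    have cv : ContinuousOn (fun τ => Q.A (Y τ) - Q.S (Z τ)) (Icc t Q.T) :=
      (Q.A.continuous.comp_continuousOn cY).sub (Q.S.continuous.comp_continuousOn cZ)
    have hY : ∀ s ∈ Icc t Q.T, HasDerivWithinAt Y (Q.A (Y s) - Q.S (Z s)) (Icc t Q.T) s :=
      fun s hs => (hasDerivWithinAt_primitive cv hs x).congr_of_mem eY hs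
    have hd := fun s hs => ((along _ _ s hs (hY s hs)).add (prim _ _ cY cZ s hs)).neg
    have hle := le_of_hasDerivWithinAt_nonneg ht.2 hd fun s hs => by
      simp [hZ, hps s hs]
    have hYt : Y t = x := by rw [eY t (left_mem_Icc.2 ht.2)]; simp
    simp only [Pi.add_apply, Pi.neg_apply, hYt, hWT, intervalIntegral.integral_same] at hle
    have hopt := Q.val_le_trackCost ht x (v := fun s => Q.feedback (Z s))
      (memLp_Ioc_of_continuousOn (Q.continuous_feedback.comp_continuousOn cZ) 2) cY fun s hs => by
        simp only [B_feedback, ← sub_eq_add_neg]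
        exact eY s hs
    rw [Q.trackCost_feedback ht.2 cY cZ] at hopt
    linarith

end ConvexControl

/-! ### Functions of quadratic growth on the Wasserstein space -/

section Wasserstein

variable {n : ℕ}

/-- The second moment of `m`. -/
def secondMoment (m : P2 n) : ℝ := ∫ x, ‖x‖ ^ 2 ∂m.toMeasure

lemma secondMoment_nonneg (m : P2 n) : 0 ≤ secondMoment m := integral_nonneg fun _ => sq_nonneg _

/-- Functions that are Lipschitz on balls with a constant growing linearly in the radius. -/
structure QuadLip (C : ℝ) (u : E n → ℝ) : Prop where
  nonneg : 0 ≤ C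
  cont : Continuous u
  bound : ∀ x y, |u x - u y| ≤ C * (1 + ‖x‖ + ‖y‖) * ‖x - y‖

lemma QuadLip.growth {C : ℝ} {u : E n → ℝ} (hu : QuadLip C u) (x : E n) :
    |u x| ≤ (|u 0| + 2 * C) * (1 + ‖x‖ ^ 2) := by
  have h := hu.bound x 0
  have hC := hu.nonneg
  simp only [norm_zero, add_zero, sub_zero] at h
  have h1 : |u x| ≤ |u 0| + |u x - u 0| := by
    have := abs_add_le (u 0) (u x - u 0)
    rwa [add_sub_cancel] at this
  have h2 : C * (1 + ‖x‖) * ‖x‖ ≤ 2 * C * (1 + ‖x‖ ^ 2) := by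
    nlinarith [mul_nonneg hC (sq_nonneg (‖x‖ - 1)), mul_nonneg hC (sq_nonneg ‖x‖)]
  have h3 : 0 ≤ |u 0| * ‖x‖ ^ 2 := by positivity
  linarith

lemma integrable_of_growth {m : P2 n} {u : E n → ℝ} {C : ℝ} (hc : Continuous u)
    (hu : ∀ x, |u x| ≤ C * (1 + ‖x‖ ^ 2)) : Integrable u m.toMeasure :=
  (((integrable_const (1 : ℝ)).add m.sq_integrable).const_mul C).mono' hc.aestronglyMeasurable
    (Filter.Eventually.of_forall hu)

lemma QuadLip.integrable {C : ℝ} {u : E n → ℝ} (hu : QuadLip C u) (m : P2 n) :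
    Integrable u m.toMeasure :=
  integrable_of_growth hu.cont hu.growth

/-! ### Couplings -/

/-- `π` is a coupling of `μ` and `ν`. -/
def IsCoupling (π : Measure (E n × E n)) (μ ν : P2 n) : Prop :=
  π.map Prod.fst = μ.toMeasure ∧ π.map Prod.snd = ν.toMeasure

section Coupling

variable {π : Measure (E n × E n)} {μ ν : P2 n}

lemma IsCoupling.isProbabilityMeasure (h : IsCoupling π μ ν) : IsProbabilityMeasure π := by
  constructor
  rw [← Set.preimage_univ (f := Prod.fst), ← Measure.map_apply measurable_fst MeasurableSet.univ,
    h.1, measure_univ]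

lemma IsCoupling.integrable_fst (h : IsCoupling π μ ν) {f : E n → ℝ}
    (hf : Integrable f μ.toMeasure) : Integrable (fun p => f p.1) π := by
  rw [← h.1] at hf
  exact (integrable_map_measure hf.1 measurable_fst.aemeasurable).1 hf

lemma IsCoupling.integrable_snd (h : IsCoupling π μ ν) {f : E n → ℝ}
    (hf : Integrable f ν.toMeasure) : Integrable (fun p => f p.2) π := by
  rw [← h.2] at hf
  exact (integrable_map_measure hf.1 measurable_snd.aemeasurable).1 hf

lemma IsCoupling.integral_fst (h : IsCoupling π μ ν) {f : E n → ℝ} (hf : Continuous f) :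
    ∫ p, f p.1 ∂π = ∫ x, f x ∂μ.toMeasure := by
  rw [← h.1, integral_map measurable_fst.aemeasurable hf.aestronglyMeasurable]

lemma IsCoupling.integral_snd (h : IsCoupling π μ ν) {f : E n → ℝ} (hf : Continuous f) :
    ∫ p, f p.2 ∂π = ∫ x, f x ∂ν.toMeasure := by
  rw [← h.2, integral_map measurable_snd.aemeasurable hf.aestronglyMeasurable]

lemma IsCoupling.integrable_cost (h : IsCoupling π μ ν) :
    Integrable (fun p => ‖p.1 - p.2‖ ^ 2) π := by
  refine (((h.integrable_fst μ.sq_integrable).const_mul 2).add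
    ((h.integrable_snd ν.sq_integrable).const_mul 2)).mono'
    (by fun_prop) (Filter.Eventually.of_forall fun p => ?_)
  rw [Real.norm_of_nonneg (sq_nonneg _)]
  have := pow_le_pow_left₀ (norm_nonneg _) (norm_sub_le p.1 p.2) 2
  simp only [Pi.add_apply]
  nlinarith [sq_nonneg (‖p.1‖ - ‖p.2‖)]

lemma IsCoupling.swap (h : IsCoupling π μ ν) : IsCoupling (π.map Prod.swap) ν μ := by
  constructor
  · rw [Measure.map_map measurable_fst measurable_swap]; exact h.2
  · rw [Measure.map_map measurable_snd measurable_swap]; exact h.1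

lemma isCoupling_prod (μ ν : P2 n) : IsCoupling (μ.toMeasure.prod ν.toMeasure) μ ν := by
  constructor
  · rw [Measure.map_fst_prod]; simp
  · rw [Measure.map_snd_prod]; simp

lemma W2_nonneg (μ ν : P2 n) : 0 ≤ W2 μ ν := Real.sqrt_nonneg _

lemma IsCoupling.W2_le (h : IsCoupling π μ ν) : W2 μ ν ≤ Real.sqrt (∫ p, ‖p.1 - p.2‖ ^ 2 ∂π) := by
  refine Real.sqrt_le_sqrt (csInf_le ⟨0, ?_⟩ ⟨π, h.1, h.2, rfl⟩)
  rintro c ⟨π', -, -, rfl⟩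
  exact integral_nonneg fun _ => sq_nonneg _

lemma exists_coupling_of_W2_lt {δ : ℝ} (h : W2 μ ν < δ) :
    ∃ π, IsCoupling π μ ν ∧ ∫ p, ‖p.1 - p.2‖ ^ 2 ∂π < δ ^ 2 := by
  have hδ : 0 < δ := (W2_nonneg μ ν).trans_lt h
  have h1 := (Real.sqrt_lt' hδ).1 h
  have hp := isCoupling_prod μ ν
  obtain ⟨c, ⟨π, h2, h3, rfl⟩, hlt⟩ := exists_lt_of_csInf_lt (by exact ⟨_, _, hp.1, hp.2, rfl⟩) h1
  exact ⟨π, ⟨h2, h3⟩, hlt⟩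

end Coupling

/-- Integrals of functions of quadratic growth are locally Lipschitz for the Wasserstein
distance. -/
lemma QuadLip.abs_integral_sub_le {C : ℝ} {u : E n → ℝ} (hu : QuadLip C u) {μ ν : P2 n} {δ : ℝ}
    (h : W2 μ ν < δ) : |(∫ x, u x ∂μ.toMeasure) - ∫ x, u x ∂ν.toMeasure| ≤
      C * δ * (2 + 6 * secondMoment ν + 2 * δ ^ 2) := by
  obtain ⟨π, hπ, hlt⟩ := exists_coupling_of_W2_lt h
  have hδ : 0 < δ := (W2_nonneg μ ν).trans_lt h
  have := hπ.isProbabilityMeasure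
  have hC := hu.nonneg
  set D := ∫ p, ‖p.1 - p.2‖ ^ 2 ∂π
  have iD := hπ.integrable_cost
  have iν := hπ.integrable_snd ν.sq_integrable
  have e2 : ∫ p, ‖p.2‖ ^ 2 ∂π = secondMoment ν :=
    hπ.integral_snd (f := fun x => ‖x‖ ^ 2) (by fun_prop)
  rw [← hπ.integral_fst hu.cont, ← hπ.integral_snd hu.cont,
    ← integral_sub (hπ.integrable_fst (hu.integrable μ)) (hπ.integrable_snd (hu.integrable ν))]
  have i1 : Integrable (fun p : E n × E n => 3 * C * δ / 2 + 6 * C * δ * ‖p.2‖ ^ 2) π :=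
    (integrable_const _).add (iν.const_mul _)
  have b : ‖∫ p, (u p.1 - u p.2) ∂π‖ ≤ ∫ p, ((3 * C * δ / 2 + 6 * C * δ * ‖p.2‖ ^ 2) +
      (3 * C * δ / 2 + C / (2 * δ)) * ‖p.1 - p.2‖ ^ 2) ∂π := by
    refine norm_integral_le_of_norm_le (i1.add (iD.const_mul _))
      (Filter.Eventually.of_forall fun p => ?_)
    refine (hu.bound p.1 p.2).trans ?_
    set d := ‖p.1 - p.2‖
    have hd : 0 ≤ d := norm_nonneg _
    have h1 : ‖p.1‖ ≤ ‖p.2‖ + d := norm_le_norm_add_norm_sub' _ _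
    have h2 : C * (1 + ‖p.1‖ + ‖p.2‖) * d ≤ C * ((1 + 2 * ‖p.2‖ + d) * d) := by
      rw [mul_assoc]
      exact mul_le_mul_of_nonneg_left (mul_le_mul_of_nonneg_right (by linarith) hd) hC
    refine h2.trans ?_
    have h3 : (1 + 2 * ‖p.2‖ + d) * d ≤ δ / 2 * (1 + 2 * ‖p.2‖ + d) ^ 2 + d ^ 2 / (2 * δ) := by
      have : δ / 2 * (1 + 2 * ‖p.2‖ + d) ^ 2 + d ^ 2 / (2 * δ) - (1 + 2 * ‖p.2‖ + d) * d =
        (δ * (1 + 2 * ‖p.2‖ + d) - d) ^ 2 / (2 * δ) := by field_simp; ring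
      have h4 : 0 ≤ (δ * (1 + 2 * ‖p.2‖ + d) - d) ^ 2 / (2 * δ) := by positivity
      linarith
    have h5 : (1 + 2 * ‖p.2‖ + d) ^ 2 ≤ 3 + 12 * ‖p.2‖ ^ 2 + 3 * d ^ 2 := by
      nlinarith [sq_nonneg (1 - 2 * ‖p.2‖), sq_nonneg (1 - d), sq_nonneg (2 * ‖p.2‖ - d)]
    have h6 := mul_le_mul_of_nonneg_left h5 (by positivity : 0 ≤ δ / 2)
    refine (mul_le_mul_of_nonneg_left (h3.trans (add_le_add h6 le_rfl)) hC).trans_eq ?_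
    field_simp
    ring
  rw [integral_add i1 (iD.const_mul _),
    integral_add (integrable_const _) (iν.const_mul _), integral_const_mul, integral_const_mul,
    integral_const, e2] at b
  simp only [probReal_univ, one_smul, Real.norm_eq_abs] at b
  refine b.trans ?_
  have h7 : (3 * C * δ / 2 + C / (2 * δ)) * D ≤ (3 * C * δ / 2 + C / (2 * δ)) * δ ^ 2 :=
    mul_le_mul_of_nonneg_left hlt.le (by positivity)
  have h8 : (3 * C * δ / 2 + C / (2 * δ)) * δ ^ 2 = 3 / 2 * (C * δ * δ ^ 2) + C * δ / 2 := by
    field_simp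
  have h9 : 0 ≤ C * δ * δ ^ 2 := by positivity
  linarith

lemma secondMoment_le_of_W2_le {m : P2 n} {R : ℝ} (h : W2 m (diracZero n) ≤ R) :
    secondMoment m ≤ 2 * (R + 1) ^ 2 := by
  obtain ⟨π, hπ, hlt⟩ := exists_coupling_of_W2_lt (lt_of_le_of_lt h (lt_add_one R))
  have e1 : ∫ p, ‖p.1‖ ^ 2 ∂π = secondMoment m :=
    hπ.integral_fst (f := fun x => ‖x‖ ^ 2) (by fun_prop)
  have e2 : ∫ p, ‖p.2‖ ^ 2 ∂π = 0 := by
    rw [hπ.integral_snd (f := fun x => ‖x‖ ^ 2) (by fun_prop)]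
    simp [diracZero]
  have hm : ∫ p, ‖p.1‖ ^ 2 ∂π ≤ ∫ p, (2 * ‖p.1 - p.2‖ ^ 2 + 2 * ‖p.2‖ ^ 2) ∂π := by
    refine integral_mono (hπ.integrable_fst m.sq_integrable)
      ((hπ.integrable_cost.const_mul 2).add
        ((hπ.integrable_snd (diracZero n).sq_integrable).const_mul 2)) fun p => ?_
    have h1 : ‖p.1‖ ≤ ‖p.2‖ + ‖p.1 - p.2‖ := norm_le_norm_add_norm_sub' _ _
    have := pow_le_pow_left₀ (norm_nonneg _) h1 2
    simp only
    nlinarith [sq_nonneg (‖p.2‖ - ‖p.1 - p.2‖)]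
  rw [integral_add (hπ.integrable_cost.const_mul 2)
    ((hπ.integrable_snd (diracZero n).sq_integrable).const_mul 2), integral_const_mul,
    integral_const_mul, e2, e1] at hm
  linarith

lemma W2_diracZero_le (m : P2 n) : W2 m (diracZero n) ≤ Real.sqrt (secondMoment m) := by
  refine (isCoupling_prod m (diracZero n)).W2_le.trans (le_of_eq ?_)
  congr 1
  rw [integral_prod _ (isCoupling_prod m (diracZero n)).integrable_cost]
  simp [diracZero, secondMoment]

/-! ### Linear functionals -/

/-- The linear functional `m ↦ ∫ u dm`, normalised, is its own functional derivative. -/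
lemma QuadLip.hasFunctionalDeriv {C : ℝ} {u : E n → ℝ} (hu : QuadLip C u) :
    HasFunctionalDeriv (fun m : P2 n => ∫ x, u x ∂m.toMeasure)
      (fun m x => u x - ∫ y, u y ∂m.toMeasure) where
  cont := by
    intro m x ε hε
    set b := C * (2 + 6 * secondMoment m + 2) with hb
    have hC := hu.nonneg
    have hb0 : 0 ≤ b := mul_nonneg hC (by linarith [secondMoment_nonneg m])
    obtain ⟨δ₁, hδ₁, h₁⟩ := Metric.continuous_iff.1 hu.cont x (ε / 2) (by positivity)
    set δ₂ := min 1 (ε / (2 * (b + 1))) with hδ₂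
    have hδ₂0 : 0 < δ₂ := by positivity
    refine ⟨min δ₁ δ₂, by positivity, fun m' x' hm hx => ?_⟩
    have k1 := h₁ x' (by rw [dist_eq_norm]; exact hx.trans_le (min_le_left _ _))
    rw [Real.dist_eq] at k1
    have k2 := hu.abs_integral_sub_le (hm.trans_le (min_le_right _ _))
    have k3 : C * δ₂ * (2 + 6 * secondMoment m + 2 * δ₂ ^ 2) ≤ b * δ₂ := by
      have : δ₂ ^ 2 ≤ 1 := pow_le_one₀ hδ₂0.le (min_le_left _ _)
      rw [hb, mul_right_comm]
      refine mul_le_mul_of_nonneg_right (mul_le_mul_of_nonneg_left ?_ hC) hδ₂0.le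
      linarith
    have k4 : b * δ₂ < ε / 2 := by
      have h1 : b * δ₂ ≤ b * (ε / (2 * (b + 1))) := mul_le_mul_of_nonneg_left (min_le_right _ _) hb0
      have h2 : b * (ε / (2 * (b + 1))) = b / (b + 1) * (ε / 2) := by field_simp
      have h3 : b / (b + 1) < 1 := (div_lt_one (by linarith)).2 (by linarith)
      nlinarith
    have k5 : |(∫ y, u y ∂m'.toMeasure) - ∫ y, u y ∂m.toMeasure| < ε / 2 :=
      (k2.trans k3).trans_lt k4
    rw [abs_lt] at k1 k5 ⊢
    constructor <;> linarith
  growth := by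
    set a := |u 0| + 2 * C
    have ha : 0 ≤ a := add_nonneg (abs_nonneg _) (by linarith [hu.nonneg])
    refine ⟨fun m => a + a * (1 + secondMoment m), ⟨fun m => ?_, fun R => ?_⟩, fun m x => ?_⟩
    · have := secondMoment_nonneg m
      positivity
    · refine ⟨a + a * (1 + 2 * (R + 1) ^ 2), fun m hm => ?_⟩
      have := secondMoment_le_of_W2_le hm
      change a + a * (1 + secondMoment m) ≤ _
      gcongr
    · have h1 := hu.growth x
      have h2 : |∫ y, u y ∂m.toMeasure| ≤ a * (1 + secondMoment m) := by
        have i : Integrable (fun x => a * (1 + ‖x‖ ^ 2)) m.toMeasure :=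
          ((integrable_const (1 : ℝ)).add m.sq_integrable).const_mul a
        have := norm_integral_le_of_norm_le (f := u) i (Filter.Eventually.of_forall hu.growth)
        rw [integral_const_mul, integral_add (integrable_const _) m.sq_integrable] at this
        simpa [secondMoment] using this
      have h3 := secondMoment_nonneg m
      have h4 : 0 ≤ a * (1 + secondMoment m) * ‖x‖ ^ 2 := by positivity
      have h5 := abs_sub (u x) (∫ y, u y ∂m.toMeasure)
      linarith
  eq := by
    intro m m'
    have : ∀ θ, intDiff m m' (fun x => u x - ∫ y, u y ∂(mix m m' θ).toMeasure) =
        (∫ x, u x ∂m'.toMeasure) - ∫ x, u x ∂m.toMeasure := by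
      intro θ
      simp only [intDiff]
      rw [integral_sub (hu.integrable m') (integrable_const _),
        integral_sub (hu.integrable m) (integrable_const _)]
      simp
    simp_rw [this]
    simp
  normalized := by
    intro m
    rw [integral_sub (hu.integrable m) (integrable_const _)]
    simp

end Wasserstein

/-! ### Mixtures and uniqueness of functional derivatives -/

section Mixtures

variable {n : ℕ}

/-- The weight of the second measure in `mix m m' θ`. -/
def weight (θ : ℝ) : ℝ := projIcc (0 : ℝ) 1 zero_le_one θ

lemma weight_nonneg (θ : ℝ) : 0 ≤ weight θ := (projIcc (0 : ℝ) 1 zero_le_one θ).2.1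

lemma weight_le_one (θ : ℝ) : weight θ ≤ 1 := (projIcc (0 : ℝ) 1 zero_le_one θ).2.2

lemma weight_of_mem {θ : ℝ} (h : θ ∈ Icc (0 : ℝ) 1) : weight θ = θ := by
  rw [weight, projIcc_of_mem _ h]

lemma continuous_weight : Continuous weight := continuous_subtype_val.comp continuous_projIcc

lemma mix_toMeasure (m m' : P2 n) (θ : ℝ) : (mix m m' θ).toMeasure =
    ENNReal.ofReal (1 - weight θ) • m.toMeasure + ENNReal.ofReal (weight θ) • m'.toMeasure := rfl

lemma P2.ext_measure {m m' : P2 n} (h : m.toMeasure = m'.toMeasure) : m = m' := by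
  cases m; cases m'; cases h; rfl

lemma integral_mix (m m' : P2 n) (θ : ℝ) {f : E n → ℝ} (hf : Integrable f m.toMeasure)
    (hf' : Integrable f m'.toMeasure) : ∫ x, f x ∂(mix m m' θ).toMeasure =
      (1 - weight θ) * (∫ x, f x ∂m.toMeasure) + weight θ * ∫ x, f x ∂m'.toMeasure := by
  rw [mix_toMeasure, integral_add_measure (hf.smul_measure ENNReal.ofReal_ne_top)
    (hf'.smul_measure ENNReal.ofReal_ne_top), integral_smul_measure, integral_smul_measure,
    ENNReal.toReal_ofReal (by linarith [weight_le_one θ]), ENNReal.toReal_ofReal (weight_nonneg θ)]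
  rfl

lemma mix_zero (m m' : P2 n) : mix m m' 0 = m := by
  apply P2.ext_measure
  rw [mix_toMeasure, weight_of_mem (by simp)]
  simp

lemma mix_mix (m m' : P2 n) {ε θ : ℝ} (hε : ε ∈ Icc (0 : ℝ) 1) (hθ : θ ∈ Icc (0 : ℝ) 1) :
    mix m (mix m m' ε) θ = mix m m' (ε * θ) := by
  apply P2.ext_measure
  have h : ε * θ ∈ Icc (0 : ℝ) 1 := ⟨mul_nonneg hε.1 hθ.1, mul_le_one₀ hε.2 hθ.1 hθ.2⟩
  rw [mix_toMeasure, mix_toMeasure, mix_toMeasure, weight_of_mem hε, weight_of_mem hθ,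
    weight_of_mem h, smul_add, smul_smul, smul_smul, ← add_assoc, ← add_smul,
    ← ENNReal.ofReal_mul hθ.1, ← ENNReal.ofReal_mul hθ.1, ← ENNReal.ofReal_add
    (by linarith [hθ.2]) (mul_nonneg hθ.1 (by linarith [hε.2]))]
  congr 3 <;> ring

/-- The mass that two mixtures share is left in place and the rest is transported along the product
coupling. -/
lemma W2_mix_sq_le_of_le (m m' : P2 n) {a b : ℝ} (h : weight a ≤ weight b) :
    (W2 (mix m m' a) (mix m m' b) ≤ Real.sqrt ((weight b - weight a) *
      ∫ p, ‖p.1 - p.2‖ ^ 2 ∂(m.toMeasure.prod m'.toMeasure))) ∧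
    W2 (mix m m' b) (mix m m' a) ≤ Real.sqrt ((weight b - weight a) *
      ∫ p, ‖p.1 - p.2‖ ^ 2 ∂(m.toMeasure.prod m'.toMeasure)) := by
  set d : E n → E n × E n := fun x => (x, x)
  have hd : Measurable d := measurable_id.prodMk measurable_id
  set r := weight b - weight a with hr
  have hr0 : 0 ≤ r := sub_nonneg.2 h
  have hb1 : 0 ≤ 1 - weight b := by linarith [weight_le_one b]
  set π : Measure (E n × E n) := ENNReal.ofReal (1 - weight b) • m.toMeasure.map d +
    ENNReal.ofReal (weight a) • m'.toMeasure.map d +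
    ENNReal.ofReal r • (m.toMeasure.prod m'.toMeasure) with hπ
  have hp := isCoupling_prod m m'
  have hc : IsCoupling π (mix m m' a) (mix m m' b) := by
    constructor
    · rw [hπ, Measure.map_add _ _ measurable_fst, Measure.map_add _ _ measurable_fst,
        Measure.map_smul, Measure.map_smul, Measure.map_smul, hp.1,
        Measure.map_map measurable_fst hd, Measure.map_map measurable_fst hd]
      change _ • m.toMeasure.map id + _ • m'.toMeasure.map id + _ = _
      rw [Measure.map_id, Measure.map_id, add_right_comm, ← add_smul, ← ENNReal.ofReal_add hb1 hr0,
        mix_toMeasure]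
      congr 3
      rw [hr]; ring
    · rw [hπ, Measure.map_add _ _ measurable_snd, Measure.map_add _ _ measurable_snd,
        Measure.map_smul, Measure.map_smul, Measure.map_smul, hp.2,
        Measure.map_map measurable_snd hd, Measure.map_map measurable_snd hd]
      change _ • m.toMeasure.map id + _ • m'.toMeasure.map id + _ = _
      rw [Measure.map_id, Measure.map_id, add_assoc, ← add_smul,
        ← ENNReal.ofReal_add (weight_nonneg a) hr0, mix_toMeasure]
      congr 3
      rw [hr]; ring
  have hcm : StronglyMeasurable fun p : E n × E n => ‖p.1 - p.2‖ ^ 2 :=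
    Continuous.stronglyMeasurable (by fun_prop)
  have i0 : ∀ μ : P2 n, Integrable (fun p : E n × E n => ‖p.1 - p.2‖ ^ 2) (μ.toMeasure.map d) :=
    fun μ => by
      rw [integrable_map_measure hcm.aestronglyMeasurable hd.aemeasurable]
      refine (integrable_zero _ ℝ _).congr (Filter.Eventually.of_forall fun x => ?_)
      simp [d]
  have e0 : ∀ μ : P2 n, ∫ p, ‖p.1 - p.2‖ ^ 2 ∂(μ.toMeasure.map d) = 0 := fun μ => by
    rw [integral_map hd.aemeasurable hcm.aestronglyMeasurable]
    simp [d]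
  have ip := hp.integrable_cost
  have ec : ∫ p, ‖p.1 - p.2‖ ^ 2 ∂π =
      r * ∫ p, ‖p.1 - p.2‖ ^ 2 ∂(m.toMeasure.prod m'.toMeasure) := by
    rw [hπ, integral_add_measure (((i0 m).smul_measure ENNReal.ofReal_ne_top).add_measure
      ((i0 m').smul_measure ENNReal.ofReal_ne_top)) (ip.smul_measure ENNReal.ofReal_ne_top),
      integral_add_measure ((i0 m).smul_measure ENNReal.ofReal_ne_top)
      ((i0 m').smul_measure ENNReal.ofReal_ne_top), integral_smul_measure, integral_smul_measure,
      integral_smul_measure, e0, e0, ENNReal.toReal_ofReal hr0]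
    simp
  refine ⟨ec ▸ hc.W2_le, ?_⟩
  have h2 := hc.swap.W2_le
  rw [integral_map measurable_swap.aemeasurable hcm.aestronglyMeasurable] at h2
  simp only [Prod.fst_swap, Prod.snd_swap] at h2
  simp_rw [norm_sub_rev] at h2
  rwa [ec] at h2

lemma tendsto_W2_mix (m m' : P2 n) (θ : ℝ) :
    Filter.Tendsto (fun θ' => W2 (mix m m' θ') (mix m m' θ)) (nhds θ) (nhds 0) := by
  set D := ∫ p, ‖p.1 - p.2‖ ^ 2 ∂(m.toMeasure.prod m'.toMeasure)
  have hb : ∀ θ', W2 (mix m m' θ') (mix m m' θ) ≤ Real.sqrt (|weight θ' - weight θ| * D) := by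
    intro θ'
    rcases le_total (weight θ') (weight θ) with h | h
    · rw [abs_sub_comm, abs_of_nonneg (sub_nonneg.2 h)]
      exact (W2_mix_sq_le_of_le m m' h).1
    · rw [abs_of_nonneg (sub_nonneg.2 h)]
      exact (W2_mix_sq_le_of_le m m' h).2
  have hc : Continuous fun θ' => Real.sqrt (|weight θ' - weight θ| * D) := by
    have := continuous_weight
    fun_prop
  have ht := hc.tendsto θ
  simp only [sub_self, abs_zero, zero_mul, Real.sqrt_zero] at ht
  exact squeeze_zero (fun _ => W2_nonneg _ _) hb ht

lemma W2_mix_diracZero_le (m m' : P2 n) (θ : ℝ) :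
    W2 (mix m m' θ) (diracZero n) ≤ Real.sqrt (secondMoment m + secondMoment m') := by
  refine (W2_diracZero_le _).trans (Real.sqrt_le_sqrt ?_)
  rw [secondMoment, integral_mix m m' θ m.sq_integrable m'.sq_integrable]
  exact add_le_add
    (mul_le_of_le_one_left (secondMoment_nonneg m) (by linarith [weight_nonneg θ]))
    (mul_le_of_le_one_left (secondMoment_nonneg m') (weight_le_one θ))

lemma HasFunctionalDeriv.continuous_apply {F : P2 n → ℝ} {φ : P2 n → E n → ℝ}
    (h : HasFunctionalDeriv F φ) (m : P2 n) : Continuous (φ m) := by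
  refine Metric.continuous_iff.2 fun x ε hε => ?_
  obtain ⟨δ, hδ, hc⟩ := h.cont m x ε hε
  have hW : W2 m m = 0 := by
    have := (W2_mix_sq_le_of_le m m (le_refl (weight 0))).1
    rw [sub_self, zero_mul, Real.sqrt_zero, mix_zero] at this
    exact le_antisymm this (W2_nonneg _ _)
  refine ⟨δ, hδ, fun x' hx' => ?_⟩
  rw [Real.dist_eq]
  exact hc m x' (hW ▸ hδ) (by rwa [← dist_eq_norm])

lemma HasFunctionalDeriv.integrable {F : P2 n → ℝ} {φ : P2 n → E n → ℝ}
    (h : HasFunctionalDeriv F φ) (m μ : P2 n) : Integrable (φ m) μ.toMeasure := by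
  obtain ⟨c, -, hc⟩ := h.growth
  exact integrable_of_growth (h.continuous_apply m) (hc m)

lemma HasFunctionalDeriv.continuous_intDiff {F : P2 n → ℝ} {φ : P2 n → E n → ℝ}
    (h : HasFunctionalDeriv F φ) (m m' : P2 n) :
    Continuous fun θ => intDiff m m' (φ (mix m m' θ)) := by
  obtain ⟨c, ⟨-, hcb⟩, hc⟩ := h.growth
  obtain ⟨k, hk⟩ := hcb (Real.sqrt (secondMoment m + secondMoment m'))
  have key : ∀ μ : P2 n, Continuous fun θ => ∫ x, φ (mix m m' θ) x ∂μ.toMeasure := by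
    intro μ
    refine continuous_of_dominated (bound := fun x => k * (1 + ‖x‖ ^ 2))
      (fun θ => (h.continuous_apply _).aestronglyMeasurable)
      (fun θ => Filter.Eventually.of_forall fun x => (hc _ x).trans ?_)
      (((integrable_const (1 : ℝ)).add μ.sq_integrable).const_mul k)
      (Filter.Eventually.of_forall fun x => ?_)
    · exact mul_le_mul_of_nonneg_right (hk _ (W2_mix_diracZero_le m m' θ)) (by positivity)
    · refine continuous_iff_continuousAt.2 fun θ => Metric.tendsto_nhds.2 fun ε hε => ?_
      obtain ⟨δ, hδ, hcont⟩ := h.cont (mix m m' θ) x ε hε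
      filter_upwards [(tendsto_W2_mix m m' θ).eventually (gt_mem_nhds hδ)] with θ' hθ'
      rw [Real.dist_eq]
      exact hcont _ _ hθ' (by simpa using hδ)
  exact (key m').sub (key m)

/-- The fundamental theorem of calculus along the segment from `m` to `m'`. -/
lemma HasFunctionalDeriv.mix_sub_eq_integral {F : P2 n → ℝ} {φ : P2 n → E n → ℝ}
    (h : HasFunctionalDeriv F φ) (m m' : P2 n) {ε : ℝ} (hε : ε ∈ Icc (0 : ℝ) 1) :
    F (mix m m' ε) - F m = ∫ θ in (0 : ℝ)..ε, intDiff m m' (φ (mix m m' θ)) := by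
  have e : ∀ θ ∈ uIcc (0 : ℝ) 1, intDiff m (mix m m' ε) (φ (mix m (mix m m' ε) θ)) =
      ε * intDiff m m' (φ (mix m m' (ε * θ))) := by
    intro θ hθ
    rw [uIcc_of_le zero_le_one] at hθ
    rw [mix_mix m m' hε hθ, intDiff, intDiff, integral_mix m m' ε (h.integrable _ m)
      (h.integrable _ m'), weight_of_mem hε]
    ring
  rw [h.eq, intervalIntegral.integral_congr e, intervalIntegral.integral_const_mul]
  rw [intervalIntegral.mul_integral_comp_mul_left (f := fun θ => intDiff m m' (φ (mix m m' θ)))]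
  simp

/-- A Dirac mass. -/
def diracAt (x : E n) : P2 n where
  toMeasure := Measure.dirac x
  isProb := inferInstance
  sq_integrable := integrable_dirac (by simp)

/-- The functional derivative is unique: its integral against `m' - m` is the derivative of the
functional at `m` in the direction of `m'`, and Dirac masses are admissible directions. -/
lemma HasFunctionalDeriv.unique {F : P2 n → ℝ} {φ ψ : P2 n → E n → ℝ}
    (hφ : HasFunctionalDeriv F φ) (hψ : HasFunctionalDeriv F ψ) : φ = ψ := by
  have deriv_zero : ∀ {χ : P2 n → E n → ℝ} (_ : HasFunctionalDeriv F χ) (m m' : P2 n),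
      HasDerivWithinAt (fun ε => F (mix m m' ε) - F m) (intDiff m m' (χ m)) (Icc 0 1) 0 := by
    intro χ h m m'
    have h0 : (0 : ℝ) ∈ Icc (0 : ℝ) 1 := by simp
    have := ((h.continuous_intDiff m m').integral_hasStrictDerivAt 0 0).hasDerivAt.hasDerivWithinAt
      (s := Icc 0 1)
    simp only [mix_zero] at this
    exact this.congr_of_mem (fun ε hε => h.mix_sub_eq_integral m m' hε) h0
  funext m x
  have e := (uniqueDiffOn_Icc zero_lt_one 0 (by simp)).eq_deriv _ (deriv_zero hφ m (diracAt x))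
    (deriv_zero hψ m (diracAt x))
  simp only [intDiff, hφ.normalized, hψ.normalized, diracAt, integral_dirac, sub_zero] at e
  exact e

lemma HasFunctionalDeriv.functionalDeriv_eq {F : P2 n → ℝ} {φ : P2 n → E n → ℝ}
    (h : HasFunctionalDeriv F φ) : functionalDeriv F = φ := by
  have hex : ∃ φ, HasFunctionalDeriv F φ := ⟨φ, h⟩
  rw [functionalDeriv, dif_pos hex]
  exact hex.choose_spec.unique h

lemma QuadLip.functionalDeriv_eq {C : ℝ} {u : E n → ℝ} (hu : QuadLip C u) {F : P2 n → ℝ}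
    (hF : ∀ m, F m = ∫ x, u x ∂m.toMeasure) :
    functionalDeriv F = fun m x => u x - ∫ y, u y ∂m.toMeasure := by
  obtain rfl : F = fun m => ∫ x, u x ∂m.toMeasure := funext hF
  exact hu.hasFunctionalDeriv.functionalDeriv_eq

lemma QuadLip.hasFunctionalDeriv_functionalDeriv {C : ℝ} {u : E n → ℝ} (hu : QuadLip C u)
    {F : P2 n → ℝ} (hF : ∀ m, F m = ∫ x, u x ∂m.toMeasure) :
    HasFunctionalDeriv F (functionalDeriv F) := by
  rw [hu.functionalDeriv_eq hF]
  obtain rfl : F = fun m => ∫ x, u x ∂m.toMeasure := funext hF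
  exact hu.hasFunctionalDeriv

lemma QuadLip.hasGradientAt_functionalDeriv {C : ℝ} {u : E n → ℝ} (hu : QuadLip C u)
    {F : P2 n → ℝ} (hF : ∀ m, F m = ∫ x, u x ∂m.toMeasure) {g : E n → E n}
    (hg : ∀ x, HasGradientAt u (g x) x) (m : P2 n) (x : E n) :
    HasGradientAt (functionalDeriv F m) (g x) x := by
  rw [hu.functionalDeriv_eq hF]
  exact (hg x).hasFDerivAt.sub_const _

end Mixtures

/-! ### The structure of the coefficients -/

section Coefficients

variable {n : ℕ}

lemma quadLip_of_hasGradientAt {l : E n → ℝ} {g : E n → E n} {L : ℝ≥0}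
    (hl : ∀ x, HasGradientAt l (g x) x) (hg : LipschitzWith L g) :
    QuadLip (‖g 0‖ + L) l where
  nonneg := add_nonneg (norm_nonneg _) L.2
  cont := continuous_iff_continuousAt.2 fun x => (hl x).continuousAt
  bound := fun x y => by
    obtain ⟨θ, hθ, e⟩ := exists_sub_eq_inner_gradient hl y x
    have hL : (0 : ℝ) ≤ L := L.2
    rw [e]
    refine (abs_real_inner_le_norm _ _).trans (mul_le_mul_of_nonneg_right ?_ (norm_nonneg _))
    have h1 := hg.dist_le_mul (y + θ • (x - y)) 0
    rw [dist_eq_norm, dist_eq_norm, sub_zero] at h1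
    have h2 : ‖y + θ • (x - y)‖ ≤ ‖x‖ + ‖y‖ := by
      have : y + θ • (x - y) = (1 - θ) • y + θ • x := by
        rw [smul_sub, sub_smul, one_smul]; abel
      rw [this]
      refine (norm_add_le _ _).trans ?_
      rw [norm_smul, norm_smul, Real.norm_of_nonneg hθ.1.le,
        Real.norm_of_nonneg (by linarith [hθ.2])]
      nlinarith [hθ.1, hθ.2, norm_nonneg x, norm_nonneg y]
    have h3 := norm_le_norm_add_norm_sub' (g (y + θ • (x - y))) (g 0)
    have h4 := mul_le_mul_of_nonneg_left h2 hL
    have h5 : 0 ≤ ‖g 0‖ * (‖x‖ + ‖y‖) := by positivity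
    linarith

/-- A `C²` function whose Hessian lies between two nonnegative multiples of the identity has a
Lipschitz gradient, which is strongly monotone with the lower constant. -/
lemma exists_gradient_of_hessian_bounds {l : E n → ℝ} {lo hi : ℝ} (hlo : 0 ≤ lo)
    (hl : ContDiff ℝ 2 l) (hb : ∀ x y, lo * ‖y‖ ^ 2 ≤ fderiv ℝ (fderiv ℝ l) x y y ∧
      fderiv ℝ (fderiv ℝ l) x y y ≤ hi * ‖y‖ ^ 2) :
    ∃ (g : E n → E n) (L : ℝ≥0), (∀ x, HasGradientAt l (g x) x) ∧ LipschitzWith L g ∧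
      ∀ x y, lo * ‖x - y‖ ^ 2 ≤ ⟪g x - g y, x - y⟫_ℝ := by
  have hd : Differentiable ℝ l := hl.differentiable two_ne_zero
  have hd2 : Differentiable ℝ (fderiv ℝ l) :=
    (hl.fderiv_right (m := 1) (by norm_num)).differentiable one_ne_zero
  have hgrad : ∀ x, HasGradientAt l (gradient l x) x := fun x => (hd x).hasGradientAt
  have hpair : ∀ x y, ⟪gradient l x, y⟫_ℝ = fderiv ℝ l x y := fun x y => by
    rw [gradient, InnerProductSpace.toDual_symm_apply]
  have hnorm : ∀ x, ‖fderiv ℝ (fderiv ℝ l) x‖ ≤ 2 * |hi| := by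
    intro x
    have hsymm : ∀ y z, fderiv ℝ (fderiv ℝ l) x y z = fderiv ℝ (fderiv ℝ l) x z y := fun y z =>
      (hl.contDiffAt.isSymmSndFDerivAt (by simp)).eq y z
    refine ContinuousLinearMap.opNorm_le_of_unit_norm (by positivity) fun y hy =>
      ContinuousLinearMap.opNorm_le_of_unit_norm (by positivity) fun z hz => ?_
    -- By polarisation, the bounds on the quadratic form bound the bilinear form.
    have h1 := hb x (y + z)
    have h2 := hb x (y - z)
    have e : fderiv ℝ (fderiv ℝ l) x (y + z) (y + z) - fderiv ℝ (fderiv ℝ l) x (y - z) (y - z) =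
        4 * fderiv ℝ (fderiv ℝ l) x y z := by
      simp only [map_add, map_sub, add_apply, sub_apply,
        hsymm z y]
      ring
    have n1 : ‖y + z‖ ^ 2 ≤ 4 := by
      have := norm_add_le y z
      rw [hy, hz] at this
      nlinarith [norm_nonneg (y + z)]
    have n2 : ‖y - z‖ ^ 2 ≤ 4 := by
      have := norm_sub_le y z
      rw [hy, hz] at this
      nlinarith [norm_nonneg (y - z)]
    have k1 : hi * ‖y + z‖ ^ 2 ≤ |hi| * 4 :=
      mul_le_mul (le_abs_self _) n1 (sq_nonneg _) (abs_nonneg _)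
    have k2 : hi * ‖y - z‖ ^ 2 ≤ |hi| * 4 :=
      mul_le_mul (le_abs_self _) n2 (sq_nonneg _) (abs_nonneg _)
    have k3 : 0 ≤ lo * ‖y + z‖ ^ 2 := by positivity
    have k4 : 0 ≤ lo * ‖y - z‖ ^ 2 := by positivity
    rw [Real.norm_eq_abs, abs_le]
    constructor <;> linarith [abs_nonneg hi]
  refine ⟨gradient l, ⟨2 * |hi|, by positivity⟩, hgrad, ?_, fun x y => ?_⟩
  · have h1 : LipschitzWith ⟨2 * |hi|, by positivity⟩ (fderiv ℝ l) :=
      lipschitzWith_of_nnnorm_fderiv_le hd2 fun x => hnorm x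
    exact LipschitzWith.of_dist_le_mul fun x y => by
      rw [gradient, gradient, LinearIsometryEquiv.dist_map]
      exact h1.dist_le_mul x y
  · have hder : ∀ θ : ℝ, HasDerivAt (fun θ : ℝ => fderiv ℝ l (y + θ • (x - y)) (x - y))
        (fderiv ℝ (fderiv ℝ l) (y + θ • (x - y)) (x - y) (x - y)) θ := by
      intro θ
      have h1 : HasDerivAt (fun θ : ℝ => y + θ • (x - y)) (x - y) θ := by
        simpa using ((hasDerivAt_id θ).smul_const (x - y)).const_add y
      have h2 := (hd2 (y + θ • (x - y))).hasFDerivAt.comp_hasDerivAt θ h1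
      simpa using h2.clm_apply (hasDerivAt_const θ (x - y))
    obtain ⟨θ, -, e⟩ := exists_hasDerivAt_eq_slope
      (fun θ : ℝ => fderiv ℝ l (y + θ • (x - y)) (x - y)) _ zero_lt_one
      (fun θ _ => (hder θ).continuousAt.continuousWithinAt) (fun θ _ => hder θ)
    have h := (hb (y + θ • (x - y)) (x - y)).1
    rw [e] at h
    simpa [inner_sub_left, hpair] using h

/-- A function on a product whose mixed derivative vanishes is a sum of functions of one
variable. -/
lemma sub_eq_sub_of_mixed_fderiv_eq_zero {k : E n → E n → ℝ} (hk : ∀ y, Differentiable ℝ (k y))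
    (h : ∀ x y, HasFDerivAt (fun y' => fderiv ℝ (k y') x) (0 : E n →L[ℝ] E n →L[ℝ] ℝ) y)
    (x x' y y' : E n) : k y x - k y' x = k y x' - k y' x' := by
  have hc : ∀ x, fderiv ℝ (k y) x = fderiv ℝ (k y') x := fun x =>
    is_const_of_fderiv_eq_zero (fun y => (h x y).differentiableAt) (fun y => (h x y).fderiv) y y'
  have hd : Differentiable ℝ fun x => k y x - k y' x := (hk y).sub (hk y')
  exact is_const_of_fderiv_eq_zero hd (fun x => by
    rw [fderiv_fun_sub (hk y x) (hk y' x), hc, sub_self]) x x'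

/-- If `D_ξ₁ D_ξ₂ ∂²f/∂m²` vanishes, the normalisation forces the second functional derivative to
vanish. -/
lemma HasSecondFunctionalDeriv.eq_zero {F : P2 n → ℝ} {φ : P2 n → E n → ℝ}
    {ψ : P2 n → E n → E n → ℝ} (h : HasSecondFunctionalDeriv F φ ψ) {m : P2 n}
    (hψ : ∀ ξ, Differentiable ℝ (ψ m ξ))
    (hmix : ∀ ξ₁ ξ₂, HasFDerivAt (fun ξ => fderiv ℝ (ψ m ξ) ξ₂)
      (0 : E n →L[ℝ] E n →L[ℝ] ℝ) ξ₁) (x y : E n) : ψ m x y = 0 := by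
  obtain ⟨c, ⟨hc0, -⟩, hc⟩ := h.growth
  have hi : ∀ x, Integrable (ψ m x) m.toMeasure := fun x =>
    integrable_of_growth (C := c m * (1 + ‖x‖ ^ 2)) (hψ x).continuous fun y => by
      refine (hc m x y).trans ?_
      rw [mul_assoc]
      exact mul_le_mul_of_nonneg_left (by nlinarith [mul_nonneg (sq_nonneg ‖x‖) (sq_nonneg ‖y‖)])
        (hc0 m)
  -- `ψ m x y - ψ m 0 y` does not depend on `y`, and its integral in `y` vanishes.
  have hsep : ∀ x y, ψ m x y = ψ m 0 y := by
    intro x y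
    have e : ∀ y', ψ m x y' - ψ m 0 y' = ψ m x y - ψ m 0 y := fun y' =>
      sub_eq_sub_of_mixed_fderiv_eq_zero hψ (fun x y => hmix y x) y' y x 0
    have := integral_sub (hi x) (hi 0)
    rw [h.normalized_right, h.normalized_right, integral_congr_ae (Filter.Eventually.of_forall e)]
      at this
    simp only [integral_const, probReal_univ, one_smul, sub_zero] at this
    linarith
  have := h.normalized_left m y
  simp_rw [fun x => hsep x y] at this
  rw [hsep x y]
  simpa using this

/-- The hypotheses on the mixed derivatives make the functional `m ↦ ∫ f(x, m) dm(x)` linear: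
`f(x, m) = f(x, δ₀) + ∫ ψ dm` with `ψ` the functional derivative of `f(x, ·)` at `δ₀`, which does
not depend on `x`. -/
lemma CoefficientAssumption.exists_linear {f : E n → P2 n → ℝ} {lo hi : ℝ}
    (h : CoefficientAssumption f lo hi) (hlo : 0 < lo) :
    ∃ (l : E n → ℝ) (g : E n → E n) (L : ℝ≥0),
      (∀ m : P2 n, ∫ x, f x m ∂m.toMeasure = ∫ x, l x ∂m.toMeasure) ∧
      (∀ x, HasGradientAt l (g x) x) ∧ LipschitzWith L g ∧
      ∀ x y, lo * ‖x - y‖ ^ 2 ≤ ⟪g x - g y, x - y⟫_ℝ := by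
  obtain ⟨p, q, hpq, hf, hp, hfb, hpb, hpd, hpm, hqd, hqm⟩ := h
  have hq0 : ∀ x m ξ₁ ξ₂, q x m ξ₁ ξ₂ = 0 := fun x m =>
    (hpq x).eq_zero (hqd x m) (hqm x m)
  -- `p x m ξ - p 0 m ξ` does not depend on `ξ`, and its integral in `ξ` vanishes.
  have hp0 : ∀ x m ξ, p x m ξ = p 0 m ξ := by
    intro x m ξ
    have e : ∀ ξ', p x m ξ' - p 0 m ξ' = p x m ξ - p 0 m ξ := fun ξ' => by
      have := sub_eq_sub_of_mixed_fderiv_eq_zero (k := fun ξ x => p x m ξ) (hpd m)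
        (fun x ξ => hpm x m ξ) x 0 ξ' ξ
      linarith
    have := integral_sub ((hpq x).first.integrable m m) ((hpq 0).first.integrable m m)
    rw [(hpq x).first.normalized, (hpq 0).first.normalized,
      integral_congr_ae (Filter.Eventually.of_forall e)] at this
    simp only [integral_const, probReal_univ, one_smul, sub_zero] at this
    linarith
  set m₀ := diracZero n with hm₀
  have hdecomp : ∀ x m, f x m = f x m₀ + ∫ ξ, p 0 m₀ ξ ∂m.toMeasure := by
    intro x m
    have := (hpq x).eq m₀ m
    simp only [hq0, intDiff, integral_zero, sub_zero, mul_zero,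
      intervalIntegral.integral_zero, add_zero, (hpq x).first.normalized] at this
    rw [integral_congr_ae (Filter.Eventually.of_forall (hp0 x m₀))] at this
    linarith
  obtain ⟨g₁, L₁, hg₁, hL₁, hm₁⟩ := exists_gradient_of_hessian_bounds hlo.le (hf m₀)
    (fun x y => hfb x m₀ y)
  obtain ⟨g₂, L₂, hg₂, hL₂, hm₂⟩ := exists_gradient_of_hessian_bounds hlo.le (hp 0 m₀)
    (fun x y => hpb 0 m₀ x y)
  refine ⟨fun x => f x m₀ + p 0 m₀ x, fun x => g₁ x + g₂ x, L₁ + L₂, fun m => ?_, fun x => ?_,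
    hL₁.add hL₂, fun x y => ?_⟩
  · have i₁ := (quadLip_of_hasGradientAt hg₁ hL₁).integrable m
    have i₂ := (quadLip_of_hasGradientAt hg₂ hL₂).integrable m
    simp_rw [fun x => hdecomp x m]
    rw [integral_add i₁ (integrable_const _), integral_add i₁ i₂]
    simp
  · rw [hasGradientAt_iff_hasFDerivAt, map_add]
    exact (hg₁ x).hasFDerivAt.add (hg₂ x).hasFDerivAt
  · have h1 := hm₁ x y
    have h2 := hm₂ x y
    have e : g₁ x + g₂ x - (g₁ y + g₂ y) = (g₁ x - g₁ y) + (g₂ x - g₂ y) := by abel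
    rw [e, inner_add_left]
    nlinarith [sq_nonneg ‖x - y‖]

end Coefficients

/-! ### Superposition operators on `L²_m` -/

section Superposition

open ControlData

variable {n : ℕ} {m : P2 n}

lemma integrable_norm_sq (X : H m) : Integrable (fun ξ => ‖X ξ‖ ^ 2) m.toMeasure :=
  (memLp_two_iff_integrable_sq_norm (Lp.memLp X).1).1 (Lp.memLp X)

lemma norm_sq_eq_integral (X : H m) : ‖X‖ ^ 2 = ∫ ξ, ‖X ξ‖ ^ 2 ∂m.toMeasure := by
  rw [← real_inner_self_eq_norm_sq, L2.inner_def]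
  simp_rw [real_inner_self_eq_norm_sq]

lemma memLp_comp_of_lipschitzWith {g : E n → E n} {L : ℝ≥0} (hg : LipschitzWith L g)
    {X : E n → E n} (hX : MemLp X 2 m.toMeasure) : MemLp (fun ξ => g (X ξ)) 2 m.toMeasure := by
  have h1 : LipschitzWith L fun x => g x - g 0 :=
    LipschitzWith.of_dist_le_mul fun x y => by
      rw [dist_sub_right]; exact hg.dist_le_mul x y
  have h2 : MemLp (fun ξ => g (X ξ) - g 0) 2 m.toMeasure := h1.comp_memLp (by simp) hX
  exact (h2.add (memLp_const (g 0))).ae_eq (Filter.Eventually.of_forall fun ξ => by simp)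

open Classical in
/-- The superposition operator `X ↦ g ∘ X` on `L²_m` (zero where `g ∘ X` is not square
integrable). -/
def superpose (m : P2 n) (g : E n → E n) (X : H m) : H m :=
  if h : MemLp (fun ξ => g (X ξ)) 2 m.toMeasure then h.toLp _ else 0

lemma coeFn_superpose {g : E n → E n} {L : ℝ≥0} (hg : LipschitzWith L g) (X : H m) :
    superpose m g X =ᵐ[m.toMeasure] fun ξ => g (X ξ) := by
  have h := memLp_comp_of_lipschitzWith hg (Lp.memLp X)
  rw [superpose, dif_pos h]
  exact h.coeFn_toLp

lemma eq_superpose {g : E n → E n} {L : ℝ≥0} (hg : LipschitzWith L g) {X Y : H m}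
    (h : Y =ᵐ[m.toMeasure] fun ξ => g (X ξ)) : Y = superpose m g X :=
  Lp.ext (h.trans (coeFn_superpose hg X).symm)

lemma coeFn_lift (L : E n →L[ℝ] E n) (X : H m) :
    lift m L X =ᵐ[m.toMeasure] fun ξ => L (X ξ) := L.coeFn_compLpL X

lemma lift_superpose (A : E n →L[ℝ] E n) {g : E n → E n} {L : ℝ≥0} (hg : LipschitzWith L g)
    (X : H m) : lift m A (superpose m g X) = superpose m (fun x => A (g x)) X := by
  refine eq_superpose (g := fun x => A (g x)) (A.lipschitz.comp hg) ?_
  filter_upwards [coeFn_lift A (superpose m g X), coeFn_superpose hg X] with ξ h1 h2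
  rw [h1, h2]

lemma superpose_add {g k : E n → E n} {L L' : ℝ≥0} (hg : LipschitzWith L g)
    (hk : LipschitzWith L' k) (X : H m) :
    superpose m g X + superpose m k X = superpose m (fun x => g x + k x) X := by
  refine eq_superpose (hg.add hk) ?_
  filter_upwards [Lp.coeFn_add (superpose m g X) (superpose m k X), coeFn_superpose hg X,
    coeFn_superpose hk X] with ξ h1 h2 h3
  rw [h1, Pi.add_apply, h2, h3]

lemma superpose_sub {g k : E n → E n} {L L' : ℝ≥0} (hg : LipschitzWith L g)
    (hk : LipschitzWith L' k) (X : H m) :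
    superpose m g X - superpose m k X = superpose m (fun x => g x - k x) X := by
  refine eq_superpose (hg.sub hk) ?_
  filter_upwards [Lp.coeFn_sub (superpose m g X) (superpose m k X), coeFn_superpose hg X,
    coeFn_superpose hk X] with ξ h1 h2 h3
  rw [h1, Pi.sub_apply, h2, h3]

lemma superpose_superpose {g k : E n → E n} {L L' : ℝ≥0} (hg : LipschitzWith L g)
    (hk : LipschitzWith L' k) (X : H m) :
    superpose m g (superpose m k X) = superpose m (fun x => g (k x)) X := by
  refine eq_superpose (g := fun x => g (k x)) (hg.comp hk) ?_
  filter_upwards [coeFn_superpose hg (superpose m k X), coeFn_superpose hk X] with ξ h1 h2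
  rw [h1, h2]

lemma superpose_id (X : H m) : superpose m (fun x => x) X = X :=
  (eq_superpose LipschitzWith.id (Filter.EventuallyEq.refl _ _)).symm

/-- A continuous family of Lipschitz maps, with uniform Lipschitz constant and linear growth. -/
structure LipPath (φ : ℝ → E n → E n) : Prop where
  cont : Continuous (Function.uncurry φ)
  lip : ∃ L : ℝ≥0, ∀ s, LipschitzWith L (φ s)
  growth : ∃ C : ℝ, ∀ s x, ‖φ s x‖ ≤ C * (1 + ‖x‖)

lemma LipPath.continuous_superpose {φ : ℝ → E n → E n} (h : LipPath φ) (X : H m) :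
    Continuous fun s => superpose m (φ s) X := by
  obtain ⟨L, hL⟩ := h.lip
  obtain ⟨C, hC⟩ := h.growth
  refine continuous_iff_continuousAt.2 fun s₀ => ?_
  have hXm := Lp.aestronglyMeasurable X
  have hXi : Integrable (fun ξ => 8 * C ^ 2 * (1 + ‖X ξ‖ ^ 2)) m.toMeasure :=
    ((integrable_const (1 : ℝ)).add (integrable_norm_sq X)).const_mul _
  have hb : ∀ x : E n, C ^ 2 * (1 + ‖x‖) ^ 2 ≤ 2 * C ^ 2 * (1 + ‖x‖ ^ 2) := fun x => by
    nlinarith [mul_nonneg (sq_nonneg C) (sq_nonneg (1 - ‖x‖))]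
  have e : ∀ s, ‖superpose m (φ s) X - superpose m (φ s₀) X‖ ^ 2 =
      ∫ ξ, ‖φ s (X ξ) - φ s₀ (X ξ)‖ ^ 2 ∂m.toMeasure := by
    intro s
    rw [superpose_sub (hL s) (hL s₀), norm_sq_eq_integral]
    refine integral_congr_ae ?_
    filter_upwards [coeFn_superpose ((hL s).sub (hL s₀)) X] with ξ hξ
    rw [hξ]
  have hc : Continuous fun s => ∫ ξ, ‖φ s (X ξ) - φ s₀ (X ξ)‖ ^ 2 ∂m.toMeasure := by
    refine continuous_of_dominated (bound := fun ξ => 8 * C ^ 2 * (1 + ‖X ξ‖ ^ 2)) (fun s => ?_)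
      (fun s => Filter.Eventually.of_forall fun ξ => ?_) hXi
      (Filter.Eventually.of_forall fun ξ => ?_)
    · exact (((hL s).continuous.comp_aestronglyMeasurable hXm).sub
        ((hL s₀).continuous.comp_aestronglyMeasurable hXm)).norm.pow 2
    · rw [Real.norm_of_nonneg (sq_nonneg _)]
      have h1 := norm_sub_le (φ s (X ξ)) (φ s₀ (X ξ))
      have h2 := pow_le_pow_left₀ (norm_nonneg _)
        (h1.trans (add_le_add (hC s (X ξ)) (hC s₀ (X ξ)))) 2
      have h3 := hb (X ξ)
      calc _ ≤ _ := h2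
        _ = 4 * (C ^ 2 * (1 + ‖X ξ‖) ^ 2) := by ring
        _ ≤ _ := by linarith
    · have : Continuous fun s => φ s (X ξ) := h.cont.comp (continuous_id.prodMk continuous_const)
      fun_prop
  have ht := hc.tendsto s₀
  simp only [sub_self, norm_zero, ne_eq, OfNat.ofNat_ne_zero, not_false_eq_true, zero_pow,
    integral_zero] at ht
  rw [ContinuousAt, tendsto_iff_norm_sub_tendsto_zero]
  have := (Real.continuous_sqrt.tendsto _).comp (ht.congr fun s => (e s).symm)
  simpa [Function.comp_def, Real.sqrt_sq (norm_nonneg _)] using this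

lemma LipPath.lipschitz_integral {φ : ℝ → E n → E n} (h : LipPath φ) {a b : ℝ} (hab : a ≤ b) :
    ∃ L : ℝ≥0, LipschitzWith L fun x => ∫ τ in a..b, φ τ x := by
  obtain ⟨L, hL⟩ := h.lip
  have hc : ∀ x, Continuous fun τ => φ τ x := fun x =>
    h.cont.comp (continuous_id.prodMk continuous_const)
  refine ⟨⟨L * (b - a), mul_nonneg L.2 (sub_nonneg.2 hab)⟩,
    LipschitzWith.of_dist_le_mul fun x y => ?_⟩
  rw [dist_eq_norm, ← intervalIntegral.integral_sub ((hc x).intervalIntegrable _ _)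
    ((hc y).intervalIntegrable _ _)]
  refine (intervalIntegral.norm_integral_le_of_norm_le_const (C := L * dist x y)
    fun τ _ => ?_).trans_eq ?_
  · rw [← dist_eq_norm]; exact (hL τ).dist_le_mul x y
  · rw [abs_of_nonneg (sub_nonneg.2 hab)]
    change _ = L * (b - a) * dist x y
    ring

/-- Bochner integrals in `L²_m` of superposition operators are computed pointwise; tested against an
element of `L²_m`, this is Fubini's theorem. -/
lemma LipPath.integral_superpose {φ : ℝ → E n → E n} (h : LipPath φ) {a b : ℝ} (hab : a ≤ b)
    (X : H m) : ∫ τ in a..b, superpose m (φ τ) X =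
      superpose m (fun x => ∫ τ in a..b, φ τ x) X := by
  obtain ⟨L', hL'⟩ := h.lipschitz_integral hab
  obtain ⟨L, hL⟩ := h.lip
  obtain ⟨C, hC⟩ := h.growth
  have hXm := Lp.aestronglyMeasurable X
  have hcont := h.continuous_superpose X
  have hi : Integrable (fun τ => superpose m (φ τ) X) (volume.restrict (Ioc a b)) :=
    (intervalIntegrable_iff_integrableOn_Ioc_of_le hab).1 (hcont.intervalIntegrable a b)
  refine ext_inner_left ℝ fun k => ?_
  have hkm := Lp.aestronglyMeasurable k
  have hprod : Integrable (fun p : ℝ × E n => ⟪k p.2, φ p.1 (X p.2)⟫_ℝ)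
      ((volume.restrict (Ioc a b)).prod m.toMeasure) := by
    have hb : Integrable (fun ξ => ‖k ξ‖ * (C * (1 + ‖X ξ‖))) m.toMeasure := by
      have h1 : MemLp (fun ξ => C * (1 + ‖X ξ‖)) 2 m.toMeasure :=
        ((memLp_const (1 : ℝ)).add (Lp.memLp X).norm).const_mul C
      exact (Lp.memLp k).norm.integrable_mul h1
    refine (hb.comp_snd (volume.restrict (Ioc a b))).mono' ?_
      (Filter.Eventually.of_forall fun p => ?_)
    · refine (hkm.comp_snd).inner ?_
      exact h.cont.comp_aestronglyMeasurable
        (measurable_fst.aestronglyMeasurable.prodMk hXm.comp_snd)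
    · exact (norm_inner_le_norm _ _).trans (mul_le_mul_of_nonneg_left (hC _ _) (norm_nonneg _))
  rw [intervalIntegral.integral_of_le hab, ← integral_inner hi k, L2.inner_def]
  have e1 : ∀ τ, ⟪k, superpose m (φ τ) X⟫_ℝ = ∫ ξ, ⟪k ξ, φ τ (X ξ)⟫_ℝ ∂m.toMeasure := fun τ => by
    rw [L2.inner_def]
    refine integral_congr_ae ?_
    filter_upwards [coeFn_superpose (hL τ) X] with ξ hξ
    rw [hξ]
  simp_rw [e1]
  rw [integral_integral_swap (f := fun τ ξ => ⟪k ξ, φ τ (X ξ)⟫_ℝ) hprod]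
  refine integral_congr_ae ?_
  filter_upwards [coeFn_superpose hL' X] with ξ hξ
  have hc : Continuous fun τ => φ τ (X ξ) := h.cont.comp (continuous_id.prodMk continuous_const)
  rw [hξ, intervalIntegral.integral_of_le hab, integral_inner
    ((intervalIntegrable_iff_integrableOn_Ioc_of_le hab).1 (hc.intervalIntegrable a b))]

/-! ### The lifted control problem -/

lemma adjoint_lift (A : E n →L[ℝ] E n) :
    ContinuousLinearMap.adjoint (lift m A) = lift m (ContinuousLinearMap.adjoint A) := by
  refine ((ContinuousLinearMap.eq_adjoint_iff _ _).2 fun X Y => ?_).symm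
  rw [L2.inner_def, L2.inner_def]
  refine integral_congr_ae ?_
  filter_upwards [coeFn_lift (ContinuousLinearMap.adjoint A) X, coeFn_lift A Y] with ξ h1 h2
  rw [h1, h2, ContinuousLinearMap.adjoint_inner_left]

/-- The gradient of `X ↦ ∫ l(X) dm` is the superposition with the gradient of `l`. -/
lemma hasGradientAt_integral_comp {l : E n → ℝ} {g : E n → E n} {L : ℝ≥0}
    (hl : ∀ x, HasGradientAt l (g x) x) (hg : LipschitzWith L g) (X : H m) :
    HasGradientAt (fun X : H m => ∫ ξ, l (X ξ) ∂m.toMeasure) (superpose m g X) X := by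
  have hq := quadLip_of_hasGradientAt hl hg
  have hi : ∀ Y : H m, Integrable (fun ξ => l (Y ξ)) m.toMeasure := fun Y =>
    (((integrable_const (1 : ℝ)).add (integrable_norm_sq Y)).const_mul _).mono'
      (hq.cont.comp_aestronglyMeasurable (Lp.aestronglyMeasurable Y))
      (Filter.Eventually.of_forall fun ξ => hq.growth (Y ξ))
  refine hasGradientAt_of_abs_le (C := L) fun Y => ?_
  have hYX : Integrable (fun ξ => l (Y ξ) - l (X ξ)) m.toMeasure := (hi Y).sub (hi X)
  rw [L2.inner_def, ← integral_sub (hi Y) (hi X), ← integral_sub hYX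
    (L2.integrable_inner _ _), norm_sq_eq_integral, ← integral_const_mul,
    ← Real.norm_eq_abs]
  refine norm_integral_le_of_norm_le ((integrable_norm_sq (Y - X)).const_mul _) ?_
  filter_upwards [coeFn_superpose hg X, Lp.coeFn_sub Y X] with ξ h1 h2
  simp only [Pi.sub_apply] at h2
  rw [h1, h2]
  exact abs_sub_sub_inner_gradient_le hl hg _ _

lemma lipschitz_superpose {g : E n → E n} {L : ℝ≥0} (hg : LipschitzWith L g) :
    LipschitzWith L (superpose m g) :=
  LipschitzWith.of_dist_le_mul fun X Y => by
    rw [dist_eq_norm, dist_eq_norm]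
    refine Lp.norm_le_mul_norm_of_ae_le_mul ?_
    filter_upwards [coeFn_superpose hg X, coeFn_superpose hg Y, Lp.coeFn_sub X Y,
      Lp.coeFn_sub (superpose m g X) (superpose m g Y)] with ξ h1 h2 h3 h4
    rw [h3, h4, Pi.sub_apply, Pi.sub_apply, h1, h2, ← dist_eq_norm, ← dist_eq_norm]
    exact hg.dist_le_mul _ _

lemma mono_superpose {g : E n → E n} {L : ℝ≥0} {c : ℝ} (hg : LipschitzWith L g)
    (hm : ∀ x y, c * ‖x - y‖ ^ 2 ≤ ⟪g x - g y, x - y⟫_ℝ) (X Y : H m) :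
    c * ‖X - Y‖ ^ 2 ≤ ⟪superpose m g X - superpose m g Y, X - Y⟫_ℝ := by
  rw [norm_sq_eq_integral, ← integral_const_mul, L2.inner_def]
  refine integral_mono_ae ((integrable_norm_sq (X - Y)).const_mul _) (L2.integrable_inner _ _) ?_
  filter_upwards [coeFn_superpose hg X, coeFn_superpose hg Y, Lp.coeFn_sub X Y,
    Lp.coeFn_sub (superpose m g X) (superpose m g Y)] with ξ h1 h2 h3 h4
  rw [h3, h4, Pi.sub_apply, Pi.sub_apply, h1, h2]
  exact hm _ _

lemma coercive_lift {A : E n →L[ℝ] E n} {c : ℝ} (h : ∀ x, c * ‖x‖ ^ 2 ≤ ⟪A x, x⟫_ℝ) (X : H m) :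
    c * ‖X‖ ^ 2 ≤ ⟪lift m A X, X⟫_ℝ := by
  rw [norm_sq_eq_integral, ← integral_const_mul, L2.inner_def]
  refine integral_mono_ae ((integrable_norm_sq X).const_mul _) (L2.integrable_inner _ _) ?_
  filter_upwards [coeFn_lift A X] with ξ h1
  rw [h1]
  exact h _

lemma lift_lift (A A' : E n →L[ℝ] E n) (X : H m) :
    lift m A (lift m A' X) = lift m (A ∘L A') X := by
  refine Lp.ext ?_
  filter_upwards [coeFn_lift A (lift m A' X), coeFn_lift A' X, coeFn_lift (A ∘L A') X]
    with ξ h1 h2 h3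
  rw [h1, h2, h3]
  rfl

lemma lift_id (X : H m) : lift m (ContinuousLinearMap.id ℝ (E n)) X = X :=
  Lp.ext (coeFn_lift _ X)

/-- The control problem on `ℝⁿ` lifted to `L²_m`. -/
def ConvexControl.lifted (Q : ConvexControl (E n)) (m : P2 n) : ConvexControl (H m) where
  A := lift m Q.A
  B := lift m Q.B
  N := lift m Q.N
  Ninv := lift m Q.Ninv
  T := Q.T
  l := fun X => ∫ ξ, Q.l (X ξ) ∂m.toMeasure
  lT := fun X => ∫ ξ, Q.lT (X ξ) ∂m.toMeasure
  g := superpose m Q.g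
  gT := superpose m Q.gT
  Lip := Q.Lip
  c := Q.c
  T_pos := Q.T_pos
  c_pos := Q.c_pos
  N_symm := fun X Y => by
    have : ContinuousLinearMap.adjoint Q.N = Q.N :=
      ((ContinuousLinearMap.eq_adjoint_iff _ _).2 Q.N_symm).symm
    rw [← ContinuousLinearMap.adjoint_inner_right, adjoint_lift, this]
  N_Ninv := fun X => by
    rw [lift_lift, show Q.N ∘L Q.Ninv = ContinuousLinearMap.id ℝ (E n) from
      ContinuousLinearMap.ext Q.N_Ninv, lift_id]
  Ninv_N := fun X => by
    rw [lift_lift, show Q.Ninv ∘L Q.N = ContinuousLinearMap.id ℝ (E n) from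
      ContinuousLinearMap.ext Q.Ninv_N, lift_id]
  N_coercive := coercive_lift Q.N_coercive
  S_coercive := fun X => by
    rw [adjoint_lift, lift_lift, lift_lift]
    exact coercive_lift (A := Q.B ∘L Q.Ninv ∘L ContinuousLinearMap.adjoint Q.B) Q.S_coercive X
  hasGradientAt_l := hasGradientAt_integral_comp Q.hasGradientAt_l Q.lipschitz_g
  hasGradientAt_lT := hasGradientAt_integral_comp Q.hasGradientAt_lT Q.lipschitz_gT
  lipschitz_g := lipschitz_superpose Q.lipschitz_g
  lipschitz_gT := lipschitz_superpose Q.lipschitz_gT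
  mono_g := mono_superpose Q.lipschitz_g Q.mono_g
  mono_gT := mono_superpose Q.lipschitz_gT Q.mono_gT

end Superposition

/-! ### The lifted flow is the superposition of the flow on `ℝⁿ` -/

section LiftedFlow

open ControlData ConvexControl

variable {n : ℕ} {m : P2 n} {Q : ConvexControl (E n)}

lemma LipPath.comp {φ : ℝ → E n → E n} (h : LipPath φ) {k : E n → E n} {L : ℝ≥0}
    (hk : LipschitzWith L k) : LipPath fun s x => k (φ s x) where
  cont := hk.continuous.comp h.cont
  lip := by
    obtain ⟨L', hL'⟩ := h.lip
    exact ⟨L * L', fun s => hk.comp (hL' s)⟩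
  growth := by
    obtain ⟨C, hC⟩ := h.growth
    refine ⟨‖k 0‖ + L * C, fun s x => ?_⟩
    have h1 := hk.dist_le_mul (φ s x) 0
    rw [dist_eq_norm, dist_eq_norm, sub_zero] at h1
    have h2 := mul_le_mul_of_nonneg_left (hC s x) L.2
    have h3 := norm_le_norm_add_norm_sub' (k (φ s x)) (k 0)
    have h4 : 0 ≤ ‖k 0‖ * ‖x‖ := by positivity
    change (L : ℝ) * ‖φ s x‖ ≤ L * (C * (1 + ‖x‖)) at h2
    linarith

lemma LipPath.add {φ ψ : ℝ → E n → E n} (h : LipPath φ) (h' : LipPath ψ) :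
    LipPath fun s x => φ s x + ψ s x where
  cont := h.cont.add h'.cont
  lip := by
    obtain ⟨L, hL⟩ := h.lip
    obtain ⟨L', hL'⟩ := h'.lip
    exact ⟨L + L', fun s => (hL s).add (hL' s)⟩
  growth := by
    obtain ⟨C, hC⟩ := h.growth
    obtain ⟨C', hC'⟩ := h'.growth
    exact ⟨C + C', fun s x => (norm_add_le _ _).trans
      ((add_le_add (hC s x) (hC' s x)).trans_eq (by ring))⟩

lemma LipPath.sub {φ ψ : ℝ → E n → E n} (h : LipPath φ) (h' : LipPath ψ) :
    LipPath fun s x => φ s x - ψ s x := by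
  have h1 : LipschitzWith 1 fun x : E n => -x := LipschitzWith.id.neg
  simpa only [sub_eq_add_neg] using h.add (h'.comp h1)

/-- Projection of times onto `[t, T]`, for `t ≤ T`. Composed with it, the flow started at time `t` is
Lipschitz in space uniformly over all of `ℝ`, while it is uncontrolled outside `[t, T]` otherwise. -/
def clamp (t T s : ℝ) : ℝ := max t (min s T)

lemma clamp_mem {t : ℝ} (ht : t ∈ Icc 0 Q.T) (s : ℝ) : clamp t Q.T s ∈ Icc t Q.T :=
  ⟨le_max_left _ _, max_le ht.2 (min_le_right _ _)⟩

lemma clamp_of_mem {t T s : ℝ} (hs : s ∈ Icc t T) : clamp t T s = s := by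
  rw [clamp, min_eq_left hs.2, max_eq_right hs.1]

lemma continuous_clamp (t T : ℝ) : Continuous (clamp t T) :=
  continuous_const.max (continuous_id.min continuous_const)

lemma lipPath_state {t : ℝ} (ht : t ∈ Icc 0 Q.T) :
    LipPath fun s x => Q.state t x (clamp t Q.T s) := by
  have lip := fun s => lipschitz_state ht (clamp_mem ht s)
  have cont : ∀ x, Continuous fun s => Q.state t x (clamp t Q.T s) :=
    fun x => (continuous_state ht x).comp (continuous_clamp t Q.T)
  obtain ⟨R, -, hR⟩ := Q.exists_growth
  have hc := continuous_prod_of_continuous_lipschitzWith'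
    (fun p : ℝ × E n => Q.state t p.2 (clamp t Q.T p.1)) Q.κ lip cont
  exact ⟨hc, ⟨Q.κ, lip⟩, ⟨R, fun s x => (hR t ht _ (clamp_mem ht s) x).1⟩⟩

lemma lipPath_costate {t : ℝ} (ht : t ∈ Icc 0 Q.T) :
    LipPath fun s x => Q.costate t x (clamp t Q.T s) := by
  have lip := fun s => lipschitz_costate ht (clamp_mem ht s)
  have cont : ∀ x, Continuous fun s => Q.costate t x (clamp t Q.T s) :=
    fun x => (continuous_costate ht x).comp (continuous_clamp t Q.T)
  obtain ⟨R, -, hR⟩ := Q.exists_growth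
  have hc := continuous_prod_of_continuous_lipschitzWith'
    (fun p : ℝ × E n => Q.costate t p.2 (clamp t Q.T p.1)) Q.κ lip cont
  exact ⟨hc, ⟨Q.κ, lip⟩, ⟨R, fun s x => (hR t ht _ (clamp_mem ht s) x).2⟩⟩

lemma lifted_As : (Q.lifted m).As = lift m Q.As := adjoint_lift Q.A

lemma lifted_Bs : (Q.lifted m).Bs = lift m Q.Bs := adjoint_lift Q.B

lemma lifted_S : (Q.lifted m).S = lift m Q.S := by
  ext1 X
  rw [S_apply, lifted_Bs]
  change lift m Q.B (lift m Q.Ninv (lift m Q.Bs X)) = _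
  rw [lift_lift, lift_lift]
  rfl

lemma lifted_isSol {t : ℝ} (ht : t ∈ Icc 0 Q.T) (X : H m) : (Q.lifted m).IsSol t X
    (fun s => superpose m (fun x => Q.state t x (clamp t Q.T s)) X)
    (fun s => superpose m (fun x => Q.costate t x (clamp t Q.T s)) X) := by
  have hY := lipPath_state ht
  have hZ := lipPath_costate ht
  have lY := fun s => lipschitz_state ht (clamp_mem ht s)
  have lZ := fun s => lipschitz_costate ht (clamp_mem ht s)
  refine ⟨(hY.continuous_superpose X).continuousOn, (hZ.continuous_superpose X).continuousOn,
    fun s hs => ?_, fun s hs => ?_⟩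
  · have hs : s ∈ Icc t Q.T := hs
    have hp := (hY.comp Q.A.lipschitz).sub (hZ.comp Q.S.lipschitz)
    have e : ∀ τ, (Q.lifted m).A (superpose m (fun x => Q.state t x (clamp t Q.T τ)) X) -
        (Q.lifted m).S (superpose m (fun x => Q.costate t x (clamp t Q.T τ)) X) =
        superpose m (fun x => Q.A (Q.state t x (clamp t Q.T τ)) -
          Q.S (Q.costate t x (clamp t Q.T τ))) X := fun τ => by
      rw [lifted_S]
      change lift m Q.A _ - _ = _
      rw [lift_superpose _ (lY τ), lift_superpose _ (lZ τ)]
      exact superpose_sub (g := fun x => Q.A (Q.state t x (clamp t Q.T τ)))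
        (k := fun x => Q.S (Q.costate t x (clamp t Q.T τ))) (Q.A.lipschitz.comp (lY τ))
        (Q.S.lipschitz.comp (lZ τ)) X
    obtain ⟨L, hL⟩ := hp.lipschitz_integral hs.1
    simp_rw [e]
    rw [hp.integral_superpose hs.1]
    have h := superpose_add (m := m) (g := fun x => x) LipschitzWith.id hL X
    have hid : superpose m (fun x : E n => x) X = X := superpose_id X
    rw [hid] at h
    rw [h]
    congr 1
    funext x
    rw [clamp_of_mem hs, (isSol ht x).eqY s hs]
    congr 1
    refine intervalIntegral.integral_congr fun τ hτ => ?_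
    rw [uIcc_of_le hs.1] at hτ
    simp only [clamp_of_mem ⟨hτ.1, hτ.2.trans hs.2⟩]
  · have hs : s ∈ Icc t Q.T := hs
    have hp := (hZ.comp Q.As.lipschitz).add (hY.comp Q.lipschitz_g)
    have e : ∀ τ, (Q.lifted m).As (superpose m (fun x => Q.costate t x (clamp t Q.T τ)) X) +
        (Q.lifted m).g (superpose m (fun x => Q.state t x (clamp t Q.T τ)) X) =
        superpose m (fun x => Q.As (Q.costate t x (clamp t Q.T τ)) +
          Q.g (Q.state t x (clamp t Q.T τ))) X := fun τ => by
      rw [lifted_As]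
      change _ + superpose m Q.g _ = _
      rw [lift_superpose _ (lZ τ), superpose_superpose Q.lipschitz_g (lY τ)]
      exact superpose_add (g := fun x => Q.As (Q.costate t x (clamp t Q.T τ)))
        (k := fun x => Q.g (Q.state t x (clamp t Q.T τ))) (Q.As.lipschitz.comp (lZ τ))
        (Q.lipschitz_g.comp (lY τ)) X
    obtain ⟨L, hL⟩ := hp.lipschitz_integral hs.2
    simp_rw [e]
    change _ = (∫ τ in s..Q.T, _) + superpose m Q.gT (superpose m (fun x =>
      Q.state t x (clamp t Q.T Q.T)) X)
    rw [hp.integral_superpose hs.2, superpose_superpose Q.lipschitz_gT (lY Q.T),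
      superpose_add (k := fun x => Q.gT (Q.state t x (clamp t Q.T Q.T))) hL
        (Q.lipschitz_gT.comp (lY Q.T))]
    congr 1
    funext x
    rw [clamp_of_mem hs, (isSol ht x).eqZ s hs, clamp_of_mem (right_mem_Icc.2 ht.2)]
    congr 1
    refine intervalIntegral.integral_congr fun τ hτ => ?_
    rw [uIcc_of_le hs.2] at hτ
    simp only [clamp_of_mem ⟨hs.1.trans hτ.1, hτ.2⟩]

lemma lifted_state {t s : ℝ} (ht : t ∈ Icc 0 Q.T) (hs : s ∈ Icc t Q.T) (X : H m) :
    (Q.lifted m).state t X s = superpose m (fun x => Q.state t x s) X := by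
  have := (IsSol.unique (Q := Q.lifted m) ht (lifted_isSol ht X)
    (isSol (Q := Q.lifted m) ht X) hs).1
  simpa only [clamp_of_mem hs] using this

lemma lifted_costate {t s : ℝ} (ht : t ∈ Icc 0 Q.T) (hs : s ∈ Icc t Q.T) (X : H m) :
    (Q.lifted m).costate t X s = superpose m (fun x => Q.costate t x s) X := by
  have := (IsSol.unique (Q := Q.lifted m) ht (lifted_isSol ht X)
    (isSol (Q := Q.lifted m) ht X) hs).2
  simpa only [clamp_of_mem hs] using this

lemma lifted_field {t : ℝ} (ht : t ∈ Icc 0 Q.T) (X : H m) :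
    (Q.lifted m).field t X = superpose m (Q.field t) X :=
  lifted_costate ht (left_mem_Icc.2 ht.2) X

variable (Q) in
lemma quadLip_l : QuadLip (‖Q.g 0‖ + Q.Lip) Q.l :=
  quadLip_of_hasGradientAt Q.hasGradientAt_l Q.lipschitz_g

variable (Q) in
lemma quadLip_lT : QuadLip (‖Q.gT 0‖ + Q.Lip) Q.lT :=
  quadLip_of_hasGradientAt Q.hasGradientAt_lT Q.lipschitz_gT

lemma quadLip_val {t : ℝ} (ht : t ∈ Icc 0 Q.T) : QuadLip (‖Q.field t 0‖ + Q.κ) (Q.val t) :=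
  quadLip_of_hasGradientAt (Q.hasGradientAt_val ht) (lipschitz_field ht)

lemma QuadLip.integrable_comp {C : ℝ} {u : E n → ℝ} (hu : QuadLip C u) (X : H m) :
    Integrable (fun ξ => u (X ξ)) m.toMeasure :=
  (((integrable_const (1 : ℝ)).add (integrable_norm_sq X)).const_mul _).mono'
    (hu.cont.comp_aestronglyMeasurable (Lp.aestronglyMeasurable X))
    (Filter.Eventually.of_forall fun ξ => hu.growth (X ξ))

lemma lifted_lag (Y Z : H m) :
    (Q.lifted m).lag Y Z = ∫ ξ, Q.lag (Y ξ) (Z ξ) ∂m.toMeasure := by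
  have i : Integrable (fun ξ => ⟪Z ξ, Q.S (Z ξ)⟫_ℝ) m.toMeasure := by
    refine (L2.integrable_inner (𝕜 := ℝ) Z (lift m Q.S Z)).congr ?_
    filter_upwards [coeFn_lift Q.S Z] with ξ h
    rw [h]
  simp only [lag]
  rw [integral_add ((quadLip_l Q).integrable_comp Y) (i.const_mul _), integral_const_mul,
    lifted_S, L2.inner_def]
  congr 2
  refine integral_congr_ae ?_
  filter_upwards [coeFn_lift Q.S Z] with ξ h
  rw [h]

variable (Q) in
lemma exists_abs_lag_le_sq : ∃ C, ∀ y z, |Q.lag y z| ≤ C * (1 + ‖y‖ ^ 2 + ‖z‖ ^ 2) := by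
  have hl := (quadLip_l Q).growth
  set a := |Q.l 0| + 2 * (‖Q.g 0‖ + Q.Lip) with ha
  have ha0 : 0 ≤ a := by
    have : (0 : ℝ) ≤ Q.Lip := Q.Lip.2
    positivity
  refine ⟨a + ‖Q.S‖, fun y z => ?_⟩
  have h1 : |⟪z, Q.S z⟫_ℝ| ≤ ‖Q.S‖ * ‖z‖ ^ 2 := by
    refine (abs_real_inner_le_norm _ _).trans ?_
    have := mul_le_mul_of_nonneg_left (Q.S.le_opNorm z) (norm_nonneg z)
    linarith
  have h2 := hl y
  have h3 : |Q.lag y z| ≤ |Q.l y| + |1 / 2 * ⟪z, Q.S z⟫_ℝ| := abs_add_le _ _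
  rw [abs_mul, abs_of_pos (show (0 : ℝ) < 1 / 2 by norm_num)] at h3
  have p1 : 0 ≤ ‖Q.S‖ * (1 + ‖y‖ ^ 2 + ‖z‖ ^ 2) := by positivity
  have p2 : 0 ≤ a * ‖z‖ ^ 2 := by positivity
  have p3 : 0 ≤ ‖Q.S‖ * ‖z‖ ^ 2 := by positivity
  have p4 : 0 ≤ ‖Q.S‖ * (1 + ‖y‖ ^ 2) := by positivity
  linarith

/-- The running cost along the optimal flow is integrable in time and space. -/
lemma integrable_lag_flow {t : ℝ} (ht : t ∈ Icc 0 Q.T) (X : H m) :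
    Integrable (fun p : ℝ × E n => Q.lag (Q.state t (X p.2) (clamp t Q.T p.1))
      (Q.costate t (X p.2) (clamp t Q.T p.1))) ((volume.restrict (Ioc t Q.T)).prod m.toMeasure) := by
  obtain ⟨C, hC⟩ := exists_abs_lag_le_sq Q
  obtain ⟨R, hR0, hR⟩ := Q.exists_growth
  have hXm := Lp.aestronglyMeasurable X
  have hm : AEStronglyMeasurable (fun p : ℝ × E n => (p.1, X p.2))
      ((volume.restrict (Ioc t Q.T)).prod m.toMeasure) :=
    measurable_fst.aestronglyMeasurable.prodMk hXm.comp_snd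
  have hb : Integrable (fun ξ => |C| * (1 + 4 * R ^ 2 * (1 + ‖X ξ‖ ^ 2))) m.toMeasure :=
    ((integrable_const (1 : ℝ)).add (((integrable_const (1 : ℝ)).add
      (integrable_norm_sq X)).const_mul _)).const_mul _
  refine (hb.comp_snd (volume.restrict (Ioc t Q.T))).mono' ?_
    (Filter.Eventually.of_forall fun p => ?_)
  · have h1 := (lipPath_state ht).cont.comp_aestronglyMeasurable hm
    have h2 := (lipPath_costate ht).cont.comp_aestronglyMeasurable hm
    have hc : Continuous fun w : E n × E n => Q.lag w.1 w.2 :=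
      (Q.continuous_l.comp continuous_fst).add (continuous_const.mul
        (continuous_snd.inner (Q.S.continuous.comp continuous_snd)))
    exact hc.comp_aestronglyMeasurable (h1.prodMk h2)
  · have h := hR t ht _ (clamp_mem ht p.1) (X p.2)
    have h1 := pow_le_pow_left₀ (norm_nonneg _) h.1 2
    have h2 := pow_le_pow_left₀ (norm_nonneg _) h.2 2
    have h3 : (R * (1 + ‖X p.2‖)) ^ 2 ≤ 2 * R ^ 2 * (1 + ‖X p.2‖ ^ 2) := by
      nlinarith [mul_nonneg (sq_nonneg R) (sq_nonneg (1 - ‖X p.2‖))]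
    refine (hC _ _).trans ((mul_le_mul_of_nonneg_right (le_abs_self C) (by positivity)).trans
      (mul_le_mul_of_nonneg_left ?_ (abs_nonneg C)))
    linarith

/-- The lifted value function is the integral of the value function on `ℝⁿ`. -/
lemma lifted_val {t : ℝ} (ht : t ∈ Icc 0 Q.T) (X : H m) :
    (Q.lifted m).val t X = ∫ ξ, Q.val t (X ξ) ∂m.toMeasure := by
  have hF := integrable_lag_flow ht X
  have hTT := right_mem_Icc.2 ht.2
  have e1 : ∀ τ ∈ Ioc t Q.T, (Q.lifted m).lag ((Q.lifted m).state t X τ)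
      ((Q.lifted m).costate t X τ) = ∫ ξ, Q.lag (Q.state t (X ξ) (clamp t Q.T τ))
        (Q.costate t (X ξ) (clamp t Q.T τ)) ∂m.toMeasure := by
    intro τ hτ
    have hτ' := Ioc_subset_Icc_self hτ
    rw [lifted_state ht hτ', lifted_costate ht hτ', lifted_lag, clamp_of_mem hτ']
    refine integral_congr_ae ?_
    filter_upwards [coeFn_superpose (lipschitz_state ht hτ') X,
      coeFn_superpose (lipschitz_costate ht hτ') X] with ξ h1 h2
    rw [h1, h2]
  have e2 : ∀ x, ∫ τ in Ioc t Q.T, Q.lag (Q.state t x (clamp t Q.T τ))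
      (Q.costate t x (clamp t Q.T τ)) =
      ∫ τ in t..Q.T, Q.lag (Q.state t x τ) (Q.costate t x τ) := by
    intro x
    rw [intervalIntegral.integral_of_le ht.2]
    refine setIntegral_congr_fun measurableSet_Ioc fun τ hτ => ?_
    simp only [clamp_of_mem (Ioc_subset_Icc_self hτ)]
  have e3 : (Q.lifted m).lT ((Q.lifted m).state t X Q.T) =
      ∫ ξ, Q.lT (Q.state t (X ξ) Q.T) ∂m.toMeasure := by
    rw [lifted_state ht hTT]
    refine integral_congr_ae ?_
    filter_upwards [coeFn_superpose (lipschitz_state ht hTT) X] with ξ h1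
    rw [h1]
  have i2 : Integrable (fun ξ => Q.lT (Q.state t (X ξ) Q.T)) m.toMeasure := by
    refine ((quadLip_lT Q).integrable_comp (superpose m (fun x => Q.state t x Q.T) X)).congr ?_
    filter_upwards [coeFn_superpose (lipschitz_state ht hTT) X] with ξ h1
    rw [h1]
  have i1 : Integrable (fun ξ => ∫ τ in t..Q.T, Q.lag (Q.state t (X ξ) τ)
      (Q.costate t (X ξ) τ)) m.toMeasure := by
    simp_rw [← e2]
    exact hF.integral_prod_right
  rw [val_eq]
  change (∫ τ in t..Q.T, _) + (Q.lifted m).lT ((Q.lifted m).state t X Q.T) = _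
  rw [e3, intervalIntegral.integral_of_le ht.2, setIntegral_congr_fun measurableSet_Ioc e1,
    integral_integral_swap (f := fun τ ξ => Q.lag (Q.state t (X ξ) (clamp t Q.T τ))
      (Q.costate t (X ξ) (clamp t Q.T τ))) hF]
  simp_rw [e2]
  rw [← integral_add i1 i2]
  rfl

end LiftedFlow

/-! ### Reduction of the mean field type problem to a control problem on `ℝⁿ` -/

section Represents

open ControlData ConvexControl

variable {n : ℕ}

/-- `Q` is a control problem on `ℝⁿ` with the dynamics of `P`, whose costs integrate to those
of `P`. -/
structure Represents (Q : ConvexControl (E n)) (P : ControlData n) : Prop where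
  A : Q.A = P.A
  B : Q.B = P.B
  N : Q.N = P.Nmat
  Ninv : Q.Ninv = P.Ninv
  T : Q.T = P.T
  F : ∀ m, P.F m = ∫ x, Q.l x ∂m.toMeasure
  FT : ∀ m, P.FT m = ∫ x, Q.lT x ∂m.toMeasure

/-- Coercivity of `B N⁻¹ B*` forces `B*` to be invertible, hence `N` to be coercive. -/
lemma ControlData.exists_coercive_Nmat (P : ControlData n) {c : ℝ} (hc : 0 < c)
    (hA1 : ∀ x, c * ‖x‖ ^ 2 ≤ ⟪P.S x, x⟫_ℝ) :
    ∃ c' > 0, ∀ v, c' * ‖v‖ ^ 2 ≤ ⟪P.Nmat v, v⟫_ℝ := by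
  have hinj : Function.Injective P.Bstar := by
    refine (injective_iff_map_eq_zero P.Bstar).2 fun x hx => ?_
    have h := hA1 x
    have h0 : P.S x = 0 := by
      change P.B (P.Ninv (P.Bstar x)) = 0
      rw [hx, map_zero, map_zero]
    rw [h0, inner_zero_left] at h
    have : ‖x‖ ^ 2 ≤ 0 := by
      by_contra hlt
      push Not at hlt
      exact absurd h (not_le.2 (mul_pos hc hlt))
    exact norm_eq_zero.1 (pow_eq_zero_iff two_ne_zero |>.1 (le_antisymm this (sq_nonneg _)))
  have hsurj : Function.Surjective P.Bstar :=
    LinearMap.surjective_of_injective (f := (P.Bstar : E n →ₗ[ℝ] E n)) hinj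
  set k := ‖P.Ninv‖ * ‖P.Bstar‖ + 1 with hk
  have hk0 : 0 < k := by positivity
  refine ⟨c / k ^ 2, by positivity, fun v => ?_⟩
  obtain ⟨x, hx⟩ := hsurj (P.Nmat v)
  have hv : v = P.Ninv (P.Bstar x) := by
    rw [hx]; exact (P.N.symm_apply_apply v).symm
  have h1 : ⟪P.Nmat v, v⟫_ℝ = ⟪P.S x, x⟫_ℝ := by
    rw [← hx, Bstar, ContinuousLinearMap.adjoint_inner_left, real_inner_comm]
    congr 1
    rw [hv]
    rfl
  have h2 : ‖v‖ ≤ k * ‖x‖ := by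
    rw [hv]
    calc ‖P.Ninv (P.Bstar x)‖ ≤ ‖P.Ninv‖ * (‖P.Bstar‖ * ‖x‖) :=
          (P.Ninv.le_opNorm _).trans (mul_le_mul_of_nonneg_left (P.Bstar.le_opNorm x)
            (norm_nonneg _))
      _ ≤ k * ‖x‖ := by rw [hk, add_mul, mul_assoc]; linarith [norm_nonneg x]
  rw [h1]
  refine le_trans ?_ (hA1 x)
  rw [div_mul_eq_mul_div, div_le_iff₀ (by positivity), mul_assoc]
  refine mul_le_mul_of_nonneg_left ?_ hc.le
  calc ‖v‖ ^ 2 ≤ (k * ‖x‖) ^ 2 := pow_le_pow_left₀ (norm_nonneg _) h2 2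
    _ = ‖x‖ ^ 2 * k ^ 2 := by ring

lemma exists_represents (P : ControlData n) {c ν M νT MT : ℝ} (hT : 0 < P.T)
    (hN : IsSelfAdjoint P.Nmat) (hc : 0 < c) (hν : 0 < ν) (hνT : 0 < νT)
    (hA1 : ∀ x, c * ‖x‖ ^ 2 ≤ ⟪P.S x, x⟫_ℝ) (hA2 : CoefficientAssumption P.f ν M)
    (hA3 : CoefficientAssumption P.h νT MT) : ∃ Q, Represents Q P := by
  obtain ⟨l, g, L, hF, hl, hg, hm⟩ := hA2.exists_linear hν
  obtain ⟨lT, gT, LT, hFT, hlT, hgT, hmT⟩ := hA3.exists_linear hνT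
  obtain ⟨c', hc', hNc⟩ := P.exists_coercive_Nmat hc hA1
  set k := min (min c c') (min ν νT) with hk
  have k1 : k ≤ c := (min_le_left _ _).trans (min_le_left _ _)
  have k2 : k ≤ c' := (min_le_left _ _).trans (min_le_right _ _)
  have k3 : k ≤ ν := (min_le_right _ _).trans (min_le_left _ _)
  have k4 : k ≤ νT := (min_le_right _ _).trans (min_le_right _ _)
  exact ⟨{
    A := P.A
    B := P.B
    N := P.Nmat
    Ninv := P.Ninv
    T := P.T
    l := l
    lT := lT
    g := g
    gT := gT
    Lip := max L LT
    c := k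
    T_pos := hT
    c_pos := lt_min (lt_min hc hc') (lt_min hν hνT)
    N_symm := fun x y => hN.isSymmetric x y
    N_Ninv := P.N.apply_symm_apply
    Ninv_N := P.N.symm_apply_apply
    N_coercive := fun x => (mul_le_mul_of_nonneg_right k2 (sq_nonneg _)).trans (hNc x)
    S_coercive := fun x => (mul_le_mul_of_nonneg_right k1 (sq_nonneg _)).trans (hA1 x)
    hasGradientAt_l := hl
    hasGradientAt_lT := hlT
    lipschitz_g := hg.weaken (le_max_left _ _)
    lipschitz_gT := hgT.weaken (le_max_right _ _)
    mono_g := fun x y => (mul_le_mul_of_nonneg_right k3 (sq_nonneg _)).trans (hm x y)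
    mono_gT := fun x y => (mul_le_mul_of_nonneg_right k4 (sq_nonneg _)).trans (hmT x y) },
    rfl, rfl, rfl, rfl, rfl, hF, hFT⟩

namespace Represents

variable {Q : ConvexControl (E n)} {P : ControlData n}

lemma As (h : Represents Q P) : Q.As = P.Astar := by rw [ConvexControl.As, h.A]; rfl

lemma Bs (h : Represents Q P) : Q.Bs = P.Bstar := by rw [ConvexControl.Bs, h.B]; rfl

lemma S (h : Represents Q P) : Q.S = P.S := by rw [ConvexControl.S, h.B, h.Ninv, h.Bs]; rfl

lemma feedback (h : Represents Q P) (z : E n) : Q.feedback z = -P.Ninv (P.Bstar z) := by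
  rw [ConvexControl.feedback, h.Ninv, h.Bs]

lemma Ddm_F (h : Represents Q P) (m : P2 n) (x : E n) : Ddm P.F m x = Q.g x :=
  ((quadLip_l Q).hasGradientAt_functionalDeriv h.F Q.hasGradientAt_l m x).gradient

lemma Ddm_FT (h : Represents Q P) (m : P2 n) (x : E n) : Ddm P.FT m x = Q.gT x :=
  ((quadLip_lT Q).hasGradientAt_functionalDeriv h.FT Q.hasGradientAt_lT m x).gradient

/-- The forward-backward system decouples: each particle solves its own system on `ℝⁿ`. -/
lemma isSol_of_isFBODE (h : Represents Q P) {m : P2 n} {t : ℝ} {Y Z : ℝ → E n → E n}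
    (hYZ : P.IsFBODE m t Y Z)
    (x : E n) : Q.IsSol t x (fun s => Y s x) fun s => Z s x := by
  have e := hYZ.eqZ x
  simp only [h.Ddm_F, h.Ddm_FT] at e
  have := hYZ.contY x
  have := hYZ.contZ x
  have := hYZ.eqY x
  rw [IsSol, h.T]
  constructor
  · assumption
  · assumption
  · rwa [h.A, h.S]
  · rwa [h.As]

end Represents

lemma push_toMeasure {m : P2 n} {X : E n → E n} (hX : MemLp X 2 m.toMeasure) :
    (push m X).toMeasure = m.toMeasure.map X := by
  rw [push, dif_pos hX]

lemma integral_push {m : P2 n} {X : E n → E n} (hX : MemLp X 2 m.toMeasure) {u : E n → ℝ}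
    (hu : Continuous u) : ∫ x, u x ∂(push m X).toMeasure = ∫ ξ, u (X ξ) ∂m.toMeasure := by
  rw [push_toMeasure hX, integral_map hX.1.aemeasurable hu.aestronglyMeasurable]

end Represents

/-! ### Controls and states as functions of time and space -/

section Fubini

open ControlData ConvexControl

variable {n : ℕ}

lemma aestronglyMeasurable_uncurry_simpleFunc {F : Type*} [NormedAddCommGroup F] {α : Type*}
    [MeasurableSpace α] {μ : Measure α} [SFinite μ] {ρ : Measure ℝ} [SFinite ρ]
    (φ : SimpleFunc ℝ ℝ) {y : ℝ → α → F} (hy : ∀ s, AEStronglyMeasurable (y (φ s)) μ) :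
    AEStronglyMeasurable (fun p : ℝ × α => y (φ p.1) p.2) (ρ.prod μ) := by
  have e : (fun p : ℝ × α => y (φ p.1) p.2) = fun p => ∑ c ∈ φ.range,
      ((φ ⁻¹' {c}) ×ˢ (univ : Set α)).indicator (fun p : ℝ × α => y c p.2) p := by
    funext p
    rw [Finset.sum_eq_single (φ p.1)]
    · simp
    · intro c _ hc
      refine indicator_of_notMem (fun h => hc ?_) _
      exact h.1.symm
    · intro h
      exact absurd (φ.mem_range_self p.1) h
  rw [e]
  refine Finset.aestronglyMeasurable_fun_sum _ fun c hc => ?_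
  obtain ⟨s, rfl⟩ := SimpleFunc.mem_range.1 hc
  exact (hy s).comp_snd.indicator ((φ.measurableSet_fiber _).prod MeasurableSet.univ)

/-- A family of measurable functions which is continuous in time is jointly measurable: it is the
limit of its values along discretisations of time. -/
lemma aestronglyMeasurable_uncurry_of_ae_continuousOn {F : Type*} [NormedAddCommGroup F]
    {α : Type*} [MeasurableSpace α] {μ : Measure α} [SFinite μ] {a b : ℝ} (hab : a ≤ b)
    {y : ℝ → α → F} (hm : ∀ s ∈ Icc a b, AEStronglyMeasurable (y s) μ)
    (hc : ∀ᵐ x ∂μ, ContinuousOn (fun s => y s x) (Icc a b)) :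
    AEStronglyMeasurable (Function.uncurry y) ((volume.restrict (Ioc a b)).prod μ) := by
  have hcl := (continuous_clamp a b).stronglyMeasurable
  have hmem : ∀ s, clamp a b s ∈ Icc a b := fun s =>
    ⟨le_max_left _ _, max_le hab (min_le_right _ _)⟩
  -- Clamping the simple approximations keeps their values in `[a, b]`.
  set φ : ℕ → SimpleFunc ℝ ℝ := fun k => (hcl.approx k).map (clamp a b) with hφ
  refine aestronglyMeasurable_of_tendsto_ae Filter.atTop
    (f := fun k p => y (φ k p.1) p.2) (fun k =>
      aestronglyMeasurable_uncurry_simpleFunc (φ k) fun s => hm _ (hmem _)) ?_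
  filter_upwards [Measure.quasiMeasurePreserving_snd.ae hc, Measure.quasiMeasurePreserving_fst.ae
    (ae_restrict_mem measurableSet_Ioc)] with p hp hs
  have hs' := Ioc_subset_Icc_self hs
  have h1 : Filter.Tendsto (fun k => φ k p.1) Filter.atTop (nhdsWithin p.1 (Icc a b)) := by
    refine tendsto_nhdsWithin_iff.2 ⟨?_, Filter.Eventually.of_forall fun k => hmem _⟩
    have h2 := ((continuous_clamp a b).tendsto _).comp (hcl.tendsto_approx p.1)
    rwa [clamp_of_mem hs', clamp_of_mem hs'] at h2
  exact (hp p.1 hs').tendsto.comp h1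

/-- Grönwall's bound for the controlled linear dynamics. -/
lemma norm_state_le {K : Type*} [NormedAddCommGroup K] [NormedSpace ℝ K] [CompleteSpace K]
    (A B : K →L[ℝ] K) {a b : ℝ} {x : K} {v y : ℝ → K}
    (hv : IntegrableOn v (Ioc a b)) (hyc : ContinuousOn y (Icc a b))
    (hy : ∀ s ∈ Icc a b, y s = x + ∫ τ in a..s, (A (y τ) + B (v τ))) {s : ℝ}
    (hs : s ∈ Icc a b) : ‖y s‖ ≤ 2 * Real.exp ((‖A‖ + 1) * (b - a)) *
      (‖x‖ + ‖B‖ * ∫ τ in a..b, ‖v τ‖) := by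
  have hab : a ≤ b := hs.1.trans hs.2
  set k := ‖A‖ + 1 with hk
  have hk0 : 0 < k := by positivity
  set β := ‖B‖ * ∫ τ in a..b, ‖v τ‖ with hβ
  have hβ0 : 0 ≤ β := mul_nonneg (norm_nonneg _)
    (intervalIntegral.integral_nonneg hab fun _ _ => norm_nonneg _)
  have cA : ContinuousOn (fun τ => A (y τ)) (Icc a b) := A.continuous.comp_continuousOn hyc
  set f : ℝ → K := fun r => x + ∫ τ in a..r, A (y τ) with hf
  have hd : ∀ r ∈ Icc a b, HasDerivWithinAt f (A (y r)) (Icc a b) r := fun r hr =>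
    hasDerivWithinAt_primitive cA hr x
  have hvi : ∀ r ∈ Icc a b, IntervalIntegrable v volume a r := fun r hr =>
    (intervalIntegrable_iff_integrableOn_Ioc_of_le hr.1).2
      (hv.mono_set (Ioc_subset_Ioc_right hr.2))
  have hsplit : ∀ r ∈ Icc a b, y r = f r + B (∫ τ in a..r, v τ) := by
    intro r hr
    have iA : IntervalIntegrable (fun τ => A (y τ)) volume a r :=
      (cA.mono (Icc_subset_Icc_right hr.2)).intervalIntegrable_of_Icc hr.1
    have iB : IntervalIntegrable (fun τ => B (v τ)) volume a r :=
      ⟨B.integrable_comp (hvi r hr).1, B.integrable_comp (hvi r hr).2⟩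
    rw [hy r hr, intervalIntegral.integral_add iA iB, ← add_assoc,
      B.intervalIntegral_comp_comm (hvi r hr)]
  have hBv : ∀ r ∈ Icc a b, ‖B (∫ τ in a..r, v τ)‖ ≤ β := by
    intro r hr
    refine (B.le_opNorm _).trans (mul_le_mul_of_nonneg_left ?_ (norm_nonneg _))
    refine (intervalIntegral.norm_integral_le_integral_norm hr.1).trans ?_
    refine intervalIntegral.integral_mono_interval le_rfl hr.1 hr.2
      (Filter.Eventually.of_forall fun _ => norm_nonneg _) ?_
    exact (hvi b (right_mem_Icc.2 hab)).norm
  have hyf : ∀ r ∈ Icc a b, ‖y r‖ ≤ ‖f r‖ + β := fun r hr => by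
    rw [hsplit r hr]
    exact (norm_add_le _ _).trans (by linarith [hBv r hr])
  have key := norm_le_gronwallBound_of_norm_deriv_right_le (f := f) (f' := fun r => A (y r))
    (δ := ‖x‖) (K := k) (ε := k * β) (fun r hr => (hd r hr).continuousWithinAt)
    (fun r hr => ((hd r (Ico_subset_Icc_self hr)).mono_of_mem_nhdsWithin
      (Icc_mem_nhdsGE_of_mem hr))) (by simp [hf]) (fun r hr => by
      have h1 := hyf r (Ico_subset_Icc_self hr)
      calc ‖A (y r)‖ ≤ ‖A‖ * ‖y r‖ := A.le_opNorm _
        _ ≤ k * ‖y r‖ := mul_le_mul_of_nonneg_right (by linarith) (norm_nonneg _)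
        _ ≤ k * (‖f r‖ + β) := mul_le_mul_of_nonneg_left h1 hk0.le
        _ = k * ‖f r‖ + k * β := by ring) s hs
  rw [gronwallBound_of_K_ne_0 hk0.ne', mul_div_cancel_left₀ _ hk0.ne'] at key
  have h1 := hyf s hs
  have h2 : Real.exp (k * (s - a)) ≤ Real.exp (k * (b - a)) :=
    Real.exp_le_exp.2 (mul_le_mul_of_nonneg_left (by linarith [hs.2]) hk0.le)
  have h3 : 1 ≤ Real.exp (k * (b - a)) := Real.one_le_exp (by
    have := sub_nonneg.2 hab; positivity)
  have h4 : ‖x‖ * Real.exp (k * (s - a)) ≤ ‖x‖ * Real.exp (k * (b - a)) :=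
    mul_le_mul_of_nonneg_left h2 (norm_nonneg _)
  have h5 : β * Real.exp (k * (s - a)) ≤ β * Real.exp (k * (b - a)) :=
    mul_le_mul_of_nonneg_left h2 hβ0
  have h6 : β ≤ β * Real.exp (k * (b - a)) := le_mul_of_one_le_right hβ0 h3
  have h7 : 0 ≤ ‖x‖ * Real.exp (k * (b - a)) := by positivity
  dsimp only at key
  linarith

variable {Q : ConvexControl (E n)} {P : ControlData n} {m : P2 n} {t : ℝ}
  {v y : ℝ → E n → E n}

lemma ae_memLp_of_memLp_prod {ρ : Measure ℝ} [SFinite ρ]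
    (hv : MemLp (Function.uncurry v) 2 (ρ.prod m.toMeasure)) :
    ∀ᵐ x ∂m.toMeasure, MemLp (fun s => v s x) 2 ρ := by
  have h1 := (memLp_two_iff_integrable_sq_norm hv.1).1 hv
  filter_upwards [h1.prod_left_ae, hv.1.prod_swap.prodMk_left] with x h2 h3
  exact (memLp_two_iff_integrable_sq_norm h3).2 h2

end Fubini

/-! ### The mean field type problem as an integral of control problems -/

section MeanField

open ControlData ConvexControl

variable {n : ℕ} {Q : ConvexControl (E n)} {P : ControlData n} {m : P2 n} {t : ℝ}
  {v y : ℝ → E n → E n}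

lemma memLp_of_lipschitzWith {g : E n → E n} {L : ℝ≥0} (hg : LipschitzWith L g) :
    MemLp g 2 m.toMeasure :=
  memLp_comp_of_lipschitzWith hg ((memLp_two_iff_integrable_sq_norm (by fun_prop)).2
    m.sq_integrable : MemLp (fun x : E n => x) 2 m.toMeasure)

lemma LipPath.memLp_uncurry {φ : ℝ → E n → E n} (h : LipPath φ) (a b : ℝ) :
    MemLp (Function.uncurry φ) 2 ((volume.restrict (Ioc a b)).prod m.toMeasure) := by
  obtain ⟨C, hC⟩ := h.growth
  have hi : Integrable (fun x : E n => 2 * C ^ 2 * (1 + ‖x‖ ^ 2)) m.toMeasure :=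
    ((integrable_const (1 : ℝ)).add m.sq_integrable).const_mul _
  refine (memLp_two_iff_integrable_sq_norm h.cont.aestronglyMeasurable).2
    ((hi.comp_snd _).mono' (h.cont.norm.pow 2).aestronglyMeasurable
      (Filter.Eventually.of_forall fun p => ?_))
  rw [Real.norm_of_nonneg (sq_nonneg _)]
  have h1 := pow_le_pow_left₀ (norm_nonneg _) (hC p.1 p.2) 2
  refine h1.trans ?_
  nlinarith [mul_nonneg (sq_nonneg C) (sq_nonneg (1 - ‖p.2‖))]

namespace Represents

lemma isControl_iff (h : Represents Q P) : P.IsControl m t v ↔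
    MemLp (Function.uncurry v) 2 ((volume.restrict (Ioc t Q.T)).prod m.toMeasure) := by
  rw [IsControl, h.T]

lemma isState_iff (h : Represents Q P) : P.IsState m t v y ↔
    (∀ s ∈ Icc t Q.T, MemLp (y s) 2 m.toMeasure) ∧
    ∀ᵐ x ∂m.toMeasure, ContinuousOn (fun s => y s x) (Icc t Q.T) ∧
      ∀ s ∈ Icc t Q.T, y s x = x + ∫ τ in t..s, (Q.A (y τ x) + Q.B (v τ x)) := by
  rw [h.T, h.A, h.B]
  exact ⟨fun h => ⟨h.1, h.2⟩, fun h => ⟨h.1, h.2⟩⟩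

/-- States are square integrable in time and space, by Grönwall's inequality. -/
lemma memLp_state (h : Represents Q P) (ht : t ≤ Q.T) (hv : P.IsControl m t v)
    (hy : P.IsState m t v y) :
    MemLp (Function.uncurry y) 2 ((volume.restrict (Ioc t Q.T)).prod m.toMeasure) := by
  rw [h.isControl_iff] at hv
  obtain ⟨hm, hy⟩ := h.isState_iff.1 hy
  have hym := aestronglyMeasurable_uncurry_of_ae_continuousOn ht (fun s hs => (hm s hs).1)
    (hy.mono fun x hx => hx.1)
  set e := 2 * Real.exp ((‖Q.A‖ + 1) * (Q.T - t)) with he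
  have hvi := ((memLp_two_iff_integrable_sq_norm hv.1).1 hv).integral_prod_right
  have hb : Integrable (fun x => 2 * e ^ 2 * (‖x‖ ^ 2 + ‖Q.B‖ ^ 2 * ((Q.T - t) *
      ∫ s in Ioc t Q.T, ‖v s x‖ ^ 2))) m.toMeasure :=
    (m.sq_integrable.add ((hvi.const_mul _).const_mul _)).const_mul _
  refine (memLp_two_iff_integrable_sq_norm hym).2 ((hb.comp_snd _).mono' (hym.norm.pow 2) ?_)
  filter_upwards [Measure.quasiMeasurePreserving_snd.ae hy, Measure.quasiMeasurePreserving_snd.ae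
    (ae_memLp_of_memLp_prod hv), Measure.quasiMeasurePreserving_fst.ae
    (ae_restrict_mem measurableSet_Ioc)] with p h1 h2 h3
  have h4 := norm_state_le Q.A Q.B (h2.integrable one_le_two) h1.1 h1.2 (Ioc_subset_Icc_self h3)
  have h5 := sq_integral_le ht
    ((intervalIntegrable_iff_integrableOn_Ioc_of_le ht).2 (h2.integrable one_le_two).norm)
    ((intervalIntegrable_iff_integrableOn_Ioc_of_le ht).2
      ((memLp_two_iff_integrable_sq_norm h2.1).1 h2))
  rw [← intervalIntegral.integral_of_le ht, Real.norm_of_nonneg (sq_nonneg _)]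
  set I := ∫ s in t..Q.T, ‖v s p.2‖
  have h6 := pow_le_pow_left₀ (norm_nonneg _) h4 2
  refine h6.trans ?_
  have h7 : (‖p.2‖ + ‖Q.B‖ * I) ^ 2 ≤ 2 * (‖p.2‖ ^ 2 + ‖Q.B‖ ^ 2 * I ^ 2) := by
    nlinarith [sq_nonneg (‖p.2‖ - ‖Q.B‖ * I)]
  calc (e * (‖p.2‖ + ‖Q.B‖ * I)) ^ 2 = e ^ 2 * (‖p.2‖ + ‖Q.B‖ * I) ^ 2 := by ring
    _ ≤ e ^ 2 * (2 * (‖p.2‖ ^ 2 + ‖Q.B‖ ^ 2 * I ^ 2)) :=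
        mul_le_mul_of_nonneg_left h7 (sq_nonneg _)
    _ ≤ e ^ 2 * (2 * (‖p.2‖ ^ 2 + ‖Q.B‖ ^ 2 * ((Q.T - t) * ∫ s in t..Q.T, ‖v s p.2‖ ^ 2))) := by
        gcongr
    _ = _ := by ring

lemma F_push (h : Represents Q P) {X : E n → E n} (hX : MemLp X 2 m.toMeasure) :
    P.F (push m X) = ∫ x, Q.l (X x) ∂m.toMeasure := by
  rw [h.F, integral_push hX Q.continuous_l]

lemma FT_push (h : Represents Q P) {X : E n → E n} (hX : MemLp X 2 m.toMeasure) :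
    P.FT (push m X) = ∫ x, Q.lT (X x) ∂m.toMeasure := by
  rw [h.FT, integral_push hX Q.continuous_lT]

/-- The cost is the integral over the starting points of the costs on `ℝⁿ`. -/
lemma cost_eq (h : Represents Q P) (ht : t ≤ Q.T) (hv : P.IsControl m t v)
    (hy : P.IsState m t v y) :
    Integrable (fun x => Q.trackCost t (fun s => v s x) fun s => y s x) m.toMeasure ∧
      P.cost m t v y = ∫ x, Q.trackCost t (fun s => v s x) (fun s => y s x) ∂m.toMeasure := by
  have hyL := h.memLp_state ht hv hy
  rw [h.isControl_iff] at hv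
  obtain ⟨hm, hy⟩ := h.isState_iff.1 hy
  have hl := quadLip_l Q
  have i1 : Integrable (fun p : ℝ × E n => Q.l (y p.1 p.2))
      ((volume.restrict (Ioc t Q.T)).prod m.toMeasure) :=
    (((integrable_const (1 : ℝ)).add
      ((memLp_two_iff_integrable_sq_norm hyL.1).1 hyL)).const_mul _).mono'
      (hl.cont.comp_aestronglyMeasurable hyL.1)
      (Filter.Eventually.of_forall fun p => hl.growth (y p.1 p.2))
  have i2 : Integrable (fun p : ℝ × E n => ⟪v p.1 p.2, Q.N (v p.1 p.2)⟫_ℝ)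
      ((volume.restrict (Ioc t Q.T)).prod m.toMeasure) :=
    integrable_inner_of_memLp_two hv (Q.N.comp_memLp' hv)
  have hT := right_mem_Icc.2 ht
  have i3 : Integrable (fun x => Q.lT (y Q.T x)) m.toMeasure :=
    (((integrable_const (1 : ℝ)).add
      ((memLp_two_iff_integrable_sq_norm (hm _ hT).1).1 (hm _ hT))).const_mul _).mono'
      ((quadLip_lT Q).cont.comp_aestronglyMeasurable (hm _ hT).1)
      (Filter.Eventually.of_forall fun x => (quadLip_lT Q).growth (y Q.T x))
  have j1 : Integrable (fun x => ∫ s in t..Q.T, Q.l (y s x)) m.toMeasure := by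
    simp_rw [intervalIntegral.integral_of_le ht]
    exact i1.integral_prod_right
  have j2 : Integrable (fun x => ∫ s in t..Q.T, ⟪v s x, Q.N (v s x)⟫_ℝ) m.toMeasure := by
    simp_rw [intervalIntegral.integral_of_le ht]
    exact i2.integral_prod_right
  have j3 : Integrable (fun x => (∫ s in t..Q.T, Q.l (y s x)) + Q.lT (y Q.T x)) m.toMeasure :=
    j1.add i3
  refine ⟨j3.add (j2.const_mul _), ?_⟩
  simp only [trackCost]
  rw [integral_add j3 (j2.const_mul _), integral_add j1 i3, integral_const_mul]
  simp_rw [intervalIntegral.integral_of_le ht]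
  rw [← integral_integral_swap (f := fun s x => Q.l (y s x)) i1,
    ← integral_integral_swap (f := fun s x => ⟪v s x, Q.N (v s x)⟫_ℝ) i2, cost, ← h.T, ← h.N,
    h.FT_push (hm _ hT), intervalIntegral.integral_of_le ht, intervalIntegral.integral_of_le ht]
  congr 2
  exact setIntegral_congr_fun measurableSet_Ioc fun s hs => h.F_push (hm s (Ioc_subset_Icc_self hs))

/-- The cost exceeds the integral of the value functions on `ℝⁿ` by at least the squared distance
to the optimal control. -/
lemma integral_val_add_le_cost (h : Represents Q P) (ht : t ∈ Icc 0 Q.T)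
    (hv : P.IsControl m t v) (hy : P.IsState m t v y) :
    (∫ x, Q.val t x ∂m.toMeasure) + Q.c / 2 * ∫ p, ‖v p.1 p.2 -
      Q.feedback (Q.costate t p.2 (clamp t Q.T p.1))‖ ^ 2
        ∂((volume.restrict (Ioc t Q.T)).prod m.toMeasure) ≤ P.cost m t v y := by
  obtain ⟨hi, hc⟩ := h.cost_eq ht.2 hv hy
  rw [h.isControl_iff] at hv
  obtain ⟨hm, hy⟩ := h.isState_iff.1 hy
  have hf : LipschitzWith ‖-(Q.Ninv ∘L Q.Bs)‖₊ Q.feedback :=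
    (-(Q.Ninv ∘L Q.Bs)).lipschitz
  have hw : MemLp (fun p : ℝ × E n => v p.1 p.2 -
      Q.feedback (Q.costate t p.2 (clamp t Q.T p.1))) 2
      ((volume.restrict (Ioc t Q.T)).prod m.toMeasure) :=
    hv.sub (((lipPath_costate ht).comp hf).memLp_uncurry t Q.T)
  have hwi := (memLp_two_iff_integrable_sq_norm hw.1).1 hw
  have hvi := (quadLip_val ht).integrable m
  rw [integral_prod_symm _ hwi, ← integral_const_mul, ← integral_add hvi
    (hwi.integral_prod_right.const_mul _), hc]
  refine integral_mono_ae (hvi.add (hwi.integral_prod_right.const_mul _)) hi ?_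
  filter_upwards [hy, ae_memLp_of_memLp_prod hv] with x h1 h2
  refine le_trans (le_of_eq ?_) (Q.val_add_le_trackCost ht x h2 h1.1 h1.2)
  rw [intervalIntegral.integral_of_le ht.2]
  congr 2
  refine setIntegral_congr_fun measurableSet_Ioc fun s hs => ?_
  simp only [clamp_of_mem (Ioc_subset_Icc_self hs)]

end Represents

end MeanField

/-! ### The optimal control and the value function on the space of measures -/

section MeanFieldSolution

open ControlData ConvexControl

variable {n : ℕ} {Q : ConvexControl (E n)} {P : ControlData n} {m : P2 n} {t : ℝ}
  {v y : ℝ → E n → E n}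

namespace Represents

lemma isFBODE (h : Represents Q P) (ht : t ∈ Icc 0 Q.T) :
    P.IsFBODE m t (fun s x => Q.state t x (clamp t Q.T s))
      fun s x => Q.costate t x (clamp t Q.T s) := by
  have hT := right_mem_Icc.2 ht.2
  constructor
  · exact fun s _ => memLp_of_lipschitzWith (lipschitz_state ht (clamp_mem ht s))
  · exact fun x => ((continuous_state ht x).comp (continuous_clamp t Q.T)).continuousOn
  · exact fun x => ((continuous_costate ht x).comp (continuous_clamp t Q.T)).continuousOn
  · intro x s hs
    rw [← h.T] at hs
    rw [clamp_of_mem hs, (isSol ht x).eqY s hs, h.A, h.S]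
    congr 1
    refine intervalIntegral.integral_congr fun τ hτ => ?_
    rw [uIcc_of_le hs.1] at hτ
    simp only [clamp_of_mem (show τ ∈ Icc t Q.T from ⟨hτ.1, hτ.2.trans hs.2⟩)]
  · intro x s hs
    rw [← h.T] at hs ⊢
    simp only [h.Ddm_F, h.Ddm_FT]
    rw [clamp_of_mem hs, (isSol ht x).eqZ s hs, h.As, clamp_of_mem hT]
    congr 1
    refine intervalIntegral.integral_congr fun τ hτ => ?_
    rw [uIcc_of_le hs.2] at hτ
    simp only [clamp_of_mem (show τ ∈ Icc t Q.T from ⟨hs.1.trans hτ.1, hτ.2⟩)]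

lemma isControl_opt (h : Represents Q P) (ht : t ∈ Icc 0 Q.T) :
    P.IsControl m t fun s x => Q.feedback (Q.costate t x (clamp t Q.T s)) :=
  h.isControl_iff.2 (((lipPath_costate ht).comp (k := Q.feedback)
    (-(Q.Ninv ∘L Q.Bs)).lipschitz).memLp_uncurry t Q.T)

lemma isState_opt (h : Represents Q P) (ht : t ∈ Icc 0 Q.T) :
    P.IsState m t (fun s x => Q.feedback (Q.costate t x (clamp t Q.T s)))
      fun s x => Q.state t x (clamp t Q.T s) := by
  refine h.isState_iff.2 ⟨fun s _ => memLp_of_lipschitzWith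
    (lipschitz_state ht (clamp_mem ht s)), Filter.Eventually.of_forall fun x =>
    ⟨((continuous_state ht x).comp (continuous_clamp t Q.T)).continuousOn, fun s hs => ?_⟩⟩
  rw [clamp_of_mem hs, Q.isState_opt ht x hs]
  congr 1
  refine intervalIntegral.integral_congr fun τ hτ => ?_
  rw [uIcc_of_le hs.1] at hτ
  simp only [clamp_of_mem (show τ ∈ Icc t Q.T from ⟨hτ.1, hτ.2.trans hs.2⟩)]

lemma cost_opt (h : Represents Q P) (ht : t ∈ Icc 0 Q.T) :
    P.cost m t (fun s x => Q.feedback (Q.costate t x (clamp t Q.T s)))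
      (fun s x => Q.state t x (clamp t Q.T s)) = ∫ x, Q.val t x ∂m.toMeasure := by
  rw [(h.cost_eq ht.2 (h.isControl_opt ht) (h.isState_opt ht)).2]
  refine integral_congr_ae (Filter.Eventually.of_forall fun x => ?_)
  simp only
  rw [← Q.trackCost_opt ht x, trackCost, trackCost, clamp_of_mem (right_mem_Icc.2 ht.2)]
  congr 2
  · refine intervalIntegral.integral_congr fun τ hτ => ?_
    rw [uIcc_of_le ht.2] at hτ
    simp only [clamp_of_mem hτ]
  · refine intervalIntegral.integral_congr fun τ hτ => ?_
    rw [uIcc_of_le ht.2] at hτ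
    simp only [clamp_of_mem hτ]

lemma integral_val_le_cost (h : Represents Q P) (ht : t ∈ Icc 0 Q.T)
    (hv : P.IsControl m t v) (hy : P.IsState m t v y) :
    ∫ x, Q.val t x ∂m.toMeasure ≤ P.cost m t v y := by
  refine le_trans (le_add_of_nonneg_right (mul_nonneg (by linarith [Q.c_pos]) ?_))
    (h.integral_val_add_le_cost ht hv hy)
  exact integral_nonneg fun _ => sq_nonneg _

/-- The value function of the mean field type problem is linear in the measure. -/
lemma V_eq (h : Represents Q P) (ht : t ∈ Icc 0 Q.T) (m : P2 n) :
    P.V m t = ∫ x, Q.val t x ∂m.toMeasure := by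
  refine le_antisymm (csInf_le ⟨∫ x, Q.val t x ∂m.toMeasure, ?_⟩
    ⟨_, _, h.isControl_opt ht, h.isState_opt ht, (h.cost_opt ht).symm⟩)
    (le_csInf ⟨_, _, _, h.isControl_opt ht, h.isState_opt ht, rfl⟩ ?_)
  · rintro c ⟨v, y, hv, hy, rfl⟩
    exact h.integral_val_le_cost ht hv hy
  · rintro c ⟨v, y, hv, hy, rfl⟩
    exact h.integral_val_le_cost ht hv hy

lemma isOptimal_opt (h : Represents Q P) (ht : t ∈ Icc 0 Q.T) :
    P.IsOptimal m t fun s x => Q.feedback (Q.costate t x (clamp t Q.T s)) := by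
  refine ⟨h.isControl_opt ht, _, h.isState_opt ht, fun v' y' hv' hy' => ?_⟩
  rw [h.cost_opt ht]
  exact h.integral_val_le_cost ht hv' hy'

lemma eq_of_isOptimal (h : Represents Q P) (ht : t ∈ Icc 0 Q.T) (hv : P.IsOptimal m t v) :
    ∀ᵐ p ∂((volume.restrict (Ioc t Q.T)).prod m.toMeasure),
      v p.1 p.2 = Q.feedback (Q.costate t p.2 (clamp t Q.T p.1)) := by
  obtain ⟨hv, y, hy, hopt⟩ := hv
  have h1 := hopt _ _ (h.isControl_opt ht) (h.isState_opt ht)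
  rw [h.cost_opt ht] at h1
  have h2 := h.integral_val_add_le_cost ht hv hy
  have hw : MemLp (fun p : ℝ × E n => v p.1 p.2 -
      Q.feedback (Q.costate t p.2 (clamp t Q.T p.1))) 2
      ((volume.restrict (Ioc t Q.T)).prod m.toMeasure) :=
    (h.isControl_iff.1 hv).sub (h.isControl_iff.1 (h.isControl_opt ht))
  have hwi := (memLp_two_iff_integrable_sq_norm hw.1).1 hw
  set I := ∫ p, ‖v p.1 p.2 - Q.feedback (Q.costate t p.2 (clamp t Q.T p.1))‖ ^ 2
        ∂((volume.restrict (Ioc t Q.T)).prod m.toMeasure) with hI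
  have h3 : I = 0 := by
    have h0 : 0 ≤ I := integral_nonneg fun _ => sq_nonneg _
    have h4 : Q.c / 2 * I ≤ 0 := by linarith
    have h5 := Q.c_pos
    nlinarith
  rw [hI, integral_eq_zero_iff_of_nonneg (fun _ => sq_nonneg _) hwi] at h3
  filter_upwards [h3] with p hp
  simpa [sub_eq_zero] using hp

lemma hasFunctionalDeriv_V (h : Represents Q P) (ht : t ∈ Icc 0 Q.T) :
    HasFunctionalDeriv (fun m => P.V m t) (functionalDeriv fun m => P.V m t) :=
  (quadLip_val ht).hasFunctionalDeriv_functionalDeriv (h.V_eq ht)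

lemma hasGradientAt_functionalDeriv_V (h : Represents Q P) (ht : t ∈ Icc 0 Q.T) (m : P2 n)
    (x : E n) : HasGradientAt (functionalDeriv (fun m => P.V m t) m) (Q.field t x) x :=
  (quadLip_val ht).hasGradientAt_functionalDeriv (h.V_eq ht) (Q.hasGradientAt_val ht) m x

lemma Ddm_V (h : Represents Q P) (ht : t ∈ Icc 0 Q.T) (m : P2 n) (x : E n) :
    Ddm (fun m => P.V m t) m x = Q.field t x :=
  (h.hasGradientAt_functionalDeriv_V ht m x).gradient

/-- The formula for `dV/dm` along the optimal trajectories: up to constants in `x`, it is the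
optimal cost of the problem on `ℝⁿ` started from `x`. -/
lemma exists_functionalDeriv_V (h : Represents Q P) (ht : t ∈ Icc 0 Q.T) (m : P2 n) :
    ∃ κ : ℝ, ∀ x, Q.val t x + κ =
      (∫ s in t..Q.T, functionalDeriv P.F (push m fun x => Q.state t x (clamp t Q.T s))
        (Q.state t x (clamp t Q.T s))) +
      functionalDeriv P.FT (push m fun x => Q.state t x (clamp t Q.T Q.T))
        (Q.state t x (clamp t Q.T Q.T)) +
      1 / 2 * ∫ s in t..Q.T, ⟪P.Ninv (P.Bstar (Q.costate t x (clamp t Q.T s))),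
        P.Bstar (Q.costate t x (clamp t Q.T s))⟫_ℝ := by
  have hl := quadLip_l Q
  have hlip : ∀ s, MemLp (fun x => Q.state t x (clamp t Q.T s)) 2 m.toMeasure := fun s =>
    memLp_of_lipschitzWith (lipschitz_state ht (clamp_mem ht s))
  have hY := (lipPath_state ht).memLp_uncurry (m := m) t Q.T
  have i1 : Integrable (fun p : ℝ × E n => Q.l (Q.state t p.2 (clamp t Q.T p.1)))
      ((volume.restrict (Ioc t Q.T)).prod m.toMeasure) :=
    (((integrable_const (1 : ℝ)).add
      ((memLp_two_iff_integrable_sq_norm hY.1).1 hY)).const_mul _).mono'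
      (hl.cont.comp_aestronglyMeasurable hY.1)
      (Filter.Eventually.of_forall fun p => hl.growth (Q.state t p.2 (clamp t Q.T p.1)))
  set a : ℝ → ℝ := fun s => ∫ x, Q.l (Q.state t x (clamp t Q.T s)) ∂m.toMeasure with ha
  have ia : IntervalIntegrable a volume t Q.T :=
    (intervalIntegrable_iff_integrableOn_Ioc_of_le ht.2).2 i1.integral_prod_left
  set b := ∫ x, Q.lT (Q.state t x (clamp t Q.T Q.T)) ∂m.toMeasure with hb
  refine ⟨-(∫ s in t..Q.T, a s) - b, fun x => ?_⟩
  have cY := (continuous_state ht x).comp (continuous_clamp t Q.T)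
  have cZ := (continuous_costate ht x).comp (continuous_clamp t Q.T)
  have e1 : ∀ s, functionalDeriv P.F (push m fun x => Q.state t x (clamp t Q.T s))
      (Q.state t x (clamp t Q.T s)) = Q.l (Q.state t x (clamp t Q.T s)) - a s := fun s => by
    rw [hl.functionalDeriv_eq h.F]
    dsimp only
    rw [integral_push (hlip s) hl.cont]
  have e2 : functionalDeriv P.FT (push m fun x => Q.state t x (clamp t Q.T Q.T))
      (Q.state t x (clamp t Q.T Q.T)) = Q.lT (Q.state t x (clamp t Q.T Q.T)) - b := by
    rw [(quadLip_lT Q).functionalDeriv_eq h.FT]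
    dsimp only
    rw [integral_push (hlip _) (quadLip_lT Q).cont]
  have e3 : ∀ z, ⟪P.Ninv (P.Bstar z), P.Bstar z⟫_ℝ = ⟪z, Q.S z⟫_ℝ := fun z => by
    rw [← h.Ninv, ← h.Bs, real_inner_comm, inner_Bs_left, S_apply]
  have i2 : IntervalIntegrable (fun s => Q.l (Q.state t x (clamp t Q.T s))) volume t Q.T :=
    (Q.continuous_l.comp cY).intervalIntegrable _ _
  have i3 : IntervalIntegrable (fun s => 1 / 2 * ⟪Q.costate t x (clamp t Q.T s),
      Q.S (Q.costate t x (clamp t Q.T s))⟫_ℝ) volume t Q.T :=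
    (continuous_const.mul (cZ.inner (Q.S.continuous.comp cZ))).intervalIntegrable _ _
  simp_rw [e1, e2, e3]
  rw [intervalIntegral.integral_sub i2 ia, val_eq]
  have e4 : ∫ s in t..Q.T, Q.lag (Q.state t x s) (Q.costate t x s) =
      (∫ s in t..Q.T, Q.l (Q.state t x (clamp t Q.T s))) + 1 / 2 * ∫ s in t..Q.T,
        ⟪Q.costate t x (clamp t Q.T s), Q.S (Q.costate t x (clamp t Q.T s))⟫_ℝ := by
    rw [← intervalIntegral.integral_const_mul, ← intervalIntegral.integral_add i2 i3]
    refine intervalIntegral.integral_congr fun τ hτ => ?_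
    rw [uIcc_of_le ht.2] at hτ
    simp only [clamp_of_mem hτ, lag]
  rw [e4, clamp_of_mem (right_mem_Icc.2 ht.2)]
  ring

/-- Solution of the mean field type control problem on `ℝⁿ`; the forward-backward system, the optimal
control and the derivatives of `V` are all read off from the optimal flow of `Q`. -/
lemma exists_optimal (h : Represents Q P) (m : P2 n) (ht : t ∈ Icc 0 P.T) :
    ∃ Y Z : ℝ → E n → E n,
      P.IsFBODE m t Y Z ∧
      (∀ Y' Z', P.IsFBODE m t Y' Z' →
        ∀ s ∈ Icc t P.T, ∀ x, Y' s x = Y s x ∧ Z' s x = Z s x) ∧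
      P.IsOptimal m t (fun s x => -P.Ninv (P.Bstar (Z s x))) ∧
      P.IsState m t (fun s x => -P.Ninv (P.Bstar (Z s x))) Y ∧
      (∀ v, P.IsOptimal m t v → ∀ᵐ p ∂((volume.restrict (Ioc t P.T)).prod m.toMeasure),
        v p.1 p.2 = -P.Ninv (P.Bstar (Z p.1 p.2))) ∧
      P.V m t = P.cost m t (fun s x => -P.Ninv (P.Bstar (Z s x))) Y ∧
      (∃ g : E n → ℝ,
        (∀ x, g x =
          (∫ s in t..P.T, functionalDeriv P.F (push m (Y s)) (Y s x)) +
          functionalDeriv P.FT (push m (Y P.T)) (Y P.T x) +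
          1 / 2 * ∫ s in t..P.T, ⟪P.Ninv (P.Bstar (Z s x)), P.Bstar (Z s x)⟫_ℝ) ∧
        Integrable g m.toMeasure ∧
        ∀ x, functionalDeriv (fun m' => P.V m' t) m x = g x - ∫ ξ, g ξ ∂m.toMeasure) ∧
      (∀ x, Ddm (fun m' => P.V m' t) m x = Z t x) ∧
      (∀ s ∈ Icc t P.T, ∀ x,
        Z s x = Ddm (fun m' => P.V m' s) (push m (Y s)) (Y s x)) := by
  rw [← h.T] at ht ⊢
  simp only [← h.feedback]
  refine ⟨fun s x => Q.state t x (clamp t Q.T s), fun s x => Q.costate t x (clamp t Q.T s),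
    h.isFBODE ht, fun Y' Z' h' s hs x => ?_, h.isOptimal_opt ht, h.isState_opt ht,
    fun v hv => h.eq_of_isOptimal ht hv, (h.V_eq ht m).trans (h.cost_opt ht).symm, ?_,
    fun x => ?_, fun s hs x => ?_⟩
  · simp only [clamp_of_mem hs]
    exact (isSol ht x).unique ht (h.isSol_of_isFBODE h' x) hs
  · obtain ⟨κ, hκ⟩ := h.exists_functionalDeriv_V ht m
    have hi := (quadLip_val ht).integrable m
    refine ⟨fun x => Q.val t x + κ, hκ, hi.add (integrable_const κ), fun x => ?_⟩
    rw [(quadLip_val ht).functionalDeriv_eq (h.V_eq ht),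
      integral_add hi (integrable_const κ)]
    simp
  · rw [h.Ddm_V ht]
    dsimp only
    rw [clamp_of_mem (left_mem_Icc.2 ht.2)]
    rfl
  · rw [h.Ddm_V ⟨ht.1.trans hs.1, hs.2⟩]
    dsimp only
    rw [clamp_of_mem hs]
    exact costate_eq_field ht hs x

end Represents

end MeanFieldSolution

/-! ### The lifted problem and the Bellman equations -/

section LiftedProblem

open ControlData ConvexControl

variable {n : ℕ} {Q : ConvexControl (E n)} {P : ControlData n} {m : P2 n} {t : ℝ}

namespace Represents

lemma ext_F (h : Represents Q P) (m : P2 n) : ext m P.F = (Q.lifted m).l :=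
  funext fun X => h.F_push (Lp.memLp X)

lemma ext_FT (h : Represents Q P) (m : P2 n) : ext m P.FT = (Q.lifted m).lT :=
  funext fun X => h.FT_push (Lp.memLp X)

lemma gradient_ext_F (h : Represents Q P) (X : H m) :
    gradient (ext m P.F) X = (Q.lifted m).g X := by
  rw [h.ext_F]; exact ((Q.lifted m).hasGradientAt_l X).gradient

lemma gradient_ext_FT (h : Represents Q P) (X : H m) :
    gradient (ext m P.FT) X = (Q.lifted m).gT X := by
  rw [h.ext_FT]; exact ((Q.lifted m).hasGradientAt_lT X).gradient

lemma V_push (h : Represents Q P) (ht : t ∈ Icc 0 Q.T) (X : H m) :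
    P.V (push m X) t = (Q.lifted m).val t X := by
  rw [h.V_eq ht, integral_push (Lp.memLp X) (quadLip_val ht).cont, lifted_val ht]

lemma ext_V (h : Represents Q P) (ht : t ∈ Icc 0 Q.T) (m : P2 n) :
    (ext m fun m' => P.V m' t) = (Q.lifted m).val t :=
  funext fun X => h.V_push ht X

lemma lifted_As (h : Represents Q P) : (Q.lifted m).As = lift m P.Astar := by
  rw [MFTC.lifted_As, h.As]

lemma lifted_S (h : Represents Q P) : (Q.lifted m).S = lift m P.S := by
  rw [MFTC.lifted_S, h.S]

lemma lifted_feedback (h : Represents Q P) (Z : H m) :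
    (Q.lifted m).feedback Z = -lift m P.Ninv (lift m P.Bstar Z) := by
  rw [ConvexControl.feedback, lifted_Bs, h.Bs, ← h.Ninv]
  rfl

lemma isLiftedFBODE_iff (h : Represents Q P) {X : H m} {Y Z : ℝ → H m} :
    P.IsLiftedFBODE m X t Y Z ↔ (Q.lifted m).IsSol t X Y Z := by
  have hA : (Q.lifted m).A = lift m P.A := by rw [← h.A]; rfl
  have hT : (Q.lifted m).T = P.T := h.T
  constructor
  · rintro ⟨h1, h2, h3, h4⟩
    simp only [h.gradient_ext_F, h.gradient_ext_FT] at h4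
    rw [← hT] at h1 h2 h3 h4
    rw [← hA, ← h.lifted_S] at h3
    rw [← h.lifted_As] at h4
    exact ⟨h1, h2, h3, h4⟩
  · rintro ⟨h1, h2, h3, h4⟩
    rw [hT] at h1 h2 h3 h4
    rw [hA, h.lifted_S] at h3
    rw [h.lifted_As] at h4
    refine ⟨h1, h2, h3, ?_⟩
    simp only [h.gradient_ext_F, h.gradient_ext_FT]
    exact h4

lemma liftedCost_eq (h : Represents Q P) (v Y : ℝ → H m) :
    P.liftedCost m t v Y = (Q.lifted m).trackCost t v Y := by
  have hT : (Q.lifted m).T = P.T := h.T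
  have hN : (Q.lifted m).N = lift m P.Nmat := by rw [← h.N]; rfl
  rw [liftedCost, trackCost, h.ext_F, h.ext_FT, hT, hN]

lemma isLiftedState_iff (h : Represents Q P) {X : H m} {v Y : ℝ → H m} :
    P.IsLiftedState m X t v Y ↔ ContinuousOn Y (Icc t Q.T) ∧ ∀ s ∈ Icc t Q.T,
      Y s = X + ∫ τ in t..s, ((Q.lifted m).A (Y τ) + (Q.lifted m).B (v τ)) := by
  have hA : (Q.lifted m).A = lift m P.A := by rw [← h.A]; rfl
  have hB : (Q.lifted m).B = lift m P.B := by rw [← h.B]; rfl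
  rw [IsLiftedState, hA, hB, h.T]

/-- The optimal control of the abstract problem on `L²_m` is a function of `X`, hence
`σ(X)`-measurable. -/
lemma isLiftedControl_opt (h : Represents Q P) (ht : t ∈ Icc 0 Q.T) (X : H m) :
    P.IsLiftedControl m X t fun s => (Q.lifted m).feedback ((Q.lifted m).costate t X s) := by
  rw [IsLiftedControl, ← h.T]
  refine ⟨memLp_Ioc_of_continuousOn ((Q.lifted m).continuous_feedback.comp
    (continuous_costate (Q := Q.lifted m) ht X)).continuousOn 2, ?_⟩
  filter_upwards [ae_restrict_mem measurableSet_Ioc] with s hs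
  have hs := Ioc_subset_Icc_self hs
  have hl := lipschitz_costate ht hs
  rw [lifted_costate ht hs, h.lifted_feedback, lift_superpose _ hl,
    lift_superpose _ (g := fun x => P.Bstar (Q.costate t x s)) (P.Bstar.lipschitz.comp hl)]
  refine Submodule.neg_mem _ (mem_lpMeas_iff_aestronglyMeasurable.2 ?_)
  have hk := P.Ninv.lipschitz.comp (P.Bstar.lipschitz.comp hl)
  refine ⟨fun ξ => P.Ninv (P.Bstar (Q.costate t (X ξ) s)), ?_, coeFn_superpose hk X⟩
  exact (hk.continuous.measurable.comp (comap_measurable X)).stronglyMeasurable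

/-- Solution of the problem lifted to `L²_m`, read off from the optimal flow of `Q.lifted m`. Its
optimal control is admissible, and competes against fewer controls than in `Q.lifted m`. -/
lemma exists_lifted_optimal (h : Represents Q P) (m : P2 n) (X : H m) (ht : t ∈ Icc 0 P.T) :
    ∃ Y Z : ℝ → H m,
      P.IsLiftedFBODE m X t Y Z ∧
      (∀ Y' Z', P.IsLiftedFBODE m X t Y' Z' → ∀ s ∈ Icc t P.T, Y' s = Y s ∧ Z' s = Z s) ∧
      P.IsLiftedOptimal m X t (fun s => -lift m P.Ninv (lift m P.Bstar (Z s))) ∧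
      P.IsLiftedState m X t (fun s => -lift m P.Ninv (lift m P.Bstar (Z s))) Y ∧
      (∀ v, P.IsLiftedOptimal m X t v → ∀ᵐ s ∂(volume.restrict (Ioc t P.T)),
        v s = -lift m P.Ninv (lift m P.Bstar (Z s))) ∧
      P.liftedV m X t = P.liftedCost m t (fun s => -lift m P.Ninv (lift m P.Bstar (Z s))) Y ∧
      P.liftedV m X t = P.V (push m X) t ∧
      (∀ s ∈ Icc t P.T, HasGradientAt (ext m fun m' => P.V m' s) (Z s) (Y s)) ∧
      HasGradientAt (ext m fun m' => P.V m' t) (Z t) X ∧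
      (∀ᵐ ξ ∂m.toMeasure,
        ((gradient (ext m fun m' => P.V m' t) X : H m) : E n → E n) ξ =
          Ddm (fun m' => P.V m' t) (push m X) ((X : E n → E n) ξ)) := by
  rw [← h.T] at ht ⊢
  simp only [← h.lifted_feedback]
  set R := Q.lifted m with hR
  have hctl := h.isLiftedControl_opt ht X
  have hst : P.IsLiftedState m X t (fun s => R.feedback (R.costate t X s)) (R.state t X) :=
    h.isLiftedState_iff.2 ⟨(continuous_state (Q := R) ht X).continuousOn,
      fun s hs => R.isState_opt ht X hs⟩
  have hcost : P.liftedCost m t (fun s => R.feedback (R.costate t X s)) (R.state t X) =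
      R.val t X := (h.liftedCost_eq _ _).trans (R.trackCost_opt ht X)
  have key : ∀ v Y, P.IsLiftedControl m X t v → P.IsLiftedState m X t v Y →
      R.val t X + R.c / 2 * ∫ s in t..R.T, ‖v s - R.feedback (R.costate t X s)‖ ^ 2 ≤
        P.liftedCost m t v Y := by
    intro v Y hv hY
    rw [h.liftedCost_eq]
    rw [h.isLiftedState_iff] at hY
    rw [IsLiftedControl, ← h.T] at hv
    exact R.val_add_le_trackCost ht X hv.1 hY.1 hY.2
  have hle : ∀ v Y, P.IsLiftedControl m X t v → P.IsLiftedState m X t v Y →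
      R.val t X ≤ P.liftedCost m t v Y := fun v Y hv hY =>
    (le_add_of_nonneg_right (mul_nonneg (div_nonneg R.c_pos.le zero_le_two)
      (intervalIntegral.integral_nonneg ht.2 fun s _ => sq_nonneg _))).trans (key v Y hv hY)
  have hval : P.liftedV m X t = R.val t X := by
    refine le_antisymm (csInf_le ⟨R.val t X, ?_⟩ ⟨_, _, hctl, hst, hcost.symm⟩)
      (le_csInf ⟨_, _, _, hctl, hst, rfl⟩ ?_)
    · rintro c ⟨v, y, hv, hy, rfl⟩
      exact hle v y hv hy
    · rintro c ⟨v, y, hv, hy, rfl⟩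
      exact hle v y hv hy
  refine ⟨R.state t X, R.costate t X, h.isLiftedFBODE_iff.2 (isSol (Q := R) ht X),
    fun Y' Z' h' s hs => IsSol.unique (Q := R) ht (isSol (Q := R) ht X) (h.isLiftedFBODE_iff.1 h') hs,
    ⟨hctl, _, hst, fun v' Y' hv' hY' => hcost.trans_le (hle v' Y' hv' hY')⟩, hst, ?_,
    hval.trans hcost.symm, hval.trans (h.V_push ht X).symm, fun s hs => ?_, ?_, ?_⟩
  · rintro v ⟨hv, Y, hY, hopt⟩
    have h1 := (hopt _ _ hctl hst).trans_eq hcost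
    have h2 := key v Y hv hY
    have hw : MemLp (fun s => v s - R.feedback (R.costate t X s)) 2
        (volume.restrict (Ioc t Q.T)) := by
      rw [IsLiftedControl, ← h.T] at hv hctl
      exact hv.1.sub hctl.1
    have hwi := (memLp_two_iff_integrable_sq_norm hw.1).1 hw
    rw [intervalIntegral.integral_of_le (show t ≤ R.T from ht.2)] at h2
    have h3 : ∫ s in Ioc t Q.T, ‖v s - R.feedback (R.costate t X s)‖ ^ 2 = 0 := by
      have h0 : 0 ≤ ∫ s in Ioc t Q.T, ‖v s - R.feedback (R.costate t X s)‖ ^ 2 :=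
        integral_nonneg fun _ => sq_nonneg _
      have h4 : R.c / 2 * ∫ s in Ioc t Q.T, ‖v s - R.feedback (R.costate t X s)‖ ^ 2 ≤ 0 := by
        change _ + _ * ∫ s in Ioc t Q.T, _ ≤ _ at h2
        linarith
      have h5 := R.c_pos
      nlinarith
    rw [integral_eq_zero_iff_of_nonneg (fun _ => sq_nonneg _) hwi] at h3
    filter_upwards [h3] with s hs
    simpa [sub_eq_zero] using hs
  · have hs' : s ∈ Icc 0 Q.T := ⟨ht.1.trans hs.1, hs.2⟩
    rw [h.ext_V hs', costate_eq_field (Q := R) ht hs]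
    exact R.hasGradientAt_val hs' _
  · rw [h.ext_V ht]
    exact R.hasGradientAt_val ht X
  · rw [h.ext_V ht, (R.hasGradientAt_val ht X).gradient, hR, lifted_field ht]
    filter_upwards [coeFn_superpose (lipschitz_field ht) X] with ξ hξ
    rw [hξ, h.Ddm_V ht]

lemma neg_ham (R : ConvexControl (H m)) (X Z : H m) :
    -R.ham X Z - ⟪Z, R.A X⟫_ℝ + 1 / 2 * ⟪Z, R.S Z⟫_ℝ = R.l X := by
  rw [ham]; ring

lemma isLiftedBellmanSolution (h : Represents Q P) (m : P2 n) :
    P.IsLiftedBellmanSolution m fun X t => P.V (push m X) t := by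
  set R := Q.lifted m with hR
  have hA : R.A = lift m P.A := by rw [← h.A]; rfl
  rw [IsLiftedBellmanSolution, ← h.T]
  refine ⟨fun X t => R.field t X, fun t ht X => ?_, ⟨R.κ, fun t ht => lipschitz_field (Q := R) ht⟩,
    fun X => R.continuousOn_field X, fun X t ht => ⟨R.ham X (R.field t X), ?_, ?_⟩, fun X => ?_⟩
  · have := h.ext_V ht m
    change HasGradientAt (ext m fun m' => P.V m' t) _ _
    rw [this]
    exact R.hasGradientAt_val ht X
  · exact (R.hasDerivWithinAt_val ht X).congr_of_mem (fun s hs => h.V_push hs X) ht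
  · rw [h.ext_F, ← hA, ← h.lifted_S]
    exact neg_ham R X _
  · rw [h.V_push (right_mem_Icc.2 Q.T_pos.le), h.ext_FT]
    exact R.val_terminal X

lemma eq_of_isLiftedBellmanSolution (h : Represents Q P) {W : H m → ℝ → ℝ}
    (hW : P.IsLiftedBellmanSolution m W) (X : H m) (ht : t ∈ Icc 0 P.T) :
    W X t = P.V (push m X) t := by
  have hA : (Q.lifted m).A = lift m P.A := by rw [← h.A]; rfl
  rw [IsLiftedBellmanSolution, ← h.T, h.ext_F, h.ext_FT, ← hA, ← h.lifted_S] at hW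
  rw [← h.T] at ht
  obtain ⟨G, h1, ⟨K, h2⟩, h3, h4, h5⟩ := hW
  rw [h.V_push ht]
  exact (Q.lifted m).bellman_unique h1 h2 h3 h4 h5 ht X

/-- The Bellman equation on the space of measures is the lifted one at the identity map. -/
lemma bellman (h : Represents Q P) (m : P2 n) (ht : t ∈ Icc 0 P.T) :
    Integrable (fun x => ⟪Ddm (fun m' => P.V m' t) m x, P.A x⟫_ℝ) m.toMeasure ∧
    Integrable (fun x => ⟪Ddm (fun m' => P.V m' t) m x,
      P.S (Ddm (fun m' => P.V m' t) m x)⟫_ℝ) m.toMeasure ∧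
    ∃ w : ℝ, HasDerivWithinAt (fun s => P.V m s) w (Icc 0 P.T) t ∧
      -w - (∫ x, ⟪Ddm (fun m' => P.V m' t) m x, P.A x⟫_ℝ ∂m.toMeasure) +
        1 / 2 * (∫ x, ⟪Ddm (fun m' => P.V m' t) m x,
          P.S (Ddm (fun m' => P.V m' t) m x)⟫_ℝ ∂m.toMeasure) = P.F m := by
  rw [← h.T] at ht ⊢
  simp only [h.Ddm_V ht]
  have hf : LipschitzWith Q.κ (Q.field t) := lipschitz_field ht
  have hid : MemLp (fun x : E n => x) 2 m.toMeasure := memLp_of_lipschitzWith LipschitzWith.id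
  set X : H m := hid.toLp with hX
  have hXx : X =ᵐ[m.toMeasure] fun x => x := hid.coeFn_toLp
  have hpush : push m X = m := by
    apply P2.ext_measure
    rw [push_toMeasure (Lp.memLp X), Measure.map_congr hXx]
    exact Measure.map_id
  set R := Q.lifted m with hR
  have hfield := coeFn_superpose hf X
  have hA : R.A = lift m P.A := by rw [← h.A]; rfl
  have e1 : (fun ξ => ⟪R.field t X ξ, R.A X ξ⟫_ℝ) =ᵐ[m.toMeasure]
      fun x => ⟪Q.field t x, P.A x⟫_ℝ := by
    rw [hR, lifted_field ht, ← hR, hA]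
    filter_upwards [hfield, coeFn_lift P.A X, hXx] with x h1 h2 h3
    rw [h1, h2, h3]
  have e2 : (fun ξ => ⟪R.field t X ξ, R.S (R.field t X) ξ⟫_ℝ) =ᵐ[m.toMeasure]
      fun x => ⟪Q.field t x, P.S (Q.field t x)⟫_ℝ := by
    rw [hR, lifted_field ht, h.lifted_S]
    filter_upwards [hfield, coeFn_lift P.S (superpose m (Q.field t) X), hXx] with x h1 h2 h3
    rw [h2, h1, h3]
  refine ⟨(L2.integrable_inner (𝕜 := ℝ) _ _).congr e1, (L2.integrable_inner (𝕜 := ℝ) _ _).congr e2,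
    R.ham X (R.field t X), ?_, ?_⟩
  · refine (R.hasDerivWithinAt_val ht X).congr_of_mem (fun s hs => ?_) ht
    rw [← h.V_push hs, hpush]
  · rw [← integral_congr_ae e1, ← integral_congr_ae e2]
    have := neg_ham R X (R.field t X)
    rw [L2.inner_def, L2.inner_def] at this
    rw [this, ← h.ext_F, ControlData.ext, hpush]

lemma V_terminal (h : Represents Q P) (m : P2 n) : P.V m P.T = P.FT m := by
  rw [← h.T, h.V_eq (right_mem_Icc.2 Q.T_pos.le), h.FT]
  simp only [Q.val_terminal]

end Represents

end LiftedProblem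
end MFTC

end

theorem mainTheorem8 (n : ℕ) (P : MFTC.ControlData n) (c ν M νT MT : ℝ)
    (hT : 0 < P.T)
    (hN : IsSelfAdjoint P.Nmat)
    (hc : 0 < c) (hν : 0 < ν) (hνT : 0 < νT)
    (hA1 : ∀ x, c * ‖x‖ ^ 2 ≤ ⟪P.S x, x⟫_ℝ)
    (hA2 : MFTC.CoefficientAssumption P.f ν M)
    (hA3 : MFTC.CoefficientAssumption P.h νT MT)
    (hA4 : ‖P.A‖ < M * ‖P.S‖) :
    -- the derivatives of `F` and `F_T` appearing in the forward-backward systems exist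
    (MFTC.HasFunctionalDeriv P.F (MFTC.functionalDeriv P.F) ∧
      MFTC.HasFunctionalDeriv P.FT (MFTC.functionalDeriv P.FT) ∧
      (∀ m, Differentiable ℝ (MFTC.functionalDeriv P.F m)) ∧
      (∀ m, Differentiable ℝ (MFTC.functionalDeriv P.FT m)) ∧
      (∀ m, Differentiable ℝ (MFTC.ControlData.ext m P.F)) ∧
      (∀ m, Differentiable ℝ (MFTC.ControlData.ext m P.FT))) ∧
    -- `V(·, t)` has a functional derivative which is differentiable in `x`
    (∀ t ∈ Set.Icc 0 P.T,
      MFTC.HasFunctionalDeriv (fun m => P.V m t) (MFTC.functionalDeriv fun m => P.V m t) ∧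
      ∀ m, Differentiable ℝ (MFTC.functionalDeriv (fun m' => P.V m' t) m)) ∧
    -- the mean field type control problem on `ℝⁿ`
    (∀ m : MFTC.P2 n, ∀ t ∈ Set.Icc 0 P.T, ∃ Y Z : ℝ → MFTC.E n → MFTC.E n,
      -- the forward-backward system has exactly one solution
      P.IsFBODE m t Y Z ∧
      (∀ Y' Z', P.IsFBODE m t Y' Z' →
        ∀ s ∈ Set.Icc t P.T, ∀ x, Y' s x = Y s x ∧ Z' s x = Z s x) ∧
      -- `-N⁻¹ B* Z` is the unique optimal control, with state `Y`
      P.IsOptimal m t (fun s x => -P.Ninv (P.Bstar (Z s x))) ∧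
      P.IsState m t (fun s x => -P.Ninv (P.Bstar (Z s x))) Y ∧
      (∀ v, P.IsOptimal m t v → ∀ᵐ p ∂((volume.restrict (Set.Ioc t P.T)).prod m.toMeasure),
        v p.1 p.2 = -P.Ninv (P.Bstar (Z p.1 p.2))) ∧
      P.V m t = P.cost m t (fun s x => -P.Ninv (P.Bstar (Z s x))) Y ∧
      -- formula for `dV/dm`, up to the additive constant fixed by the normalisation
      (∃ g : MFTC.E n → ℝ,
        (∀ x, g x =
          (∫ s in t..P.T, MFTC.functionalDeriv P.F (MFTC.push m (Y s)) (Y s x)) +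
          MFTC.functionalDeriv P.FT (MFTC.push m (Y P.T)) (Y P.T x) +
          1 / 2 * ∫ s in t..P.T, ⟪P.Ninv (P.Bstar (Z s x)), P.Bstar (Z s x)⟫_ℝ) ∧
        Integrable g m.toMeasure ∧
        ∀ x, MFTC.functionalDeriv (fun m' => P.V m' t) m x = g x - ∫ ξ, g ξ ∂m.toMeasure) ∧
      -- `D dV/dm (m,t)(x) = Z_{x,m,t}(t)` and the feedback form of `Z`
      (∀ x, MFTC.Ddm (fun m' => P.V m' t) m x = Z t x) ∧
      (∀ s ∈ Set.Icc t P.T, ∀ x,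
        Z s x = MFTC.Ddm (fun m' => P.V m' s) (MFTC.push m (Y s)) (Y s x))) ∧
    -- the problem lifted to `H_m`
    (∀ (m : MFTC.P2 n) (X : MFTC.ControlData.H m), ∀ t ∈ Set.Icc 0 P.T,
      ∃ Y Z : ℝ → MFTC.ControlData.H m,
        P.IsLiftedFBODE m X t Y Z ∧
        (∀ Y' Z', P.IsLiftedFBODE m X t Y' Z' →
          ∀ s ∈ Set.Icc t P.T, Y' s = Y s ∧ Z' s = Z s) ∧
        P.IsLiftedOptimal m X t
          (fun s => -MFTC.ControlData.lift m P.Ninv (MFTC.ControlData.lift m P.Bstar (Z s))) ∧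
        P.IsLiftedState m X t
          (fun s => -MFTC.ControlData.lift m P.Ninv (MFTC.ControlData.lift m P.Bstar (Z s))) Y ∧
        (∀ v, P.IsLiftedOptimal m X t v → ∀ᵐ s ∂(volume.restrict (Set.Ioc t P.T)),
          v s = -MFTC.ControlData.lift m P.Ninv (MFTC.ControlData.lift m P.Bstar (Z s))) ∧
        -- the lifted value depends on `X` only through `X ⊗ m`
        P.liftedV m X t = P.liftedCost m t
          (fun s => -MFTC.ControlData.lift m P.Ninv (MFTC.ControlData.lift m P.Bstar (Z s))) Y ∧
        P.liftedV m X t = P.V (MFTC.push m X) t ∧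
        -- `Z_{Xt}(s) = D_X V(Y_{Xt}(s) ⊗ m, s)`; in particular `D_X V(X ⊗ m, t) = Z_{Xt}(t)`
        (∀ s ∈ Set.Icc t P.T,
          HasGradientAt (MFTC.ControlData.ext m fun m' => P.V m' s) (Z s) (Y s)) ∧
        HasGradientAt (MFTC.ControlData.ext m fun m' => P.V m' t) (Z t) X ∧
        -- `D_X V(X ⊗ m, t) = D dV/dm (X ⊗ m, t)(X)`
        (∀ᵐ ξ ∂m.toMeasure,
          ((gradient (MFTC.ControlData.ext m fun m' => P.V m' t) X : MFTC.ControlData.H m) :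
            MFTC.E n → MFTC.E n) ξ =
            MFTC.Ddm (fun m' => P.V m' t) (MFTC.push m X) ((X : MFTC.E n → MFTC.E n) ξ))) ∧
    -- the lifted Bellman equation has `V(X ⊗ m, t)` as its unique solution
    (∀ m : MFTC.P2 n,
      P.IsLiftedBellmanSolution m (fun X t => P.V (MFTC.push m X) t) ∧
      ∀ W, P.IsLiftedBellmanSolution m W →
        ∀ X, ∀ t ∈ Set.Icc 0 P.T, W X t = P.V (MFTC.push m X) t) ∧
    -- the Bellman equation on `P₂(ℝⁿ)`
    (∀ m : MFTC.P2 n,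
      (∀ t ∈ Set.Icc 0 P.T,
        Integrable (fun x => ⟪MFTC.Ddm (fun m' => P.V m' t) m x, P.A x⟫_ℝ) m.toMeasure ∧
        Integrable (fun x => ⟪MFTC.Ddm (fun m' => P.V m' t) m x,
          P.S (MFTC.Ddm (fun m' => P.V m' t) m x)⟫_ℝ) m.toMeasure ∧
        ∃ w : ℝ, HasDerivWithinAt (fun s => P.V m s) w (Set.Icc 0 P.T) t ∧
          -w - (∫ x, ⟪MFTC.Ddm (fun m' => P.V m' t) m x, P.A x⟫_ℝ ∂m.toMeasure) +
            1 / 2 * (∫ x, ⟪MFTC.Ddm (fun m' => P.V m' t) m x,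
              P.S (MFTC.Ddm (fun m' => P.V m' t) m x)⟫_ℝ ∂m.toMeasure) = P.F m) ∧
      P.V m P.T = P.FT m) := by
  obtain ⟨Q, h⟩ := MFTC.exists_represents P hT hN hc hν hνT hA1 hA2 hA3
  refine ⟨⟨?_, ?_, fun m x => ?_, fun m x => ?_, fun m X => ?_, fun m X => ?_⟩,
    fun t ht => ?_, fun m t ht => h.exists_optimal m ht,
    fun m X t ht => h.exists_lifted_optimal m X ht,
    fun m => ⟨h.isLiftedBellmanSolution m, fun W hW X t ht =>
      h.eq_of_isLiftedBellmanSolution hW X ht⟩,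
    fun m => ⟨fun t ht => h.bellman m ht, h.V_terminal m⟩⟩
  · exact (MFTC.quadLip_l Q).hasFunctionalDeriv_functionalDeriv h.F
  · exact (MFTC.quadLip_lT Q).hasFunctionalDeriv_functionalDeriv h.FT
  · exact ((MFTC.quadLip_l Q).hasGradientAt_functionalDeriv h.F Q.hasGradientAt_l m
      x).differentiableAt
  · exact ((MFTC.quadLip_lT Q).hasGradientAt_functionalDeriv h.FT Q.hasGradientAt_lT m
      x).differentiableAt
  · rw [h.ext_F]
    exact ((Q.lifted m).hasGradientAt_l X).differentiableAt
  · rw [h.ext_FT]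
    exact ((Q.lifted m).hasGradientAt_lT X).differentiableAt
  · rw [← h.T] at ht
    exact ⟨h.hasFunctionalDeriv_V ht, fun m x =>
      (h.hasGradientAt_functionalDeriv_V ht m x).differentiableAt⟩
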